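/- Let $(M,\lambda)$ be an exact symplectic manifold, i.e. $\lambda$ is a smooth one-form on the (finite-dimensional, Hausdorff, second countable, boundaryless) manifold $M$ such that $\omega=d\lambda$ is non-degenerate. Let $Y$ be the Liouville vector field, $\lambda=\omega(Y,\cdot)$, and for $h\in C^\infty(M)$ let $X_h$ be the Hamiltonian vector field, $dh=\omega(\cdot,X_h)$. Let $L_0,L_1\subset M$ be exact Lagrangians, i.e. embedded Lagrangian submanifolds, closed as subsets of $M$, with $\lambda|_{L_0}=0$ and $\lambda|_{L_1}=0$. Let $H\colon M\times[0,1]\to\mathbb{R}$ be smooth, $H_\mu:=H(\cdot,\mu)$, $\Sigma_\mu:=H_\mu^{-1}(0)$, and assume that $0$ is a regular value of $H_\mu$ for every $\mu\in[0,1]$, that $H^{-1}(0)\subset M\times[0,1]$ is compact, and that $dH_\mu(Y)>0$ along $\Sigma_\mu$ for every $\mu\in[0,1]$. (It follows that $\Sigma_\mu$ is transverse to $L_0$ and $L_1$.) Let $\mathcal{P}$ be the space of smooth paths $v\colon[0,1]\to M$ with $v(0)\in L_0$ and $v(1)\in L_1$, with the $C^\infty$-topology. A chord on $\Sigma_\mu$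 is a pair $(v,\tau)\in\mathcal{P}\times(0,\infty)$ with $v([0,1])\subset\Sigma_\mu$ and $\partial_t v=\tau X_{H_\mu}(v)$. It is called non-degenerate if, for $\Phi\colon(L_0\cap\Sigma_\mu)\times(0,\infty)\to\Sigma_\mu$, $\Phi(x,s)=\phi^s_{H_\mu}(x)$, where $\phi^s_{H_\mu}$ is the flow of $X_{H_\mu}$, the map $\Phi$ is transverse to $L_1\cap\Sigma_\mu$ at $(v(0),\tau)$, i.e. $$d\Phi(v(0),\tau)\,T_{(v(0),\tau)}\big((L_0\cap\Sigma_\mu)\times(0,\infty)\big)\oplus T_{v(1)}(L_1\cap\Sigma_\mu)=T_{v(1)}\Sigma_\mu,$$ and degenerate otherwise. The Rabinowitz action functional is $\mathcal{A}^{h}(v,\tau)=\int_0^1 v^*\lambda-\tau\int_0^1 h(v(t))\,dt$ on $\mathcal{P}\times(0,\infty)$. Let $\mu_\infty\in(0,1]$ and let $(v_\mu,\tau_\mu)$, $\mu\in[0,\mu_\infty)$, be a family such that $(v_\mu,\tau_\mu)$ is a non-degenerate chord on $\Sigma_\mu$ for every $\mu$, and $(t,\mu)\mapsto v_\mu(t)$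 and $\mu\mapsto\tau_\mu$ are smooth. Assume that $\mu_\infty$ is maximal, i.e. for no $b\in(\mu_\infty,1]$ does there exist such a family on $[0,b)$ with the same chord $(v_0,\tau_0)$ at $\mu=0$. Let $\Omega\subset\mathcal{P}\times(0,\infty)$ be the Omega limit set, consisting of all $(w,\sigma)\in\mathcal{P}\times(0,\infty)$ for which there is a sequence $\mu_\nu\in[0,\mu_\infty)$ with $\mu_\nu\to\mu_\infty$ and $(v_{\mu_\nu},\tau_{\mu_\nu})\to(w,\sigma)$. Then $\Omega$ is nonempty, compact and connected, it consists of chords on $\Sigma_{\mu_\infty}$, and $\mathcal{A}^{H_{\mu_\infty}}$ is constant on $\Omega$. If $\mu_\infty<1$, then all chords in $\Omega$ are degenerate. If $\mu_\infty=1$ and $\Omega$ consists of more than one chord, then again all chords in $\Omega$ are degenerate. -/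

import Mathlib

open Set Filter Topology
open scoped Manifold ContDiff

noncomputable section

namespace Chords

variable {E : Type*} [NormedAddCommGroup E] [NormedSpace ℝ E]
  {M : Type*} [TopologicalSpace M] [ChartedSpace E M]

/-! ### One-forms and exact symplectic structures -/

/-- A (not necessarily smooth) one-form on the manifold `M`. -/
abbrev OneForm (E : Type*) [NormedAddCommGroup E] [NormedSpace ℝ E]
    (M : Type*) [TopologicalSpace M] [ChartedSpace E M] : Type _ :=
  (x : M) → TangentSpace 𝓘(ℝ, E) x →L[ℝ] ℝ

/-- Smoothness of a one-form, as a section of the cotangent bundle. -/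
def SmoothOneForm [IsManifold 𝓘(ℝ, E) ∞ M] (lam : OneForm E M) : Prop :=
  ContMDiff 𝓘(ℝ, E) (𝓘(ℝ, E).prod 𝓘(ℝ, E →L[ℝ] ℝ)) ∞
    (fun x => (Bundle.TotalSpace.mk' (E →L[ℝ] ℝ) x (lam x) :
      Bundle.TotalSpace (E →L[ℝ] ℝ) (fun x : M => TangentSpace 𝓘(ℝ, E) x →L[ℝ] ℝ)))

/-- The one-form `lam` written in the chart around `x`, i.e. pulled back by the inverse chart. -/
def chartForm (lam : OneForm E M) (x : M) : OneForm E E := fun y =>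
  (lam ((extChartAt 𝓘(ℝ, E) x).symm y)).comp
    (mfderiv 𝓘(ℝ, E) 𝓘(ℝ, E) (extChartAt 𝓘(ℝ, E) x).symm y)

/-- The exterior derivative `ω = dλ` at `x`: the exterior derivative of the expression of `λ` in the
chart around `x`, pulled back by the differential of this chart. -/
def omega (lam : OneForm E M) (x : M) (u w : TangentSpace 𝓘(ℝ, E) x) : ℝ :=
  extDeriv (fun y => ContinuousAlternatingMap.ofSubsingleton ℝ E ℝ (0 : Fin 1) (chartForm lam x y))
    (extChartAt 𝓘(ℝ, E) x x)
    ![(mfderiv 𝓘(ℝ, E) 𝓘(ℝ, E) (extChartAt 𝓘(ℝ, E) x) x u : E),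
      (mfderiv 𝓘(ℝ, E) 𝓘(ℝ, E) (extChartAt 𝓘(ℝ, E) x) x w : E)]

/-- `(M, λ)` is an exact symplectic manifold: `λ` is smooth and `dλ` is non-degenerate. -/
def IsExactSymplectic [IsManifold 𝓘(ℝ, E) ∞ M] (lam : OneForm E M) : Prop :=
  SmoothOneForm lam ∧
    ∀ (x : M) (u : TangentSpace 𝓘(ℝ, E) x),
      (∀ w : TangentSpace 𝓘(ℝ, E) x, omega lam x u w = 0) → u = 0

/-- The differential of a function on `M`, as a one-form. -/
def diff (h : M → ℝ) : OneForm E M := fun x => mfderiv 𝓘(ℝ, E) 𝓘(ℝ, ℝ) h x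

/-- The Hamiltonian vector field: the vector `X` with `dh = ω(·, X)`
(unique, and existing, when `ω` is non-degenerate). -/
def hamVF (lam : OneForm E M) (h : M → ℝ) (x : M) : TangentSpace 𝓘(ℝ, E) x :=
  Classical.epsilon fun X : TangentSpace 𝓘(ℝ, E) x =>
    ∀ u : TangentSpace 𝓘(ℝ, E) x, diff (E := E) h x u = omega lam x u X

/-- The Liouville vector field: the vector `Y` with `λ = ω(Y, ·)`
(unique, and existing, when `ω` is non-degenerate). -/
def liouvilleVF (lam : OneForm E M) (x : M) : TangentSpace 𝓘(ℝ, E) x :=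
  Classical.epsilon fun Y : TangentSpace 𝓘(ℝ, E) x =>
    ∀ u : TangentSpace 𝓘(ℝ, E) x, lam x u = omega lam x Y u

/-! ### Exact Lagrangian submanifolds -/

/-- `L` is an embedded smooth submanifold without boundary: around each of its points it is given,
in a chart of the smooth structure of `M`, by a linear subspace. -/
def IsSubmanifold (E : Type*) [NormedAddCommGroup E] [NormedSpace ℝ E]
    {M : Type*} [TopologicalSpace M] [ChartedSpace E M] (L : Set M) : Prop :=
  ∀ x ∈ L, ∃ φ ∈ IsManifold.maximalAtlas 𝓘(ℝ, E) ∞ M, x ∈ φ.source ∧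
    ∃ W : Submodule ℝ E, ∀ y ∈ φ.source, y ∈ L ↔ φ y ∈ W

/-- The tangent space at `x` of a submanifold `L` of `M`, spanned by the velocities of curves
in `L` through `x` (for a submanifold these velocities already form a linear subspace). -/
def tangent (L : Set M) (x : M) : Submodule ℝ (TangentSpace 𝓘(ℝ, E) x) :=
  Submodule.span ℝ {u | ∃ c : ℝ → M, c 0 = x ∧ (∀ᶠ t in 𝓝 (0 : ℝ), c t ∈ L) ∧
    ∃ c' : ℝ →L[ℝ] E, HasMFDerivAt 𝓘(ℝ, ℝ) 𝓘(ℝ, E) c 0 c' ∧ c' 1 = u}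

/-- `L` is an exact Lagrangian: an embedded submanifold, closed as a subset of `M`, whose tangent
spaces coincide with their `ω`-orthogonal complements, and on which `λ` vanishes. -/
def IsExactLagrangian (lam : OneForm E M) (L : Set M) : Prop :=
  IsClosed L ∧ IsSubmanifold E L ∧
    (∀ x ∈ L, ∀ u : TangentSpace 𝓘(ℝ, E) x,
      u ∈ tangent L x ↔ ∀ w ∈ tangent (E := E) L x, omega lam x u w = 0) ∧
    (∀ x ∈ L, ∀ u ∈ tangent (E := E) L x, lam x u = 0)

/-! ### Paths and the Rabinowitz action functional -/

/-- The space `𝓟` of smooth paths `[0,1] → M` from `L₀` to `L₁`. -/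
@[ext]
structure PathSpace (E : Type*) [NormedAddCommGroup E] [NormedSpace ℝ E]
    {M : Type*} [TopologicalSpace M] [ChartedSpace E M] (L₀ L₁ : Set M) where
  /-- the underlying map -/
  toFun : Icc (0 : ℝ) 1 → M
  smooth : ContMDiff (𝓡∂ 1) 𝓘(ℝ, E) ∞ toFun
  source : toFun 0 ∈ L₀
  target : toFun 1 ∈ L₁

variable {L₀ L₁ : Set M}

/-- The path as a function on `ℝ`, constant on `(-∞,0]` and on `[1,∞)`; only its values and its
one-sided derivatives within `[0,1]` are used. -/
def PathSpace.extend (v : PathSpace E L₀ L₁) : ℝ → M :=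
  IccExtend (zero_le_one' ℝ) v.toFun

/-- The `C^∞`-topology on `𝓟`: the coarsest topology such that for every smooth function `g` on `M`
and every `k`, the map `v ↦ (g ∘ v)^(k)` is continuous for uniform convergence on `[0,1]`.
(Embedding `M` properly in some `ℝ^N` shows that this is the usual topology of uniform convergence
of all derivatives.) -/
instance : TopologicalSpace (PathSpace E L₀ L₁) :=
  ⨅ (g : {g : M → ℝ // ContMDiff 𝓘(ℝ, E) 𝓘(ℝ, ℝ) ∞ g}) (k : ℕ),
    TopologicalSpace.induced
      (fun v : PathSpace E L₀ L₁ => UniformOnFun.ofFun {Icc (0 : ℝ) 1}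
        (iteratedDerivWithin k (fun t => g.1 (v.extend t)) (Icc 0 1)))
      inferInstance

/-- The Rabinowitz action functional
`𝓐^h(v, τ) = ∫₀¹ v^*λ - τ ∫₀¹ h(v(t)) dt` on `𝓟 × (0,∞)`. -/
def action (lam : OneForm E M) (h : M → ℝ) (p : PathSpace E L₀ L₁ × Ioi (0 : ℝ)) : ℝ :=
  (∫ t in (0 : ℝ)..1, lam (p.1.extend t)
      (mfderivWithin 𝓘(ℝ, ℝ) 𝓘(ℝ, E) p.1.extend (Icc 0 1) t (1 : ℝ)))
    - (p.2 : ℝ) * ∫ t in (0 : ℝ)..1, h (p.1.extend t)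

/-! ### Chords and non-degeneracy -/

/-- `(v, τ)` is a chord: `v` lies in `Σ = h⁻¹(0)` and `∂ₜ v = τ X_h(v)`
(the boundary conditions and `τ > 0` are built into the type). -/
def IsChord (lam : OneForm E M) (h : M → ℝ) (p : PathSpace E L₀ L₁ × Ioi (0 : ℝ)) : Prop :=
  (∀ t ∈ Icc (0 : ℝ) 1, h (p.1.extend t) = 0) ∧
    IsMIntegralCurveOn (I := 𝓘(ℝ, E)) p.1.extend (fun x => (p.2 : ℝ) • hamVF lam h x) (Icc 0 1)

/-- `y` is reached from `x` at time `t` along the vector field `X`. -/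
def Reaches (X : (x : M) → TangentSpace 𝓘(ℝ, E) x) (t : ℝ) (x y : M) : Prop :=
  ∃ c : ℝ → M, c 0 = x ∧ c t = y ∧ IsMIntegralCurveOn (I := 𝓘(ℝ, E)) c X (uIcc 0 t)

open Classical in
/-- The (local) flow `φ^t(x)` of the vector field `X`; it is given the irrelevant value `x` where
the solution starting at `x` does not exist up to time `t`. -/
def flow (X : (x : M) → TangentSpace 𝓘(ℝ, E) x) (t : ℝ) (x : M) : M :=
  if hy : ∃ y, Reaches X t x y then hy.choose else x

/-- The tangent space at `x` of the level set `Σ = h⁻¹(0)`, `0` being a regular value of `h`. -/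
def tangentLevel (h : M → ℝ) (x : M) : Submodule ℝ (TangentSpace 𝓘(ℝ, E) x) :=
  LinearMap.ker (diff (E := E) h x).toLinearMap

/-- The tangent space at `x` of the (transverse) intersection `L ∩ Σ`. Transversality is automatic
for an exact Lagrangian `L` and a level set satisfying the contact condition, since the Liouville
vector field is tangent to `L` and transverse to `Σ`. -/
def tangentInter (L : Set M) (h : M → ℝ) (x : M) : Submodule ℝ (TangentSpace 𝓘(ℝ, E) x) :=
  tangent L x ⊓ tangentLevel h x

/-- The image of `dΦ` at `(x, τ)`, where `Φ : (L₀ ∩ Σ) × (0,∞) → Σ`, `Φ(x,τ) = φ^τ(x)`, and `φ` is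
the flow of `X_h`. It is obtained by restricting the differential of `(x, τ) ↦ φ^τ(x)` on (an open
subset of) `M × ℝ` to `T_x(L₀ ∩ Σ) × ℝ`. -/
def imageDPhi (lam : OneForm E M) (h : M → ℝ) (L : Set M) (x : M) (τ : ℝ) :
    Submodule ℝ (TangentSpace 𝓘(ℝ, E) (flow (hamVF lam h) τ x)) :=
  Submodule.map
    (mfderiv (𝓘(ℝ, E).prod 𝓘(ℝ, ℝ)) 𝓘(ℝ, E)
      (fun q : M × ℝ => flow (hamVF lam h) q.2 q.1) (x, τ)).toLinearMap
    ((tangentInter (E := E) L h x).prod (⊤ : Submodule ℝ ℝ))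

/-- A chord is non-degenerate if `dΦ(T(L₀ ∩ Σ) × ℝ) ⊕ T(L₁ ∩ Σ) = TΣ` (an internal direct sum)
at the end point `Φ(v(0), τ) = v(1)`. -/
def Nondegenerate (lam : OneForm E M) (h : M → ℝ) (p : PathSpace E L₀ L₁ × Ioi (0 : ℝ)) : Prop :=
  let x := p.1.toFun 0
  let y := flow (hamVF lam h) (p.2 : ℝ) x
  imageDPhi lam h L₀ x p.2 ⊔ tangentInter (E := E) L₁ h y = tangentLevel h y ∧
    Disjoint (imageDPhi lam h L₀ x p.2) (tangentInter (E := E) L₁ h y)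

/-! ### Families of Hamiltonians and of chords -/

/-- A smooth family `H_μ`, `μ ∈ [0,1]`, of Hamiltonians on `M`, with `0` a regular value of each
`H_μ`, with `{(x, μ) | H_μ(x) = 0}` compact, and such that every `Σ_μ = H_μ⁻¹(0)` satisfies the
contact condition `dH_μ(Y) > 0`, where `Y` is the Liouville vector field. -/
structure IsContactFamily (lam : OneForm E M) (H : ℝ → M → ℝ) : Prop where
  smooth : ContMDiffOn (𝓘(ℝ, E).prod 𝓘(ℝ, ℝ)) 𝓘(ℝ, ℝ) ∞ (fun q : M × ℝ => H q.2 q.1)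
    (univ ×ˢ Icc 0 1)
  regular : ∀ μ ∈ Icc (0 : ℝ) 1, ∀ x, H μ x = 0 → diff (E := E) (H μ) x ≠ 0
  compact : IsCompact {q : M × ℝ | q.2 ∈ Icc (0 : ℝ) 1 ∧ H q.2 q.1 = 0}
  contact : ∀ μ ∈ Icc (0 : ℝ) 1, ∀ x, H μ x = 0 → 0 < diff (H μ) x (liouvilleVF lam x)

/-- `μ ↦ c μ = (v_μ, τ_μ)`, `μ ∈ [0, b)`, is a smooth family of non-degenerate chords on `Σ_μ`
starting at `c₀`. -/
structure IsChordFamily (lam : OneForm E M) (H : ℝ → M → ℝ)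
    (c₀ : PathSpace E L₀ L₁ × Ioi (0 : ℝ)) (b : ℝ)
    (c : ℝ → PathSpace E L₀ L₁ × Ioi (0 : ℝ)) : Prop where
  start : c 0 = c₀
  smooth_path : ContMDiffOn 𝓘(ℝ, ℝ × ℝ) 𝓘(ℝ, E) ∞ (fun q : ℝ × ℝ => (c q.2).1.extend q.1)
    (Icc 0 1 ×ˢ Ico 0 b)
  smooth_period : ContDiffOn ℝ ∞ (fun μ => ((c μ).2 : ℝ)) (Ico 0 b)
  chord : ∀ μ ∈ Ico 0 b, IsChord lam (H μ) (c μ)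
  nondegenerate : ∀ μ ∈ Ico 0 b, Nondegenerate lam (H μ) (c μ)

/-- The Omega limit set of the family `c μ`, `μ ∈ [0, b)`, as `μ → b`. -/
def omegaLimitSet (b : ℝ) (c : ℝ → PathSpace E L₀ L₁ × Ioi (0 : ℝ)) :
    Set (PathSpace E L₀ L₁ × Ioi (0 : ℝ)) :=
  {p | ∃ m : ℕ → ℝ, (∀ n, m n ∈ Ico 0 b) ∧ Tendsto m atTop (𝓝 b) ∧
    Tendsto (fun n => c (m n)) atTop (𝓝 p)}

end Chords

end

/-! A chord on `Σ_μ` is determined by its initial point `x ∈ L₀`, the parameter `μ` and the period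
`τ`. The family is therefore a curve in the finite-dimensional space of triples `(x, μ, τ)`, and the
argument takes place there.

Compactness. On a chord `H_μ` vanishes, so its action is `A = τ ∫ λ(X_H) = τ ∫ dH_μ(Y)`. On the
compact set `H⁻¹(0)` the function `dH_μ(Y)` lies between two positive constants, so `A` and `τ`
bound each other. Since `λ` vanishes on `L₀` and `L₁`, no boundary terms occur in the first
variation, and `dA/dμ = -τ ∫ ∂_μ H` along the family (`hasDerivAt_chordAction`). Hence `|A'| ≤ C A`,
so `log A` is Lipschitz, `A` has a positive limit, and `τ` stays in a compact subinterval of `(0,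
∞)` (`exists_tendsto_chordAction`). The curve of triples eventually remains in a compact set of
chord data. Its set of limit points is then nonempty, compact and, as for any such continuous curve,
connected (`isPreconnected_clusterSet`). All limit points are chord data at `μ_∞` with the same
action. Since the flow is smooth, a triple determines its path continuously for the `C^∞`-topology,
and `Ω` is the image of this cluster set (`omegaLimitSet_eq`).

Degeneracy. A dimension count shows that non-degeneracy of a chord means that the differential of
the equations "start on `L₀`, energy zero, end on `L₁`, prescribed `μ`" is bijective. By the inverse
function theorem, the chords near a non-degenerate one form a smooth branch over `μ`, again
non-degenerate, with a single chord for each `μ` (`exists_branch`). A non-degenerate chord of `Ω` is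
thus isolated in `Ω`, hence the only point of the connected set `Ω`. The family then runs into the
branch. If `μ_∞ < 1`, continuing along the branch contradicts maximality (`exists_extension`).

Two devices make the flow globally smooth. The substitution `μ = (1 - cos s) / 2` turns a family
smooth over `[0,1]` into one smooth over `ℝ`, and a cut-off equal to `1` near all zero sets makes
the Hamiltonian fields complete without altering any chord. Smooth dependence of flows on time,
point and parameter is obtained from the inverse function theorem in a space of continuous curves.
-/

namespace Chords

set_option linter.unusedSectionVars false

/-! ### Smooth dependence of solutions of ordinary differential equations -/

section BanachODE

universe u

/-- The inverse function theorem, with a smooth inverse and invertible derivatives on a whole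
neighbourhood. -/
theorem exists_smooth_localInverse {A B : Type*} [NormedAddCommGroup A] [NormedSpace ℝ A]
    [CompleteSpace A] [NormedAddCommGroup B] [NormedSpace ℝ B]
    {f : A → B} {U : Set A} (hU : IsOpen U) (hf : ContDiffOn ℝ ∞ f U) {a : A} (ha : a ∈ U)
    (f' : A ≃L[ℝ] B) (hf' : fderiv ℝ f a = f') :
    ∃ e : OpenPartialHomeomorph A B, a ∈ e.source ∧ e.source ⊆ U ∧ (∀ x, e x = f x) ∧
      ContDiffOn ℝ ∞ e.symm e.target ∧
      ∀ x ∈ e.source, Function.Injective (fderiv ℝ f x) := by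
  have hfa : ContDiffAt ℝ ∞ f a := hf.contDiffAt (hU.mem_nhds ha)
  have hne : (∞ : WithTop ℕ∞) ≠ 0 := by simp
  have hd : HasFDerivAt f (f' : A →L[ℝ] B) a := by
    rw [← hf']; exact (hfa.differentiableAt hne).hasFDerivAt
  -- Isomorphisms form an open set, so the derivative stays invertible on a neighbourhood. This
  -- later makes non-degeneracy persist along a branch of chords.
  set V : Set A := U ∩ fderiv ℝ f ⁻¹' range ContinuousLinearEquiv.toContinuousLinearMap with hVdef
  have hV : IsOpen V := by
    have hc : ContinuousOn (fderiv ℝ f) U := hf.continuousOn_fderiv_of_isOpen hU (by simp)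
    exact hc.isOpen_inter_preimage hU ContinuousLinearEquiv.isOpen
  have haV : a ∈ V := ⟨ha, ⟨f', hf'.symm⟩⟩
  refine ⟨(hfa.toOpenPartialHomeomorph f hd hne).restrOpen V hV,
    ⟨hfa.mem_toOpenPartialHomeomorph_source hd hne, haV⟩, fun x hx => hx.2.1, fun x => rfl, ?_, ?_⟩
  · intro y hy
    apply ContDiffAt.contDiffWithinAt
    set e := (hfa.toOpenPartialHomeomorph f hd hne).restrOpen V hV with he
    have hx : e.symm y ∈ e.source := e.map_target hy
    have hxV : e.symm y ∈ V := hx.2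
    obtain ⟨g, hg⟩ := hxV.2
    refine e.contDiffAt_symm hy (f₀' := g) ?_ ?_
    · rw [hg]
      exact ((hf.contDiffAt (hU.mem_nhds hxV.1)).differentiableAt hne).hasFDerivAt
    · exact hf.contDiffAt (hU.mem_nhds hxV.1)
  · intro x hx
    obtain ⟨g, hg⟩ := hx.2.2
    rw [← hg]
    exact g.injective

variable {K : Type*} [TopologicalSpace K] [CompactSpace K]

/-- A continuous family of operators acts on continuous maps. -/
noncomputable def familyCLM (K : Type*) [TopologicalSpace K] [CompactSpace K] (V W : Type*)
    [NormedAddCommGroup V] [NormedSpace ℝ V] [NormedAddCommGroup W] [NormedSpace ℝ W] :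
    C(K, V →L[ℝ] W) →L[ℝ] C(K, V) →L[ℝ] C(K, W) :=
  LinearMap.mkContinuous₂
    (LinearMap.mk₂ ℝ (fun (A : C(K, V →L[ℝ] W)) (η : C(K, V)) =>
        (⟨fun t => A t (η t), by fun_prop⟩ : C(K, W)))
      (fun _ _ _ => by ext; simp) (fun _ _ _ => by ext; simp)
      (fun _ _ _ => by ext; simp) (fun _ _ _ => by ext; simp)) 1 (by
    intro A η
    rw [ContinuousMap.norm_le _ (by positivity)]
    intro t
    simp only [LinearMap.mk₂_apply, ContinuousMap.coe_mk, one_mul]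
    exact ((A t).le_opNorm _).trans
      (mul_le_mul (A.norm_coe_le_norm t) (η.norm_coe_le_norm t) (norm_nonneg _) (norm_nonneg A)))

@[simp] theorem familyCLM_apply {V W : Type*}
    [NormedAddCommGroup V] [NormedSpace ℝ V] [NormedAddCommGroup W] [NormedSpace ℝ W]
    (A : C(K, V →L[ℝ] W)) (η : C(K, V)) (t : K) : familyCLM K V W A η t = A t (η t) := rfl

/-- Near the compact range of `γ` the derivative `f'` is uniformly close to its values on the range,
so the mean value inequality bounds the remainder uniformly in `t`. -/
theorem hasFDerivAt_postcomp {V W : Type*}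
    [NormedAddCommGroup V] [NormedSpace ℝ V] [NormedAddCommGroup W] [NormedSpace ℝ W]
    (f : C(V, W)) (f' : C(V, V →L[ℝ] W)) (hf : ∀ x, HasFDerivAt f (f' x) x) (γ : C(K, V)) :
    HasFDerivAt (fun γ : C(K, V) => f.comp γ) (familyCLM K V W (f'.comp γ)) γ := by
  rw [hasFDerivAt_iff_isLittleO_nhds_zero, Asymptotics.isLittleO_iff]
  intro ε hε
  have hcpt : IsCompact (range γ) := isCompact_range γ.continuous
  have huc := hcpt.uniformContinuousAt_of_continuousAt f' (fun a _ => f'.continuous.continuousAt)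
    (Metric.dist_mem_uniformity hε)
  obtain ⟨δ, hδ, hball⟩ := Metric.mem_uniformity_dist.1 huc
  filter_upwards [Metric.ball_mem_nhds (0 : C(K, V)) hδ] with h hh
  rw [ContinuousMap.norm_le _ (by positivity)]
  intro t
  have hht : ‖h t‖ < δ := (h.norm_coe_le_norm t).trans_lt (by simpa using hh)
  have key := (convex_ball (γ t) δ).norm_image_sub_le_of_norm_hasFDerivWithin_le'
    (f := f) (f' := f') (φ := f' (γ t)) (C := ε) (x := γ t) (y := γ t + h t)
    (fun x _ => (hf x).hasFDerivWithinAt)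
    (fun x hx => by
      have := hball (a := γ t) (b := x) (by rw [dist_comm]; exact hx) ⟨t, rfl⟩
      rw [← dist_eq_norm, dist_comm]
      exact le_of_lt this)
    (Metric.mem_ball_self hδ) (by simpa using hht)
  simp only [add_sub_cancel_left] at key
  simpa using key.trans (mul_le_mul_of_nonneg_left (h.norm_coe_le_norm t) hε.le)

/-- The derivative of `γ ↦ f ∘ γ` is again a postcomposition, with `f'`, followed by a bounded
linear map, which permits induction on `n`. The target `W` varies in the induction, and the common
universe keeps `V →L[ℝ] W` admissible. -/
theorem contDiff_postcomp_nat {V : Type u} [NormedAddCommGroup V] [NormedSpace ℝ V] (n : ℕ) :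
    ∀ {W : Type u} [NormedAddCommGroup W] [NormedSpace ℝ W] (f : C(V, W)),
      ContDiff ℝ n f → ContDiff ℝ n (fun γ : C(K, V) => f.comp γ) := by
  induction n with
  | zero =>
    intro W _ _ f _
    exact contDiff_zero.2 (ContinuousMap.continuous_postcomp f)
  | succ n ih =>
    intro W _ _ f hf
    obtain ⟨f', hf', hd⟩ := contDiff_succ_iff_hasFDerivAt.1 hf
    refine contDiff_succ_iff_hasFDerivAt.2
      ⟨fun γ => familyCLM K V W ((⟨f', hf'.continuous⟩ : C(V, V →L[ℝ] W)).comp γ), ?_, ?_⟩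
    · exact (familyCLM K V W).contDiff.comp (ih ⟨f', hf'.continuous⟩ hf')
    · exact fun γ => hasFDerivAt_postcomp f ⟨f', hf'.continuous⟩ hd γ

theorem contDiff_postcomp {V W : Type u} [NormedAddCommGroup V] [NormedSpace ℝ V]
    [NormedAddCommGroup W] [NormedSpace ℝ W] (f : C(V, W)) (hf : ContDiff ℝ ∞ f) :
    ContDiff ℝ ∞ (fun γ : C(K, V) => f.comp γ) :=
  contDiff_infty.2 fun n => contDiff_postcomp_nat n f (contDiff_infty.1 hf n)

theorem neg_one_le_one' : (-1 : ℝ) ≤ 1 := by norm_num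

/-- Integration from `0`, as an operator on continuous functions on `[-1, 1]`. -/
noncomputable def primitiveCLM (V : Type*) [NormedAddCommGroup V] [NormedSpace ℝ V] :
    C(Icc (-1 : ℝ) 1, V) →L[ℝ] C(Icc (-1 : ℝ) 1, V) :=
  LinearMap.mkContinuous
    { toFun := fun η => ⟨fun t => ∫ x in (0 : ℝ)..t, IccExtend neg_one_le_one' η x,
        (intervalIntegral.continuous_primitive
          (fun a b => (η.continuous.Icc_extend' (h := neg_one_le_one')).intervalIntegrable a b) 0).comp
            continuous_subtype_val⟩
      map_add' := fun η ζ => by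
        ext t
        simp only [ContinuousMap.coe_mk, ContinuousMap.coe_add, ContinuousMap.add_apply]
        rw [← intervalIntegral.integral_add
          ((η.continuous.Icc_extend' (h := neg_one_le_one')).intervalIntegrable _ _)
          ((ζ.continuous.Icc_extend' (h := neg_one_le_one')).intervalIntegrable _ _)]
        rfl
      map_smul' := fun c η => by
        ext t
        simp only [ContinuousMap.coe_mk, ContinuousMap.coe_smul, ContinuousMap.smul_apply,
          RingHom.id_apply]
        rw [← intervalIntegral.integral_smul]
        rfl } 1 (by
    intro η
    rw [ContinuousMap.norm_le _ (by positivity)]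
    intro t
    simp only [LinearMap.coe_mk, AddHom.coe_mk, ContinuousMap.coe_mk, one_mul]
    refine (intervalIntegral.norm_integral_le_of_norm_le_const
      (C := ‖η‖) (fun x _ => η.norm_coe_le_norm _)).trans ?_
    have : |(t : ℝ) - 0| ≤ 1 := by rw [sub_zero]; exact abs_le.2 t.2
    nlinarith [norm_nonneg η])

theorem primitiveCLM_apply {V : Type*} [NormedAddCommGroup V] [NormedSpace ℝ V]
    (η : C(Icc (-1 : ℝ) 1, V)) (t : Icc (-1 : ℝ) 1) :
    primitiveCLM V η t = ∫ x in (0 : ℝ)..t, IccExtend neg_one_le_one' η x := rfl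

/-- The defect of `γ` as a solution of `γ' = τ F(γ)`, `γ(0) = v`. -/
noncomputable def odeDefect {V : Type*} [NormedAddCommGroup V] [NormedSpace ℝ V] (F : C(V, V))
    (q : (V × ℝ) × C(Icc (-1 : ℝ) 1, V)) : C(Icc (-1 : ℝ) 1, V) :=
  q.2 - ContinuousLinearMap.const ℝ _ q.1.1 - q.1.2 • primitiveCLM V (F.comp q.2)

theorem odeDefect_eq_zero_iff {V : Type*} [NormedAddCommGroup V] [NormedSpace ℝ V] (F : C(V, V))
    (v : V) (τ : ℝ) (γ : C(Icc (-1 : ℝ) 1, V)) :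
    odeDefect F ((v, τ), γ) = 0 ↔ ∀ t : Icc (-1 : ℝ) 1,
      γ t = v + τ • ∫ x in (0 : ℝ)..t, F (IccExtend neg_one_le_one' γ x) := by
  rw [ContinuousMap.ext_iff]
  refine forall_congr' fun t => ?_
  simp only [odeDefect, ContinuousMap.sub_apply, ContinuousMap.smul_apply,
    primitiveCLM_apply, ContinuousMap.zero_apply]
  rw [sub_sub, sub_eq_zero]
  exact Iff.rfl

theorem contDiff_odeDefect {V : Type*} [NormedAddCommGroup V] [NormedSpace ℝ V] (F : C(V, V))
    (hF : ContDiff ℝ ∞ F) : ContDiff ℝ ∞ (odeDefect F) := by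
  have h1 : ContDiff ℝ ∞ (fun q : (V × ℝ) × C(Icc (-1 : ℝ) 1, V) =>
      primitiveCLM V (F.comp q.2)) :=
    (primitiveCLM V).contDiff.comp ((contDiff_postcomp F hF).comp contDiff_snd)
  have h2 : ContDiff ℝ ∞ (fun q : (V × ℝ) × C(Icc (-1 : ℝ) 1, V) =>
      (ContinuousLinearMap.const ℝ (Icc (-1 : ℝ) 1) q.1.1 : C(Icc (-1 : ℝ) 1, V))) :=
    (ContinuousLinearMap.const ℝ (M := V) (Icc (-1 : ℝ) 1)).contDiff.comp
      (contDiff_fst.comp contDiff_fst)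
  exact (contDiff_snd.sub h2).sub ((contDiff_snd.comp contDiff_fst).smul h1)

/-- A linear shear. -/
def shearEquiv {A B : Type*} [NormedAddCommGroup A] [NormedSpace ℝ A]
    [NormedAddCommGroup B] [NormedSpace ℝ B] (L : A →L[ℝ] B) : (A × B) ≃L[ℝ] (A × B) :=
  ContinuousLinearEquiv.equivOfInverse
    ((ContinuousLinearMap.fst ℝ A B).prod
      (ContinuousLinearMap.snd ℝ A B - L.comp (ContinuousLinearMap.fst ℝ A B)))
    ((ContinuousLinearMap.fst ℝ A B).prod
      (ContinuousLinearMap.snd ℝ A B + L.comp (ContinuousLinearMap.fst ℝ A B)))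
    (fun x => by ext <;> simp) (fun x => by ext <;> simp)

/-- At `τ = 0` the factor `τ` kills the variation of the nonlinear term in `γ`. What remains is the
identity in `γ` plus a term in `(v, τ)`: a shear, invertible whatever `F` is. -/
theorem hasFDerivAt_odeDefect {V : Type*} [NormedAddCommGroup V] [NormedSpace ℝ V] (F : C(V, V))
    (hF : ContDiff ℝ ∞ F) (v₀ : V) : ∃ L : (V × ℝ) →L[ℝ] C(Icc (-1 : ℝ) 1, V),
    HasFDerivAt (fun q : (V × ℝ) × C(Icc (-1 : ℝ) 1, V) => (q.1, odeDefect F q))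
      (shearEquiv L : ((V × ℝ) × C(Icc (-1 : ℝ) 1, V)) →L[ℝ] _)
      ((v₀, 0), ContinuousMap.const _ v₀) := by
  set a : (V × ℝ) × C(Icc (-1 : ℝ) 1, V) := ((v₀, 0), ContinuousMap.const _ v₀) with ha
  set R : (V × ℝ) × C(Icc (-1 : ℝ) 1, V) → C(Icc (-1 : ℝ) 1, V) :=
    fun q => primitiveCLM V (F.comp q.2)
  have hR : DifferentiableAt ℝ R a := by
    have h1 : ContDiff ℝ ∞ R :=
      (primitiveCLM V).contDiff.comp ((contDiff_postcomp F hF).comp contDiff_snd)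
    exact h1.contDiffAt.differentiableAt (by simp)
  have h2 : HasFDerivAt (fun q : (V × ℝ) × C(Icc (-1 : ℝ) 1, V) => q.1.2) _ a :=
    (hasFDerivAt_snd (𝕜 := ℝ) (p := a.1)).comp a hasFDerivAt_fst
  have h3 := h2.smul hR.hasFDerivAt
  have h4 : HasFDerivAt (fun q : (V × ℝ) × C(Icc (-1 : ℝ) 1, V) =>
      (ContinuousLinearMap.const ℝ (M := V) (Icc (-1 : ℝ) 1)) q.1.1) _ a :=
    ((ContinuousLinearMap.const ℝ (M := V) (Icc (-1 : ℝ) 1)).hasFDerivAt (x := a.1.1)).comp a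
      ((hasFDerivAt_fst (𝕜 := ℝ) (p := a.1)).comp a hasFDerivAt_fst)
  have h5 := (hasFDerivAt_fst (𝕜 := ℝ) (p := a)).prodMk
    ((((hasFDerivAt_snd (𝕜 := ℝ) (p := a)).sub h4).sub h3))
  refine ⟨(ContinuousLinearMap.const ℝ (M := V) (Icc (-1 : ℝ) 1)).comp
      (ContinuousLinearMap.fst ℝ V ℝ) + (ContinuousLinearMap.snd ℝ V ℝ).smulRight (R a), ?_⟩
  convert! h5 using 1
  refine ContinuousLinearMap.ext fun q => Prod.ext rfl ?_
  simp [shearEquiv, ha, sub_sub]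

/-- Time is treated as the parameter `τ` of `γ' = τ F(γ)` on the fixed interval `[-1, 1]`. The
inverse function theorem gives a solution `sol (v, τ)` smooth in `(v, τ)`, and the flow is its value
at `1`. Rescaling the curve recovers the differential equation in `τ`. -/
theorem exists_local_flow {V : Type*} [NormedAddCommGroup V] [NormedSpace ℝ V] [CompleteSpace V]
    {F : V → V} (hF : ContDiff ℝ ∞ F) (v₀ : V) : ∃ ε > 0, ∃ Φ : ℝ × V → V,
      ContDiffOn ℝ ∞ Φ (Ioo (-ε) ε ×ˢ Metric.ball v₀ ε) ∧
      (∀ v ∈ Metric.ball v₀ ε, Φ (0, v) = v) ∧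
      ∀ t ∈ Ioo (-ε) ε, ∀ v ∈ Metric.ball v₀ ε,
        HasDerivAt (fun t => Φ (t, v)) (F (Φ (t, v))) t := by
  set F' : C(V, V) := ⟨F, hF.continuous⟩ with hF'
  set a : (V × ℝ) × C(Icc (-1 : ℝ) 1, V) := ((v₀, 0), ContinuousMap.const _ v₀) with ha
  obtain ⟨L, hL⟩ := hasFDerivAt_odeDefect F' hF v₀
  obtain ⟨e, hae, -, hef, hsymm, -⟩ := exists_smooth_localInverse
    (f := fun q : (V × ℝ) × C(Icc (-1 : ℝ) 1, V) => (q.1, odeDefect F' q)) isOpen_univ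
    (contDiff_fst.prodMk (contDiff_odeDefect F' hF)).contDiffOn (mem_univ a) (shearEquiv L)
    hL.fderiv
  have hea : e a = ((v₀, 0), 0) := by
    rw [hef]
    refine Prod.ext rfl ((odeDefect_eq_zero_iff _ _ _ _).2 fun t => ?_)
    simp
  set sol : V × ℝ → C(Icc (-1 : ℝ) 1, V) := fun z => (e.symm (z, 0)).2 with hsol
  obtain ⟨r, hr, hball⟩ := Metric.isOpen_iff.1 e.open_source a hae
  have hat : ((v₀, (0 : ℝ)), (0 : C(Icc (-1 : ℝ) 1, V))) ∈ e.target := hea ▸ e.map_source hae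
  have hcont : ContinuousAt (fun z : V × ℝ => e.symm (z, 0)) (v₀, 0) :=
    ContinuousAt.comp (f := fun z : V × ℝ => (z, (0 : C(Icc (-1 : ℝ) 1, V))))
      (e.continuousAt_symm hat) (by fun_prop)
  have hsa : e.symm ((v₀, (0 : ℝ)), (0 : C(Icc (-1 : ℝ) 1, V))) = a := by
    rw [← hea, e.left_inv hae]
  have hev : ∀ᶠ z : V × ℝ in 𝓝 (v₀, 0), (z, (0 : C(Icc (-1 : ℝ) 1, V))) ∈ e.target ∧
      e.symm (z, 0) ∈ Metric.ball a r := by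
    refine Filter.Eventually.and ?_ ?_
    · exact ContinuousAt.eventually_mem (x := (v₀, (0 : ℝ)))
        (f := fun z : V × ℝ => (z, (0 : C(Icc (-1 : ℝ) 1, V)))) (by fun_prop)
        (e.open_target.mem_nhds hat)
    · refine hcont.eventually_mem ?_
      rw [hsa]
      exact Metric.ball_mem_nhds _ hr
  obtain ⟨ε₁, hε₁, hgood⟩ := Metric.eventually_nhds_iff_ball.1 hev
  set ε := min ε₁ r with hε
  have hεpos : 0 < ε := lt_min hε₁ hr
  have hmem : ∀ t ∈ Ioo (-ε) ε, ∀ v ∈ Metric.ball v₀ ε, (v, t) ∈ Metric.ball (v₀, (0 : ℝ)) ε := by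
    intro t ht v hv
    rw [← ball_prod_same]
    exact ⟨hv, by simpa [abs_lt] using ht⟩
  have hfst : ∀ z : V × ℝ, (z, (0 : C(Icc (-1 : ℝ) 1, V))) ∈ e.target →
      (e.symm (z, 0)).1 = z ∧ odeDefect F' (z, sol z) = 0 := by
    intro z hz
    have := e.right_inv hz
    rw [hef] at this
    have h1 : (e.symm (z, 0)).1 = z := congrArg Prod.fst this
    refine ⟨h1, ?_⟩
    have h2 := congrArg Prod.snd this
    simp only at h2
    rw [← h2]
    congr 1
    exact Prod.ext h1.symm rfl
  -- The curve `x ↦ sol (v, τ) (t x)` solves the equation with parameter `t τ`. It stays in the ball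
  -- where the local inverse is injective, so it coincides with `sol (v, t τ)`.
  have hscale : ∀ τ ∈ Ioo (-ε) ε, ∀ v ∈ Metric.ball v₀ ε, ∀ t : Icc (-1 : ℝ) 1,
      sol (v, t * τ) ⟨1, by norm_num⟩ = sol (v, τ) t := by
    intro τ hτ v hv t
    have hz := hgood (v, τ) (Metric.ball_subset_ball (min_le_left _ _) (hmem τ hτ v hv))
    have habs : |(t : ℝ) * τ| ≤ |τ| := by
      rw [abs_mul]
      exact mul_le_of_le_one_left (abs_nonneg _) (abs_le.2 t.2)
    have htτ : (t : ℝ) * τ ∈ Ioo (-ε) ε := abs_lt.1 (habs.trans_lt (abs_lt.2 hτ))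
    have hz' := hgood (v, t * τ) (Metric.ball_subset_ball (min_le_left _ _) (hmem _ htτ v hv))
    have hmap : ∀ x : Icc (-1 : ℝ) 1, (t : ℝ) * x ∈ Icc (-1 : ℝ) 1 := by
      intro x
      rw [mem_Icc, ← abs_le, abs_mul]
      exact mul_le_one₀ (abs_le.2 t.2) (abs_nonneg _) (abs_le.2 x.2)
    set γ' : C(Icc (-1 : ℝ) 1, V) :=
      ⟨fun x => sol (v, τ) ⟨t * x, hmap x⟩, by fun_prop⟩ with hγ'
    have hdef : odeDefect F' ((v, t * τ), γ') = 0 := by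
      rw [odeDefect_eq_zero_iff]
      intro x
      have h1 := (odeDefect_eq_zero_iff F' v τ (sol (v, τ))).1 (hfst _ hz.1).2 ⟨t * x, hmap x⟩
      change sol (v, τ) ⟨t * x, hmap x⟩ = _
      rw [h1]
      congr 1
      rw [mul_comm (t : ℝ) τ, mul_smul]
      congr 1
      have h2 := intervalIntegral.smul_integral_comp_mul_left (a := 0) (b := x)
        (fun y => F' (IccExtend neg_one_le_one' (sol (v, τ)) y)) (t : ℝ)
      rw [mul_zero] at h2
      rw [← h2]
      congr 1
      apply intervalIntegral.integral_congr
      intro y hy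
      have hy' : y ∈ Icc (-1 : ℝ) 1 := by
        have hx := x.2
        rw [mem_Icc] at hx ⊢
        rcases le_total 0 (x : ℝ) with h | h
        · rw [uIcc_of_le h, mem_Icc] at hy
          constructor <;> linarith [hy.1, hy.2, hx.1, hx.2]
        · rw [uIcc_of_ge h, mem_Icc] at hy
          constructor <;> linarith [hy.1, hy.2, hx.1, hx.2]
      simp only
      rw [IccExtend_of_mem _ _ hy', IccExtend_of_mem _ _ (hmap ⟨y, hy'⟩)]
      rfl
    have hsrc : ((v, (t : ℝ) * τ), γ') ∈ e.source := by
      apply hball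
      rw [ha, ← ball_prod_same]
      refine ⟨Metric.ball_subset_ball (min_le_right _ _) (hmem _ htτ v hv), ?_⟩
      have h2 : (sol (v, τ)) ∈ Metric.ball (ContinuousMap.const _ v₀) r := by
        have := hz.2
        rw [ha, ← ball_prod_same] at this
        exact this.2
      rw [Metric.mem_ball] at h2 ⊢
      refine lt_of_le_of_lt ((ContinuousMap.dist_le dist_nonneg).2 fun x => ?_) h2
      exact ContinuousMap.dist_apply_le_dist (f := sol (v, τ)) (g := ContinuousMap.const _ v₀)
        (⟨t * x, hmap x⟩ : Icc (-1 : ℝ) 1)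
    have heq : e.symm ((v, t * τ), 0) = ((v, (t : ℝ) * τ), γ') := by
      rw [← e.left_inv hsrc, hef, hdef]
    have : sol (v, t * τ) = γ' := congrArg Prod.snd heq
    rw [this]
    change sol (v, τ) ⟨t * 1, _⟩ = _
    congr 1
    exact Subtype.ext (mul_one _)
  refine ⟨ε, hεpos, fun q => sol (q.2, q.1) ⟨1, by norm_num⟩, ?_, ?_, ?_⟩
  · have h1 : ContDiffOn ℝ ∞ (fun q : ℝ × V => e.symm ((q.2, q.1), 0))
        (Ioo (-ε) ε ×ˢ Metric.ball v₀ ε) := by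
      refine hsymm.comp (t := e.target) (by fun_prop) ?_
      rintro ⟨t, v⟩ ⟨ht, hv⟩
      exact (hgood _ (Metric.ball_subset_ball (min_le_left _ _) (hmem t ht v hv))).1
    exact ((ContinuousMap.evalCLM ℝ (⟨1, by norm_num⟩ : Icc (-1 : ℝ) 1)).contDiff.comp
      contDiff_snd).comp_contDiffOn h1
  · intro v hv
    have h0 : (0 : ℝ) ∈ Ioo (-ε) ε := ⟨by linarith, hεpos⟩
    have hz := hgood (v, 0) (Metric.ball_subset_ball (min_le_left _ _) (hmem 0 h0 v hv))
    have h1 := (odeDefect_eq_zero_iff F' v 0 (sol (v, 0))).1 (hfst _ hz.1).2 ⟨1, by norm_num⟩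
    rw [zero_smul, add_zero] at h1
    exact h1
  · intro t ht v hv
    -- With `τ` fixed and `|t| < τ`, the flow near time `t` is a reparametrised piece of the single
    -- curve `sol (v, τ)`, which can be differentiated under the integral equation.
    obtain ⟨τ, hτ1, hτ2⟩ := exists_between (abs_lt.2 ht)
    have hτ0 : 0 < τ := (abs_nonneg t).trans_lt hτ1
    have hτm : τ ∈ Ioo (-ε) ε := ⟨by linarith, hτ2⟩
    have hz := hgood (v, τ) (Metric.ball_subset_ball (min_le_left _ _) (hmem τ hτm v hv))
    have hint := (odeDefect_eq_zero_iff F' v τ (sol (v, τ))).1 (hfst _ hz.1).2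
    have hmm : ∀ s ∈ Ioo (-τ) τ, s / τ ∈ Icc (-1 : ℝ) 1 := by
      intro s hs
      rw [mem_Icc, le_div_iff₀ hτ0, div_le_iff₀ hτ0]
      exact ⟨by linarith [hs.1], by linarith [hs.2]⟩
    have heq : ∀ s ∈ Ioo (-τ) τ, sol (v, s) ⟨1, by norm_num⟩ =
        v + τ • ∫ x in (0 : ℝ)..s / τ, F' (IccExtend neg_one_le_one' (sol (v, τ)) x) := by
      intro s hs
      have h1 := hscale τ hτm v hv ⟨s / τ, hmm s hs⟩
      simp only [div_mul_cancel₀ _ hτ0.ne'] at h1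
      rw [h1, hint]
    have htτ : t ∈ Ioo (-τ) τ := abs_lt.1 hτ1
    have hcg : Continuous fun x => F' (IccExtend neg_one_le_one' (sol (v, τ)) x) :=
      F'.continuous.comp ((sol (v, τ)).continuous.Icc_extend')
    have hd : HasDerivAt (fun s => v + τ • ∫ x in (0 : ℝ)..s / τ,
        F' (IccExtend neg_one_le_one' (sol (v, τ)) x))
        (F (sol (v, t) ⟨1, by norm_num⟩)) t := by
      have h1 := (hcg.integral_hasStrictDerivAt 0 (t / τ)).hasDerivAt
      have h2 : HasDerivAt (fun s : ℝ => s / τ) (1 / τ) t := (hasDerivAt_id t).div_const τ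
      have h3 := ((h1.scomp t h2).const_smul τ).const_add v
      refine h3.congr_deriv ?_
      have h4 := hscale τ hτm v hv ⟨t / τ, hmm t htτ⟩
      simp only [div_mul_cancel₀ _ hτ0.ne'] at h4
      rw [smul_smul, mul_one_div_cancel hτ0.ne', one_smul, h4,
        IccExtend_of_mem _ _ (hmm t htτ)]
      rfl
    refine hd.congr_of_eventuallyEq ?_
    filter_upwards [Ioo_mem_nhds htτ.1 htτ.2] with s hs
    exact heq s hs

end BanachODE
/-! ### Flows of smooth families of vector fields -/

section ManifoldFlow

variable {E : Type*} [NormedAddCommGroup E] [NormedSpace ℝ E]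
  {M : Type*} [TopologicalSpace M] [ChartedSpace E M]
  {P : Type*} [NormedAddCommGroup P] [NormedSpace ℝ P]

/-- A family of vector fields on `M`, depending smoothly on a parameter in `P`. -/
def SmoothFamily [IsManifold 𝓘(ℝ, E) ∞ M]
    (Z : P → (x : M) → TangentSpace 𝓘(ℝ, E) x) : Prop :=
  ContMDiff (𝓘(ℝ, E).prod 𝓘(ℝ, P)) 𝓘(ℝ, E).tangent ∞
    (fun q : M × P => (⟨q.1, Z q.2 q.1⟩ : TangentBundle 𝓘(ℝ, E) M))

theorem SmoothFamily.contMDiff [IsManifold 𝓘(ℝ, E) ∞ M]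
    {Z : P → (x : M) → TangentSpace 𝓘(ℝ, E) x} (hZ : SmoothFamily Z) (p : P) :
    ContMDiff 𝓘(ℝ, E) 𝓘(ℝ, E).tangent ∞
      (fun x : M => (⟨x, Z p x⟩ : TangentBundle 𝓘(ℝ, E) M)) := by
  have h : ContMDiff 𝓘(ℝ, E) (𝓘(ℝ, E).prod 𝓘(ℝ, P)) ∞ (fun x : M => (x, p)) :=
    contMDiff_id.prodMk contMDiff_const
  exact ContMDiff.comp hZ h

/-- The expression of a vector field in the chart around `x₀`. -/
noncomputable def chartVF (Z : P → (x : M) → TangentSpace 𝓘(ℝ, E) x) (x₀ : M) (q : E × P) : E :=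
  mfderiv 𝓘(ℝ, E) 𝓘(ℝ, E) (chartAt E x₀) ((chartAt E x₀).symm q.1)
    (Z q.2 ((chartAt E x₀).symm q.1))

theorem trivializationAt_snd [IsManifold 𝓘(ℝ, E) ∞ M] (x₀ : M) {x : M}
    (hx : x ∈ (chartAt E x₀).source) (v : TangentSpace 𝓘(ℝ, E) x) :
    (trivializationAt E (TangentSpace 𝓘(ℝ, E)) x₀ (⟨x, v⟩ : TangentBundle 𝓘(ℝ, E) M)).2 =
      mfderiv 𝓘(ℝ, E) 𝓘(ℝ, E) (chartAt E x₀) x v := by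
  have : IsManifold 𝓘(ℝ, E) 1 M := IsManifold.of_le (n := ∞) (by simp)
  have h := TangentBundle.continuousLinearMapAt_trivializationAt (I := 𝓘(ℝ, E)) (x₀ := x₀) hx
  have hb : x ∈ (trivializationAt E (TangentSpace 𝓘(ℝ, E)) x₀).baseSet := by simpa using hx
  have h2 := (trivializationAt E (TangentSpace 𝓘(ℝ, E)) x₀).continuousLinearMapAt_apply_of_mem
    (R := ℝ) hb v
  rw [h] at h2
  exact h2.symm

/-- In the trivialisation of the tangent bundle over a chart, the fibre coordinate of a vector is
its image under the differential of the chart. Smoothness of the section thus becomes smoothness of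
an `E`-valued map. -/
theorem smoothFamily_iff [IsManifold 𝓘(ℝ, E) ∞ M]
    {Z : P → (x : M) → TangentSpace 𝓘(ℝ, E) x} :
    SmoothFamily Z ↔
      ∀ x₀ : M, ContDiffOn ℝ ∞ (chartVF Z x₀) ((chartAt E x₀).target ×ˢ univ) := by
  have : IsManifold 𝓘(ℝ, E) 1 M := IsManifold.of_le (n := ∞) (by simp)
  constructor
  · intro h x₀
    rintro ⟨y, p⟩ ⟨hy, -⟩
    apply ContDiffAt.contDiffWithinAt
    have hs : ContMDiffAt 𝓘(ℝ, E × P) (𝓘(ℝ, E).prod 𝓘(ℝ, P)) ∞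
        (fun q : E × P => ((chartAt E x₀).symm q.1, q.2)) (y, p) := by
      refine ContMDiffAt.prodMk ?_ contDiff_snd.contMDiff.contMDiffAt
      exact ContMDiffAt.comp (y, p) ((contMDiffOn_chart_symm (I := 𝓘(ℝ, E)) (n := ∞)
        (x := x₀)).contMDiffAt ((chartAt E x₀).open_target.mem_nhds hy))
        contDiff_fst.contMDiff.contMDiffAt
    have hc := ContMDiffAt.comp (y, p) (h ((chartAt E x₀).symm y, p)) hs
    have hsrc := (chartAt E x₀).map_target hy
    have hmem : ((fun q : M × P => (⟨q.1, Z q.2 q.1⟩ : TangentBundle 𝓘(ℝ, E) M)) ∘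
        fun q : E × P => ((chartAt E x₀).symm q.1, q.2)) (y, p) ∈
        (trivializationAt E (TangentSpace 𝓘(ℝ, E)) x₀).source := by
      rw [Bundle.Trivialization.mem_source]
      simpa using hsrc
    have h2 := ((Bundle.Trivialization.contMDiffAt_iff hmem).1 hc).2
    rw [contMDiffAt_iff_contDiffAt] at h2
    refine h2.congr_of_eventuallyEq ?_
    have hev : ∀ᶠ q : E × P in 𝓝 (y, p), q.1 ∈ (chartAt E x₀).target :=
      continuousAt_fst.eventually_mem ((chartAt E x₀).open_target.mem_nhds hy)
    filter_upwards [hev] with q hq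
    exact (trivializationAt_snd x₀ ((chartAt E x₀).map_target hq) _).symm
  · rintro h ⟨x₀, p⟩
    have hmem : (⟨x₀, Z p x₀⟩ : TangentBundle 𝓘(ℝ, E) M) ∈
        (trivializationAt E (TangentSpace 𝓘(ℝ, E)) x₀).source := by
      rw [Bundle.Trivialization.mem_source]
      simp
    refine (Bundle.Trivialization.contMDiffAt_iff
      (f := fun q : M × P => (⟨q.1, Z q.2 q.1⟩ : TangentBundle 𝓘(ℝ, E) M)) hmem).2
        ⟨contMDiff_fst.contMDiffAt, ?_⟩
    have hx₀ := mem_chart_source E x₀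
    have h1 : ContDiffAt ℝ ∞ (chartVF Z x₀) (chartAt E x₀ x₀, p) :=
      (h x₀).contDiffAt (((chartAt E x₀).open_target.prod isOpen_univ).mem_nhds
        ⟨(chartAt E x₀).map_source hx₀, mem_univ _⟩)
    have h2 : ContMDiffAt (𝓘(ℝ, E).prod 𝓘(ℝ, P)) 𝓘(ℝ, E × P) ∞
        (fun q : M × P => (chartAt E x₀ q.1, q.2)) (x₀, p) := by
      refine ContMDiffAt.prodMk_space ?_ contMDiffAt_snd
      exact ContMDiffAt.comp (x₀, p) ((contMDiffOn_chart (I := 𝓘(ℝ, E)) (n := ∞)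
        (x := x₀)).contMDiffAt ((chartAt E x₀).open_source.mem_nhds hx₀)) contMDiffAt_fst
    have h3 := ContMDiffAt.comp (x₀, p) (h1.contMDiffAt) h2
    refine h3.congr_of_eventuallyEq ?_
    have hev : ∀ᶠ q : M × P in 𝓝 (x₀, p), q.1 ∈ (chartAt E x₀).source :=
      continuousAt_fst.eventually_mem ((chartAt E x₀).open_source.mem_nhds hx₀)
    filter_upwards [hev] with q hq
    rw [trivializationAt_snd x₀ hq]
    simp only [Function.comp, chartVF]
    rw [(chartAt E x₀).left_inv hq]

/-- A vector field smooth near a point can be changed away from it to become smooth everywhere. -/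
theorem exists_contDiff_eventuallyEq {V W : Type*} [NormedAddCommGroup V] [NormedSpace ℝ V]
    [FiniteDimensional ℝ V] [NormedAddCommGroup W] [NormedSpace ℝ W] {f : V → W} {U : Set V}
    (hU : IsOpen U) (hf : ContDiffOn ℝ ∞ f U) {a : V} (ha : a ∈ U) :
    ∃ F : V → W, ContDiff ℝ ∞ F ∧ F =ᶠ[𝓝 a] f := by
  obtain ⟨r, hr, hball⟩ := Metric.nhds_basis_closedBall.mem_iff.1 (hU.mem_nhds ha)
  let b : ContDiffBump a := ⟨r / 2, r, by positivity, by linarith⟩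
  refine ⟨fun x => b x • f x, contDiff_iff_contDiffAt.2 fun x => ?_, ?_⟩
  · by_cases hx : x ∈ U
    · exact b.contDiff.contDiffAt.smul (hf.contDiffAt (hU.mem_nhds hx))
    · have hx' : x ∈ (Metric.closedBall a r)ᶜ := fun h => hx (hball h)
      refine (contDiffAt_const (c := (0 : W))).congr_of_eventuallyEq ?_
      filter_upwards [Metric.isClosed_closedBall.isOpen_compl.mem_nhds hx'] with y hy
      rw [b.zero_of_le_dist, zero_smul]
      exact le_of_lt (not_le.1 hy)
  · filter_upwards [b.eventuallyEq_one] with x hx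
    simp [hx]

theorem hasMFDerivAt_chart_symm_comp [IsManifold 𝓘(ℝ, E) ∞ M] (x₀ : M) {y : ℝ → E} {t : ℝ}
    {w : E} (hy : HasDerivAt y w t) (ht : y t ∈ (chartAt E x₀).target)
    (v : TangentSpace 𝓘(ℝ, E) ((chartAt E x₀).symm (y t)))
    (hv : mfderiv 𝓘(ℝ, E) 𝓘(ℝ, E) (chartAt E x₀) ((chartAt E x₀).symm (y t)) v = w) :
    HasMFDerivAt 𝓘(ℝ, ℝ) 𝓘(ℝ, E) (fun t => (chartAt E x₀).symm (y t)) t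
      ((1 : ℝ →L[ℝ] ℝ).smulRight v) := by
  have : IsManifold 𝓘(ℝ, E) 1 M := IsManifold.of_le (n := ∞) (by simp)
  have hm := mdifferentiable_chart (I := 𝓘(ℝ, E)) x₀
  have h1 : HasMFDerivAt 𝓘(ℝ, ℝ) 𝓘(ℝ, E) y t ((1 : ℝ →L[ℝ] ℝ).smulRight w) :=
    hasMFDerivAt_iff_hasFDerivAt.2 hy.hasFDerivAt
  have h2 := (hm.mdifferentiableAt_symm ht).hasMFDerivAt.comp t h1
  have h3 := hm.symm_comp_deriv ((chartAt E x₀).map_target ht)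
  rw [(chartAt E x₀).right_inv ht] at h3
  have h4 : mfderiv 𝓘(ℝ, E) 𝓘(ℝ, E) (chartAt E x₀).symm (y t)
      (mfderiv 𝓘(ℝ, E) 𝓘(ℝ, E) (chartAt E x₀) ((chartAt E x₀).symm (y t)) v) = v :=
    DFunLike.congr_fun h3 v
  let L : E →L[ℝ] E := mfderiv 𝓘(ℝ, E) 𝓘(ℝ, E) (chartAt E x₀).symm (y t)
  have h5 : L.comp ((1 : ℝ →L[ℝ] ℝ).smulRight w) = (1 : ℝ →L[ℝ] ℝ).smulRight (v : E) := by
    refine ContinuousLinearMap.ext fun r => ?_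
    change L (r • w) = r • (v : E)
    rw [L.map_smul, ← hv]
    exact congrArg (fun z : E => r • z) h4
  exact h2.congr_mfderiv h5

/-- Local existence of a smooth flow of a smooth family of vector fields. -/
theorem SmoothFamily.exists_local_flow [FiniteDimensional ℝ E] [FiniteDimensional ℝ P]
    [IsManifold 𝓘(ℝ, E) ∞ M]
    {Z : P → (x : M) → TangentSpace 𝓘(ℝ, E) x} (hZ : SmoothFamily Z) (x₀ : M) (p₀ : P) :
    ∃ ε > 0, ∃ U : Set M, ∃ U' : Set P, IsOpen U ∧ x₀ ∈ U ∧ IsOpen U' ∧ p₀ ∈ U' ∧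
      ∃ Φ : ℝ × M × P → M,
        ContMDiffOn (𝓘(ℝ, ℝ).prod (𝓘(ℝ, E).prod 𝓘(ℝ, P))) 𝓘(ℝ, E) ∞ Φ
          (Ioo (-ε) ε ×ˢ U ×ˢ U') ∧
        ∀ x ∈ U, ∀ p ∈ U', Φ (0, x, p) = x ∧
          IsMIntegralCurveOn (fun t => Φ (t, x, p)) (Z p) (Ioo (-ε) ε) := by
  set e := chartAt E x₀ with he
  have hx₀ : x₀ ∈ e.source := mem_chart_source E x₀
  set a : E × P := (e x₀, p₀) with ha
  have haW : a ∈ e.target ×ˢ (univ : Set P) := ⟨e.map_source hx₀, mem_univ _⟩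
  have hW : IsOpen (e.target ×ˢ (univ : Set P)) := e.open_target.prod isOpen_univ
  obtain ⟨f, hf, hfeq⟩ := exists_contDiff_eventuallyEq hW (smoothFamily_iff.1 hZ x₀) haW
  -- Parameters are adjoined as coordinates with zero velocity, so that dependence on parameters
  -- becomes dependence on the initial point.
  have hF : ContDiff ℝ ∞ (fun q : E × P => (f q, (0 : P))) := hf.prodMk contDiff_const
  obtain ⟨ε₁, hε₁, Φ, hΦ, hΦ0, hΦd⟩ := Chords.exists_local_flow hF a
  have hdom : IsOpen (Ioo (-ε₁) ε₁ ×ˢ Metric.ball a ε₁) := isOpen_Ioo.prod Metric.isOpen_ball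
  have h0mem : ((0 : ℝ), a) ∈ Ioo (-ε₁) ε₁ ×ˢ Metric.ball a ε₁ :=
    ⟨⟨by linarith, hε₁⟩, Metric.mem_ball_self hε₁⟩
  have hc : ContinuousAt Φ (0, a) := (hΦ.contDiffAt (hdom.mem_nhds h0mem)).continuousAt
  have hev : ∀ᶠ q : ℝ × (E × P) in 𝓝 (0, a), q ∈ Ioo (-ε₁) ε₁ ×ˢ Metric.ball a ε₁ ∧
      Φ q ∈ e.target ×ˢ (univ : Set P) ∧ f (Φ q) = chartVF Z x₀ (Φ q) := by
    refine Filter.Eventually.and (hdom.mem_nhds h0mem) ?_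
    have hΦa : Φ (0, a) = a := hΦ0 a (Metric.mem_ball_self hε₁)
    exact hc.eventually (p := fun z => z ∈ e.target ×ˢ (univ : Set P) ∧ f z = chartVF Z x₀ z)
      (by rw [hΦa]; exact Filter.Eventually.and (hW.mem_nhds haW) hfeq)
  obtain ⟨ε, hε, hgood⟩ := Metric.eventually_nhds_iff_ball.1 hev
  have hgood' : ∀ t ∈ Ioo (-ε) ε, ∀ y ∈ Metric.ball (e x₀) ε, ∀ p ∈ Metric.ball p₀ ε,
      (t, (y, p)) ∈ Metric.ball ((0 : ℝ), a) ε := by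
    intro t ht y hy p hp
    rw [← ball_prod_same, ha, ← ball_prod_same]
    exact ⟨by simpa [abs_lt] using ht, hy, hp⟩
  have hsnd : ∀ t ∈ Ioo (-ε) ε, ∀ y ∈ Metric.ball (e x₀) ε, ∀ p ∈ Metric.ball p₀ ε,
      (Φ (t, (y, p))).2 = p := by
    intro t ht y hy p hp
    have h0 : (0 : ℝ) ∈ Ioo (-ε) ε := ⟨by linarith, hε⟩
    have hd : ∀ s ∈ Ioo (-ε) ε, HasDerivAt (fun s => (Φ (s, (y, p))).2) 0 s := by
      intro s hs
      have h1 := (hgood _ (hgood' s hs y hy p hp)).1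
      exact (hΦd s h1.1 _ h1.2).snd
    have h2 := isOpen_Ioo.is_const_of_deriv_eq_zero isPreconnected_Ioo
      (fun s hs => (hd s hs).differentiableAt.differentiableWithinAt)
      (fun s hs => (hd s hs).deriv) ht h0
    rw [h2, hΦ0 _ (hgood _ (hgood' 0 h0 y hy p hp)).1.2]
  refine ⟨ε, hε, e.source ∩ e ⁻¹' Metric.ball (e x₀) ε, Metric.ball p₀ ε,
    e.continuousOn.isOpen_inter_preimage e.open_source Metric.isOpen_ball,
    ⟨hx₀, Metric.mem_ball_self hε⟩, Metric.isOpen_ball, Metric.mem_ball_self hε,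
    fun q => e.symm (Φ (q.1, (e q.2.1, q.2.2))).1, ?_, ?_⟩
  · rintro ⟨t, x, p⟩ ⟨ht, ⟨hxs, hx⟩, hp⟩
    apply ContMDiffAt.contMDiffWithinAt
    have hg := hgood _ (hgood' t ht _ hx p hp)
    have h1 : ContMDiffAt (𝓘(ℝ, ℝ).prod (𝓘(ℝ, E).prod 𝓘(ℝ, P))) 𝓘(ℝ, ℝ × (E × P)) ∞
        (fun q : ℝ × M × P => (q.1, (e q.2.1, q.2.2))) (t, x, p) := by
      refine contMDiffAt_fst.prodMk_space (ContMDiffAt.prodMk_space ?_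
        (contMDiffAt_snd.comp _ contMDiffAt_snd))
      exact ContMDiffAt.comp (t, x, p) (((contMDiffOn_chart (I := 𝓘(ℝ, E)) (n := ∞)
        (x := x₀)).contMDiffAt (e.open_source.mem_nhds hxs)))
        (contMDiffAt_fst.comp _ contMDiffAt_snd)
    have h2 := (hΦ.contDiffAt (hdom.mem_nhds hg.1)).fst.contMDiffAt
    have h3 := (contMDiffOn_chart_symm (I := 𝓘(ℝ, E)) (n := ∞)
        (x := x₀)).contMDiffAt (e.open_target.mem_nhds hg.2.1.1)
    exact ContMDiffAt.comp (t, x, p) h3 (ContMDiffAt.comp (t, x, p)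
      (g := fun z : ℝ × (E × P) => (Φ z).1) h2 h1)
  · rintro x ⟨hxs, hx⟩ p hp
    have h0 : (0 : ℝ) ∈ Ioo (-ε) ε := ⟨by linarith, hε⟩
    constructor
    · simp only
      rw [hΦ0 _ (hgood _ (hgood' 0 h0 _ hx p hp)).1.2]
      exact e.left_inv hxs
    · intro t ht
      have hg := hgood _ (hgood' t ht _ hx p hp)
      have hd := (hΦd t hg.1.1 _ hg.1.2).fst
      refine (hasMFDerivAt_chart_symm_comp x₀ hd hg.2.1.1 _ ?_).hasMFDerivWithinAt
      simp only
      rw [hg.2.2, chartVF, hsnd t ht _ hx p hp]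

theorem isMIntegralCurveOn_const {v : (x : M) → TangentSpace 𝓘(ℝ, E) x} {x : M} (h : v x = 0)
    (s : Set ℝ) : IsMIntegralCurveOn (I := 𝓘(ℝ, E)) (fun _ : ℝ => x) v s :=
  (isMIntegralCurve_const h).isMIntegralCurveOn s

/-- The data of a smooth global flow of the family `Z`. -/
structure IsSmoothFlow (Z : P → (x : M) → TangentSpace 𝓘(ℝ, E) x) (φ : ℝ × M × P → M) :
    Prop where
  zero : ∀ x p, φ (0, x, p) = x
  curve : ∀ x p, IsMIntegralCurve (I := 𝓘(ℝ, E)) (fun t => φ (t, x, p)) (Z p)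
  smooth : ContMDiff (𝓘(ℝ, ℝ).prod (𝓘(ℝ, E).prod 𝓘(ℝ, P))) 𝓘(ℝ, E) ∞ φ

theorem SmoothFamily.contMDiff_one [IsManifold 𝓘(ℝ, E) ∞ M]
    {Z : P → (x : M) → TangentSpace 𝓘(ℝ, E) x} (hZ : SmoothFamily Z) (p : P) :
    ContMDiff 𝓘(ℝ, E) 𝓘(ℝ, E).tangent 1
      (fun x : M => (⟨x, Z p x⟩ : TangentBundle 𝓘(ℝ, E) M)) :=
  (hZ.contMDiff p).of_le (by simp)

/-- Both sides are integral curves of the same field in `t`, and they agree at `t = 0`. -/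
theorem SmoothFamily.flow_add [IsManifold 𝓘(ℝ, E) ∞ M] [T2Space M]
    {Z : P → (x : M) → TangentSpace 𝓘(ℝ, E) x} (hZ : SmoothFamily Z) {φ : ℝ × M × P → M}
    (h0 : ∀ x p, φ (0, x, p) = x)
    (hφ : ∀ x p, IsMIntegralCurve (I := 𝓘(ℝ, E)) (fun t => φ (t, x, p)) (Z p))
    (s t : ℝ) (x : M) (p : P) : φ (t, φ (s, x, p), p) = φ (t + s, x, p) := by
  have : IsManifold 𝓘(ℝ, E) 1 M := IsManifold.of_le (n := ∞) (by simp)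
  have h := isMIntegralCurve_Ioo_eq_of_contMDiff_boundaryless (I := 𝓘(ℝ, E)) (t₀ := 0)
    (hZ.contMDiff_one p) (hφ (φ (s, x, p)) p) ((hφ x p).comp_add s) (by simp [h0])
  exact congrFun h t

/-- A family of vector fields vanishing outside a fixed compact set has a smooth global flow. -/
theorem SmoothFamily.exists_flow [FiniteDimensional ℝ E] [FiniteDimensional ℝ P]
    [IsManifold 𝓘(ℝ, E) ∞ M] [T2Space M]
    {Z : P → (x : M) → TangentSpace 𝓘(ℝ, E) x} (hZ : SmoothFamily Z) {K : Set M}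
    (hK : IsCompact K) (hZK : ∀ p, ∀ x ∉ K, Z p x = 0) :
    ∃ φ : ℝ × M × P → M, IsSmoothFlow Z φ := by
  have : IsManifold 𝓘(ℝ, E) 1 M := IsManifold.of_le (n := ∞) (by simp)
  -- Compactness of `K` gives, for each fixed parameter, one existence time valid at all points of
  -- `K`. Outside `K` the curves are constant, so every integral curve extends to all times.
  have hunif : ∀ p₀ : P, ∃ ε > 0, ∀ x₀ ∈ K, ∃ U : Set M, ∃ U' : Set P, IsOpen U ∧ x₀ ∈ U ∧
      IsOpen U' ∧ p₀ ∈ U' ∧ ∃ Φ : ℝ × M × P → M,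
        ContMDiffOn (𝓘(ℝ, ℝ).prod (𝓘(ℝ, E).prod 𝓘(ℝ, P))) 𝓘(ℝ, E) ∞ Φ
          (Ioo (-ε) ε ×ˢ U ×ˢ U') ∧
        ∀ x ∈ U, ∀ p ∈ U', Φ (0, x, p) = x ∧
          IsMIntegralCurveOn (fun t => Φ (t, x, p)) (Z p) (Ioo (-ε) ε) := by
    intro p₀
    refine hK.induction_on (p := fun A => ∃ ε > 0, ∀ x₀ ∈ A, ∃ U : Set M, ∃ U' : Set P,
      IsOpen U ∧ x₀ ∈ U ∧ IsOpen U' ∧ p₀ ∈ U' ∧ ∃ Φ : ℝ × M × P → M,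
        ContMDiffOn (𝓘(ℝ, ℝ).prod (𝓘(ℝ, E).prod 𝓘(ℝ, P))) 𝓘(ℝ, E) ∞ Φ
          (Ioo (-ε) ε ×ˢ U ×ˢ U') ∧
        ∀ x ∈ U, ∀ p ∈ U', Φ (0, x, p) = x ∧
          IsMIntegralCurveOn (fun t => Φ (t, x, p)) (Z p) (Ioo (-ε) ε))
      ⟨1, one_pos, fun x hx => hx.elim⟩
      (fun A B hAB ⟨ε, hε, h⟩ => ⟨ε, hε, fun x hx => h x (hAB hx)⟩) ?_ ?_
    · rintro A B ⟨ε₁, hε₁, h₁⟩ ⟨ε₂, hε₂, h₂⟩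
      have hsub : ∀ {ε : ℝ}, min ε₁ ε₂ ≤ ε →
          Ioo (-min ε₁ ε₂) (min ε₁ ε₂) ⊆ Ioo (-ε) ε :=
        fun h => Ioo_subset_Ioo (neg_le_neg h) h
      refine ⟨min ε₁ ε₂, lt_min hε₁ hε₂, ?_⟩
      rintro x (hx | hx)
      · obtain ⟨U, U', hU, hxU, hU', hpU', Φ, hΦ, hΦ'⟩ := h₁ x hx
        exact ⟨U, U', hU, hxU, hU', hpU', Φ, hΦ.mono (prod_mono (hsub (min_le_left _ _)) le_rfl),
          fun x hx p hp => ⟨(hΦ' x hx p hp).1, (hΦ' x hx p hp).2.mono (hsub (min_le_left _ _))⟩⟩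
      · obtain ⟨U, U', hU, hxU, hU', hpU', Φ, hΦ, hΦ'⟩ := h₂ x hx
        exact ⟨U, U', hU, hxU, hU', hpU', Φ, hΦ.mono (prod_mono (hsub (min_le_right _ _)) le_rfl),
          fun x hx p hp => ⟨(hΦ' x hx p hp).1, (hΦ' x hx p hp).2.mono (hsub (min_le_right _ _))⟩⟩
    · intro x hx
      obtain ⟨ε, hε, U, U', hU, hxU, hU', hpU', Φ, hΦ, hΦ'⟩ := hZ.exists_local_flow x p₀
      exact ⟨U, mem_nhdsWithin_of_mem_nhds (hU.mem_nhds hxU), ε, hε,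
        fun y hy => ⟨U, U', hU, hy, hU', hpU', Φ, hΦ, hΦ'⟩⟩
  have hglob : ∀ q : M × P, ∃ γ : ℝ → M, γ 0 = q.1 ∧
      IsMIntegralCurve (I := 𝓘(ℝ, E)) γ (Z q.2) := by
    rintro ⟨x, p⟩
    obtain ⟨ε, hε, h⟩ := hunif p
    refine exists_isMIntegralCurve_of_isMIntegralCurveOn (I := 𝓘(ℝ, E)) (hZ.contMDiff_one p) hε
      (fun y => ?_) x
    by_cases hy : y ∈ K
    · obtain ⟨U, U', hU, hyU, hU', hpU', Φ, -, hΦ⟩ := h y hy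
      exact ⟨fun t => Φ (t, y, p), hΦ y hyU p hpU'⟩
    · exact ⟨fun _ => y, rfl, isMIntegralCurveOn_const (hZK p y hy) _⟩
  choose γ hγ0 hγ using hglob
  set φ : ℝ × M × P → M := fun q => γ q.2 q.1 with hφ
  have hφ0 : ∀ x p, φ (0, x, p) = x := fun x p => hγ0 (x, p)
  have hφc : ∀ x p, IsMIntegralCurve (I := 𝓘(ℝ, E)) (fun t => φ (t, x, p)) (Z p) :=
    fun x p => hγ (x, p)
  -- By uniqueness the global curves agree with the smooth local flows at points of `K`, and are
  -- stationary near points of the open complement.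
  have hshort : ∀ p₀, ∃ ε > 0, ∀ x₀, ∀ t ∈ Ioo (-ε) ε,
      ContMDiffAt (𝓘(ℝ, ℝ).prod (𝓘(ℝ, E).prod 𝓘(ℝ, P))) 𝓘(ℝ, E) ∞ φ (t, x₀, p₀) := by
    intro p₀
    obtain ⟨ε, hε, h⟩ := hunif p₀
    refine ⟨ε, hε, fun x₀ t ht => ?_⟩
    have h0 : (0 : ℝ) ∈ Ioo (-ε) ε := ⟨by linarith, hε⟩
    by_cases hx₀ : x₀ ∈ K
    · obtain ⟨U, U', hU, hxU, hU', hpU', Φ, hΦ, hΦ'⟩ := h x₀ hx₀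
      have hnhds : Ioo (-ε) ε ×ˢ U ×ˢ U' ∈ 𝓝 (t, x₀, p₀) :=
        (isOpen_Ioo.prod (hU.prod hU')).mem_nhds ⟨ht, hxU, hpU'⟩
      refine (hΦ.contMDiffAt hnhds).congr_of_eventuallyEq ?_
      filter_upwards [hnhds] with q hq
      obtain ⟨s, x, p⟩ := q
      have := hΦ' x hq.2.1 p hq.2.2
      exact isMIntegralCurveOn_Ioo_eqOn_of_contMDiff_boundaryless (I := 𝓘(ℝ, E)) h0
        (hZ.contMDiff_one p) ((hφc x p).isMIntegralCurveOn _) this.2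
        ((hφ0 x p).trans this.1.symm) hq.1
    · refine (contMDiffAt_fst.comp _ contMDiffAt_snd).congr_of_eventuallyEq
        (f := fun q : ℝ × M × P => q.2.1) ?_
      have hev : ∀ᶠ q : ℝ × M × P in 𝓝 (t, x₀, p₀), q.2.1 ∈ Kᶜ :=
        (continuous_fst.comp continuous_snd).continuousAt.eventually_mem
          (hK.isClosed.isOpen_compl.mem_nhds hx₀)
      filter_upwards [hev] with q hq
      obtain ⟨s, x, p⟩ := q
      exact congrFun (isMIntegralCurve_Ioo_eq_of_contMDiff_boundaryless (I := 𝓘(ℝ, E)) (t₀ := 0)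
        (hZ.contMDiff_one p) (hφc x p) (isMIntegralCurve_const (hZK p x hq)) (hφ0 x p)) s
  refine ⟨φ, hφ0, hφc, ?_⟩
  rintro ⟨t, x₀, p₀⟩
  obtain ⟨ε, hε, h⟩ := hshort p₀
  have hn : ∀ n : ℕ, ∀ t : ℝ, |t| < n * ε →
      ContMDiffAt (𝓘(ℝ, ℝ).prod (𝓘(ℝ, E).prod 𝓘(ℝ, P))) 𝓘(ℝ, E) ∞ φ (t, x₀, p₀) := by
    intro n
    induction n with
    | zero => intro t ht; simp at ht; linarith [abs_nonneg t]
    | succ n ih =>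
      intro t ht
      rcases Nat.eq_zero_or_pos n with rfl | hnpos
      · refine h x₀ t (abs_lt.1 ?_)
        simpa using ht
      -- The time is divided into `n + 1` equal steps of length less than `ε`: flow for `n` of them
      -- by induction, then once more with the short-time result at the new point.
      set t₁ : ℝ := t * (n / (n + 1)) with ht₁
      have hn1 : (0 : ℝ) < n + 1 := by positivity
      have hn0 : (0 : ℝ) < n := by exact_mod_cast hnpos
      push_cast at ht
      have ha : |t| / (n + 1) < ε := by
        rw [div_lt_iff₀ hn1]; linarith
      have h1 : |t₁| < n * ε := by
        rw [ht₁, abs_mul, abs_of_nonneg (show (0 : ℝ) ≤ n / (n + 1) by positivity)]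
        calc |t| * (n / (n + 1)) = n * (|t| / (n + 1)) := by ring
          _ < n * ε := mul_lt_mul_of_pos_left ha hn0
      have h2 : |t - t₁| < ε := by
        have : t - t₁ = t / (n + 1) := by rw [ht₁]; field_simp; ring
        rw [this, abs_div, abs_of_pos hn1]
        exact ha
      have hc : ContMDiffAt (𝓘(ℝ, ℝ).prod (𝓘(ℝ, E).prod 𝓘(ℝ, P)))
          (𝓘(ℝ, ℝ).prod (𝓘(ℝ, E).prod 𝓘(ℝ, P))) ∞
          (fun q : ℝ × M × P => (q.1 - t₁, φ (t₁, q.2), q.2.2)) (t, x₀, p₀) := by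
        refine ContMDiffAt.prodMk ?_ (ContMDiffAt.prodMk ?_ ?_)
        · exact contMDiffAt_fst.sub contMDiffAt_const
        · exact ContMDiffAt.comp (t, x₀, p₀)
            (f := fun q : ℝ × M × P => (t₁, q.2)) (ih t₁ h1)
            (contMDiffAt_const.prodMk contMDiffAt_snd)
        · exact contMDiffAt_snd.comp _ contMDiffAt_snd
      have := ContMDiffAt.comp (t, x₀, p₀)
        (f := fun q : ℝ × M × P => (q.1 - t₁, φ (t₁, q.2), q.2.2))
        (h (φ (t₁, x₀, p₀)) (t - t₁) (abs_lt.1 h2)) hc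
      refine this.congr_of_eventuallyEq (Filter.Eventually.of_forall fun q => ?_)
      obtain ⟨s, x, p⟩ := q
      simp only [Function.comp]
      rw [hZ.flow_add hφ0 hφc]
      simp
  obtain ⟨n, hn'⟩ := exists_nat_gt (|t| / ε)
  exact hn n t ((div_lt_iff₀ hε).1 hn')

/-- Integral curves on closed intervals are determined by their initial values. -/
theorem eqOn_Icc_of_isMIntegralCurveOn [IsManifold 𝓘(ℝ, E) ∞ M] [T2Space M]
    {v : (x : M) → TangentSpace 𝓘(ℝ, E) x}
    (hv : ContMDiff 𝓘(ℝ, E) 𝓘(ℝ, E).tangent 1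
      (fun x : M => (⟨x, v x⟩ : TangentBundle 𝓘(ℝ, E) M)))
    {c γ : ℝ → M} {T ε : ℝ} (hε : 0 < ε)
    (hc : IsMIntegralCurveOn (I := 𝓘(ℝ, E)) c v (Icc 0 T))
    (hγ : IsMIntegralCurveOn (I := 𝓘(ℝ, E)) γ v (Ioo (-ε) (T + ε))) (h0 : c 0 = γ 0) :
    EqOn c γ (Icc 0 T) := by
  classical
  have : IsManifold 𝓘(ℝ, E) 1 M := IsManifold.of_le (n := ∞) (by simp)
  rcases lt_trichotomy T 0 with hT | rfl | hT
  · rw [Icc_eq_empty (not_le.2 hT)]; exact fun x hx => hx.elim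
  · intro x hx
    rw [Icc_self, mem_singleton_iff] at hx
    rw [hx, h0]
  -- Prolonging `c` by `γ` before time `0` makes `0` an interior point, where uniqueness on open
  -- intervals applies. The right endpoint `T` is recovered by continuity.
  set d : ℝ → M := fun t => if t ≤ 0 then γ t else c t with hd
  have hdc : ∀ t ∈ Icc 0 T, d t = c t := by
    intro t ht
    by_cases h : t ≤ 0
    · have : t = 0 := le_antisymm h ht.1
      simp [hd, this, h0]
    · simp [hd, h]
  have hdI : IsMIntegralCurveOn (I := 𝓘(ℝ, E)) d v (Ioo (-ε) T) := by
    intro t ht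
    apply HasMFDerivAt.hasMFDerivWithinAt
    rcases lt_trichotomy t 0 with h | h | h
    · have h1 := (hγ t ⟨ht.1, by linarith⟩).hasMFDerivAt (Ioo_mem_nhds ht.1 (by linarith))
      have heq : d =ᶠ[𝓝 t] γ := by
        filter_upwards [Iio_mem_nhds h] with s hs
        simp [hd, le_of_lt (show s < 0 from hs)]
      rw [heq.eq_of_nhds]
      exact h1.congr_of_eventuallyEq heq
    · subst h
      have hd0 : d 0 = γ 0 := by simp [hd]
      have h1 : HasMFDerivWithinAt 𝓘(ℝ, ℝ) 𝓘(ℝ, E) d (Icc (-(ε / 2)) 0) 0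
          ((1 : ℝ →L[ℝ] ℝ).smulRight (v (d 0))) := by
        rw [hd0]
        refine ((hγ 0 ⟨by linarith, by linarith⟩).mono ?_).congr_of_eventuallyEq ?_ hd0
        · intro s hs; exact ⟨by linarith [hs.1], by linarith [hs.2]⟩
        · filter_upwards [self_mem_nhdsWithin] with s hs
          simp [hd, hs.2]
      have h2 : HasMFDerivWithinAt 𝓘(ℝ, ℝ) 𝓘(ℝ, E) d (Icc 0 T) 0
          ((1 : ℝ →L[ℝ] ℝ).smulRight (v (d 0))) := by
        have hd0' : d 0 = c 0 := hd0.trans h0.symm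
        rw [hd0']
        refine (hc 0 ⟨le_rfl, hT.le⟩).congr_of_eventuallyEq ?_ hd0'
        filter_upwards [self_mem_nhdsWithin] with s hs
        exact hdc s hs
      refine (h1.union h2).hasMFDerivAt ?_
      rw [Icc_union_Icc_eq_Icc (by linarith) hT.le]
      exact Icc_mem_nhds (by linarith) hT
    · have h1 := (hc t ⟨h.le, ht.2.le⟩).hasMFDerivAt (Icc_mem_nhds h ht.2)
      have heq : d =ᶠ[𝓝 t] c := by
        filter_upwards [Icc_mem_nhds h ht.2] with s hs
        exact hdc s hs
      rw [heq.eq_of_nhds]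
      exact h1.congr_of_eventuallyEq heq
  have hIoo : EqOn d γ (Ioo (-ε) T) :=
    isMIntegralCurveOn_Ioo_eqOn_of_contMDiff_boundaryless (I := 𝓘(ℝ, E)) (t₀ := 0)
      ⟨by linarith, hT⟩ hv hdI (hγ.mono (Ioo_subset_Ioo le_rfl (by linarith))) (by simp [hd])
  have hIco : EqOn c γ (Ico 0 T) := fun t ht => by
    rw [← hdc t ⟨ht.1, ht.2.le⟩]
    exact hIoo ⟨by linarith [ht.1], ht.2⟩
  have hcl : Icc 0 T = closure (Ico 0 T) := (closure_Ico hT.ne).symm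
  refine EqOn.of_subset_closure hIco hc.continuousOn
    (hγ.continuousOn.mono fun t ht => ⟨by linarith [ht.1], by linarith [ht.2]⟩)
    Ico_subset_Icc_self hcl.le

end ManifoldFlow
/-! ### Exterior derivatives of one-forms and pull-backs -/

section Exterior

variable {V W : Type*} [NormedAddCommGroup V] [NormedSpace ℝ V]
  [NormedAddCommGroup W] [NormedSpace ℝ W]

/-- The exterior derivative of a one-form on a normed space. -/
noncomputable def extd (α : V → V →L[ℝ] ℝ) (v a b : V) : ℝ := fderiv ℝ α v a b - fderiv ℝ α v b a

/-- A linear form as an alternating form in one variable. -/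
noncomputable def oneAltCLM (V : Type*) [NormedAddCommGroup V] [NormedSpace ℝ V]
    [FiniteDimensional ℝ V] : (V →L[ℝ] ℝ) →L[ℝ] (V [⋀^Fin 1]→L[ℝ] ℝ) :=
  LinearMap.toContinuousLinearMap
    { toFun := ContinuousAlternatingMap.ofSubsingleton ℝ V ℝ (0 : Fin 1)
      map_add' := fun _ _ => rfl
      map_smul' := fun _ _ => rfl }

theorem contDiff_of_linear [FiniteDimensional ℝ V] (f : V → W)
    (hadd : ∀ x y, f (x + y) = f x + f y) (hsmul : ∀ (r : ℝ) x, f (r • x) = r • f x) :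
    ContDiff ℝ ∞ f :=
  (LinearMap.toContinuousLinearMap
    ({ toFun := f, map_add' := hadd, map_smul' := hsmul } : V →ₗ[ℝ] W)).contDiff

theorem extDeriv_ofSubsingleton [FiniteDimensional ℝ V] {α : V → V →L[ℝ] ℝ} {v : V}
    (hα : DifferentiableAt ℝ α v) (a b : V) :
    extDeriv (fun y => ContinuousAlternatingMap.ofSubsingleton ℝ V ℝ (0 : Fin 1) (α y)) v ![a, b] =
      extd α v a b := by
  have hd : DifferentiableAt ℝ
      (fun y => ContinuousAlternatingMap.ofSubsingleton ℝ V ℝ (0 : Fin 1) (α y)) v :=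
    ((oneAltCLM V).differentiableAt).comp v hα
  have hc : ∀ c : V, fderiv ℝ (fun x => α x c) v = (fderiv ℝ α v).flip c := by
    intro c
    ext u
    rw [fderiv_clm_apply hα (differentiableAt_const c)]
    simp
  rw [extDeriv_apply hd, Fin.sum_univ_two]
  simp only [Fin.val_zero, pow_zero, one_smul, Fin.val_one, pow_one, neg_smul]
  have h0 : (fun x => (ContinuousAlternatingMap.ofSubsingleton ℝ V ℝ (0 : Fin 1) (α x))
      ((0 : Fin 2).removeNth ![a, b])) = fun x => α x b := rfl
  have h1 : (fun x => (ContinuousAlternatingMap.ofSubsingleton ℝ V ℝ (0 : Fin 1) (α x))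
      ((1 : Fin 2).removeNth ![a, b])) = fun x => α x a := rfl
  rw [h0, h1, hc, hc]
  simp [extd, sub_eq_add_neg]

/-- This is naturality of the exterior derivative; the second derivatives of `f` cancel by symmetry.
It is deduced by regarding one-forms as alternating maps in one variable. -/
theorem extd_pullback [FiniteDimensional ℝ V] [FiniteDimensional ℝ W] {α : W → W →L[ℝ] ℝ}
    {f : V → W} {v : V} (hα : ContDiffAt ℝ ∞ α (f v)) (hf : ContDiffAt ℝ ∞ f v) (a b : V) :
    extd (fun x => (α (f x)).comp (fderiv ℝ f x)) v a b =
      extd α (f v) (fderiv ℝ f v a) (fderiv ℝ f v b) := by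
  have hd : DifferentiableAt ℝ α (f v) := hα.differentiableAt (by simp)
  have hd' : DifferentiableAt ℝ
      (fun y => ContinuousAlternatingMap.ofSubsingleton ℝ W ℝ (0 : Fin 1) (α y)) (f v) :=
    ((oneAltCLM W).differentiableAt).comp _ hd
  have hdf : DifferentiableAt ℝ (fun x => (α (f x)).comp (fderiv ℝ f x)) v := by
    have h1 : ContDiffAt ℝ ∞ (fun x => α (f x)) v := hα.comp v hf
    have h2 : ContDiffAt ℝ ∞ (fderiv ℝ f) v := hf.fderiv_right (by simp)
    exact (h1.clm_comp h2).differentiableAt (by simp)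
  rw [← extDeriv_ofSubsingleton hd, ← extDeriv_ofSubsingleton hdf]
  have h := extDeriv_pullback hd' hf
    (by rw [minSmoothness_of_isRCLikeNormedField]; exact WithTop.coe_le_coe.2 le_top)
  have h' := DFunLike.congr_fun h ![a, b]
  have e1 : (fun x => (ContinuousAlternatingMap.ofSubsingleton ℝ W ℝ (0 : Fin 1)
      (α (f x))).compContinuousLinearMap (fderiv ℝ f x)) =
      fun x => ContinuousAlternatingMap.ofSubsingleton ℝ V ℝ (0 : Fin 1)
        ((α (f x)).comp (fderiv ℝ f x)) := by
    funext x
    ext u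
    rfl
  rw [e1] at h'
  rw [h', ContinuousAlternatingMap.compContinuousLinearMap_apply]
  congr 1
  ext i
  fin_cases i <;> rfl

theorem extd_congr {α β : V → V →L[ℝ] ℝ} {v : V} (h : α =ᶠ[𝓝 v] β) (a b : V) :
    extd α v a b = extd β v a b := by
  rw [extd, extd, h.fderiv_eq]

end Exterior

/-! ### One-forms, their differentials and Hamiltonian vector fields in charts -/

section Forms

variable {E : Type*} [NormedAddCommGroup E] [NormedSpace ℝ E] [FiniteDimensional ℝ E]
  {M : Type*} [TopologicalSpace M] [ChartedSpace E M] [IsManifold 𝓘(ℝ, E) ∞ M]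
  {V : Type*} [NormedAddCommGroup V] [NormedSpace ℝ V]

/-- The pull-back of a one-form by a map from a normed space. -/
noncomputable def pull (lam : OneForm E M) (u : V → M) (v : V) : V →L[ℝ] ℝ :=
  (lam (u v)).comp (mfderiv 𝓘(ℝ, V) 𝓘(ℝ, E) u v)

/-- The expression of a one-form in the chart around `x`, as a map between vector spaces. -/
noncomputable def localForm (lam : OneForm E M) (x : M) : E → E →L[ℝ] ℝ := chartForm lam x

theorem localForm_eq_pull (lam : OneForm E M) (x : M) :
    localForm lam x = pull lam (chartAt E x).symm := rfl

theorem mfderiv_chart_symm_apply (x₀ : M) {y : E} (hy : y ∈ (chartAt E x₀).target) (w : E) :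
    mfderiv 𝓘(ℝ, E) 𝓘(ℝ, E) (chartAt E x₀) ((chartAt E x₀).symm y)
      (mfderiv 𝓘(ℝ, E) 𝓘(ℝ, E) (chartAt E x₀).symm y w) = w := by
  have : IsManifold 𝓘(ℝ, E) 1 M := IsManifold.of_le (n := ∞) (by simp)
  exact DFunLike.congr_fun ((mdifferentiable_chart (I := 𝓘(ℝ, E)) x₀).comp_symm_deriv hy) w

theorem mfderiv_symm_chart_apply (x₀ : M) {x : M} (hx : x ∈ (chartAt E x₀).source)
    (w : TangentSpace 𝓘(ℝ, E) x) :
    mfderiv 𝓘(ℝ, E) 𝓘(ℝ, E) (chartAt E x₀).symm (chartAt E x₀ x)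
      (mfderiv 𝓘(ℝ, E) 𝓘(ℝ, E) (chartAt E x₀) x w) = w := by
  have : IsManifold 𝓘(ℝ, E) 1 M := IsManifold.of_le (n := ∞) (by simp)
  exact DFunLike.congr_fun ((mdifferentiable_chart (I := 𝓘(ℝ, E)) x₀).symm_comp_deriv hx) w

/-- It suffices to evaluate on constant vectors `w`. The image of `w` under the differential of the
inverse chart is a smooth section, being constant in the trivialisation, and a smooth one-form
applied to it is smooth. -/
theorem SmoothOneForm.contDiffOn_localForm {lam : OneForm E M} (hlam : SmoothOneForm lam)
    (x₀ : M) : ContDiffOn ℝ ∞ (localForm lam x₀) (chartAt E x₀).target := by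
  refine contDiffOn_clm_apply.2 fun w => ?_
  intro y hy
  apply ContDiffAt.contDiffWithinAt
  have hsymm : ContMDiffAt 𝓘(ℝ, E) 𝓘(ℝ, E) ∞ (chartAt E x₀).symm y :=
    (contMDiffOn_chart_symm (I := 𝓘(ℝ, E)) (n := ∞) (x := x₀)).contMDiffAt
      ((chartAt E x₀).open_target.mem_nhds hy)
  have hsec : ContMDiffAt 𝓘(ℝ, E) 𝓘(ℝ, E).tangent ∞ (fun y : E =>
      (⟨(chartAt E x₀).symm y, mfderiv 𝓘(ℝ, E) 𝓘(ℝ, E) (chartAt E x₀).symm y w⟩ :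
        TangentBundle 𝓘(ℝ, E) M)) y := by
    have hmem : (⟨(chartAt E x₀).symm y, mfderiv 𝓘(ℝ, E) 𝓘(ℝ, E) (chartAt E x₀).symm y w⟩ :
        TangentBundle 𝓘(ℝ, E) M) ∈ (trivializationAt E (TangentSpace 𝓘(ℝ, E)) x₀).source := by
      rw [Bundle.Trivialization.mem_source]
      simpa using (chartAt E x₀).map_target hy
    refine (Bundle.Trivialization.contMDiffAt_iff (f := fun y : E =>
      (⟨(chartAt E x₀).symm y, mfderiv 𝓘(ℝ, E) 𝓘(ℝ, E) (chartAt E x₀).symm y w⟩ :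
        TangentBundle 𝓘(ℝ, E) M)) hmem).2 ⟨hsymm, ?_⟩
    refine (contMDiffAt_const (c := w)).congr_of_eventuallyEq ?_
    filter_upwards [(chartAt E x₀).open_target.mem_nhds hy] with z hz
    rw [trivializationAt_snd x₀ ((chartAt E x₀).map_target hz)]
    exact mfderiv_chart_symm_apply x₀ hz w
  have hphi := ContMDiffAt.comp y (hlam ((chartAt E x₀).symm y)) hsymm
  have h := ContMDiffAt.clm_bundle_apply (E₂ := Bundle.Trivial M ℝ)
    (ϕ := fun y => lam ((chartAt E x₀).symm y)) hphi hsec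
  rw [Bundle.contMDiffAt_totalSpace] at h
  exact contMDiffAt_iff_contDiffAt.1 h.2

theorem SmoothOneForm.contDiffAt_localForm {lam : OneForm E M} (hlam : SmoothOneForm lam)
    (x₀ : M) {y : E} (hy : y ∈ (chartAt E x₀).target) :
    ContDiffAt ℝ ∞ (localForm lam x₀) y :=
  (hlam.contDiffOn_localForm x₀).contDiffAt ((chartAt E x₀).open_target.mem_nhds hy)

theorem contMDiffAt_chartAt (x₀ : M) {x : M} (hx : x ∈ (chartAt E x₀).source) :
    ContMDiffAt 𝓘(ℝ, E) 𝓘(ℝ, E) ∞ (chartAt E x₀) x :=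
  (contMDiffOn_chart (I := 𝓘(ℝ, E)) (n := ∞) (x := x₀)).contMDiffAt
    ((chartAt E x₀).open_source.mem_nhds hx)

theorem contMDiffAt_chartAt_symm (x₀ : M) {y : E} (hy : y ∈ (chartAt E x₀).target) :
    ContMDiffAt 𝓘(ℝ, E) 𝓘(ℝ, E) ∞ (chartAt E x₀).symm y :=
  (contMDiffOn_chart_symm (I := 𝓘(ℝ, E)) (n := ∞) (x := x₀)).contMDiffAt
    ((chartAt E x₀).open_target.mem_nhds hy)

/-- The pull-back of a one-form, computed in a chart. -/
theorem pull_eventuallyEq (lam : OneForm E M) (x₀ : M) {u : V → M} {v : V}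
    (hu : ContMDiffAt 𝓘(ℝ, V) 𝓘(ℝ, E) ∞ u v) (hx : u v ∈ (chartAt E x₀).source) :
    pull lam u =ᶠ[𝓝 v] fun z => (localForm lam x₀ (chartAt E x₀ (u z))).comp
      (fderiv ℝ (fun z => chartAt E x₀ (u z)) z) := by
  have h1 : ∀ᶠ z in 𝓝 v, u z ∈ (chartAt E x₀).source :=
    hu.continuousAt.eventually_mem ((chartAt E x₀).open_source.mem_nhds hx)
  have h2 : ∀ᶠ z in 𝓝 v, ContMDiffAt 𝓘(ℝ, V) 𝓘(ℝ, E) 1 u z :=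
    contMDiffAt_iff_contMDiffAt_nhds (by simp) |>.1 (hu.of_le (by simp))
  filter_upwards [h1, h2] with z hz hz2
  have hd := hz2.mdifferentiableAt (by simp)
  have hcd := (contMDiffAt_chartAt x₀ hz).mdifferentiableAt (by simp)
  have hcomp := mfderiv_comp z hcd hd
  refine ContinuousLinearMap.ext fun w => ?_
  have h0 : fderiv ℝ (fun z => chartAt E x₀ (u z)) z =
      mfderiv 𝓘(ℝ, V) 𝓘(ℝ, E) (chartAt E x₀ ∘ u) z := mfderiv_eq_fderiv.symm
  rw [h0]
  change lam (u z) (mfderiv 𝓘(ℝ, V) 𝓘(ℝ, E) u z w) =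
    lam ((chartAt E x₀).symm (chartAt E x₀ (u z)))
      (mfderiv 𝓘(ℝ, E) 𝓘(ℝ, E) (chartAt E x₀).symm (chartAt E x₀ (u z))
        (mfderiv 𝓘(ℝ, V) 𝓘(ℝ, E) (chartAt E x₀ ∘ u) z w))
  rw [hcomp]
  have h3 := mfderiv_symm_chart_apply x₀ hz (mfderiv 𝓘(ℝ, V) 𝓘(ℝ, E) u z w)
  have h4 := (chartAt E x₀).left_inv hz
  have h5 : ∀ x : M, x = u z → lam (u z) (mfderiv 𝓘(ℝ, V) 𝓘(ℝ, E) u z w) =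
      lam x ((mfderiv 𝓘(ℝ, V) 𝓘(ℝ, E) u z w : E)) := by
    rintro x rfl; rfl
  rw [h5 _ h4]
  exact congrArg (fun e : E => lam ((chartAt E x₀).symm (chartAt E x₀ (u z))) e) h3.symm

theorem extd_pull [FiniteDimensional ℝ V] {lam : OneForm E M} (hlam : SmoothOneForm lam)
    (x₀ : M) {u : V → M} {v : V}
    (hu : ContMDiffAt 𝓘(ℝ, V) 𝓘(ℝ, E) ∞ u v) (hx : u v ∈ (chartAt E x₀).source) (a b : V) :
    extd (pull lam u) v a b = extd (localForm lam x₀) (chartAt E x₀ (u v))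
      (mfderiv 𝓘(ℝ, E) 𝓘(ℝ, E) (chartAt E x₀) (u v) (mfderiv 𝓘(ℝ, V) 𝓘(ℝ, E) u v a))
      (mfderiv 𝓘(ℝ, E) 𝓘(ℝ, E) (chartAt E x₀) (u v) (mfderiv 𝓘(ℝ, V) 𝓘(ℝ, E) u v b)) := by
  have hc := contMDiffAt_chartAt x₀ hx
  have hcu : ContDiffAt ℝ ∞ (fun z => chartAt E x₀ (u z)) v :=
    contMDiffAt_iff_contDiffAt.1 (ContMDiffAt.comp v hc hu)
  rw [extd_congr (pull_eventuallyEq lam x₀ hu hx),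
    extd_pullback (α := localForm lam x₀) (f := fun z => chartAt E x₀ (u z))
      (hlam.contDiffAt_localForm x₀ ((chartAt E x₀).map_source hx)) hcu]
  have hcomp := mfderiv_comp v (hc.mdifferentiableAt (by simp)) (hu.mdifferentiableAt (by simp))
  have h : ∀ w : V, fderiv ℝ (fun z => chartAt E x₀ (u z)) v w =
      mfderiv 𝓘(ℝ, E) 𝓘(ℝ, E) (chartAt E x₀) (u v) (mfderiv 𝓘(ℝ, V) 𝓘(ℝ, E) u v w) := by
    intro w
    rw [← mfderiv_eq_fderiv]
    exact DFunLike.congr_fun hcomp w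
  rw [h, h]

theorem omega_eq_extd {lam : OneForm E M} (hlam : SmoothOneForm lam) (x : M)
    (u w : TangentSpace 𝓘(ℝ, E) x) : omega lam x u w =
      extd (localForm lam x) (chartAt E x x) (mfderiv 𝓘(ℝ, E) 𝓘(ℝ, E) (chartAt E x) x u)
        (mfderiv 𝓘(ℝ, E) 𝓘(ℝ, E) (chartAt E x) x w) :=
  extDeriv_ofSubsingleton ((hlam.contDiffAt_localForm x
    ((chartAt E x).map_source (mem_chart_source E x))).differentiableAt (by simp)) _ _

/-- The exterior derivative of a pull-back is the pull-back of the exterior derivative. -/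
theorem extd_pull_eq_omega [FiniteDimensional ℝ V] {lam : OneForm E M} (hlam : SmoothOneForm lam)
    {u : V → M} {v : V} (hu : ContMDiffAt 𝓘(ℝ, V) 𝓘(ℝ, E) ∞ u v) (a b : V) :
    extd (pull lam u) v a b = omega lam (u v) (mfderiv 𝓘(ℝ, V) 𝓘(ℝ, E) u v a)
      (mfderiv 𝓘(ℝ, V) 𝓘(ℝ, E) u v b) := by
  rw [extd_pull hlam (u v) hu (mem_chart_source E _), omega_eq_extd hlam]

/-- The form `omega` may be computed in any chart. -/
theorem omega_eq_extd_chart {lam : OneForm E M} (hlam : SmoothOneForm lam) (x₀ : M) {x : M}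
    (hx : x ∈ (chartAt E x₀).source) (u w : TangentSpace 𝓘(ℝ, E) x) : omega lam x u w =
      extd (localForm lam x₀) (chartAt E x₀ x) (mfderiv 𝓘(ℝ, E) 𝓘(ℝ, E) (chartAt E x₀) x u)
        (mfderiv 𝓘(ℝ, E) 𝓘(ℝ, E) (chartAt E x₀) x w) := by
  have hy := (chartAt E x₀).map_source hx
  have h := extd_pull_eq_omega hlam (contMDiffAt_chartAt_symm x₀ hy)
    (mfderiv 𝓘(ℝ, E) 𝓘(ℝ, E) (chartAt E x₀) x u) (mfderiv 𝓘(ℝ, E) 𝓘(ℝ, E) (chartAt E x₀) x w)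
  rw [mfderiv_symm_chart_apply x₀ hx, mfderiv_symm_chart_apply x₀ hx] at h
  rw [localForm_eq_pull, h]
  have h5 : ∀ y : M, y = x → omega lam x u w = omega lam y (u : E) (w : E) := by
    rintro y rfl; rfl
  exact h5 _ ((chartAt E x₀).left_inv hx)

/-- The exterior derivative of a one-form as a bilinear form. -/
noncomputable def extdL (α : V → V →L[ℝ] ℝ) (v : V) : V →L[ℝ] V →L[ℝ] ℝ :=
  fderiv ℝ α v - (fderiv ℝ α v).flip

theorem extdL_apply (α : V → V →L[ℝ] ℝ) (v a b : V) : extdL α v a b = extd α v a b := by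
  simp [extdL, extd]

theorem extd_self (α : V → V →L[ℝ] ℝ) (v a : V) : extd α v a a = 0 := sub_self _

theorem extd_swap (α : V → V →L[ℝ] ℝ) (v a b : V) : extd α v a b = -extd α v b a := by
  simp [extd]

/-- The differential of the chart at `x`, as a map between vector spaces. -/
noncomputable def chartDeriv (x₀ x : M) : E →L[ℝ] E :=
  mfderiv 𝓘(ℝ, E) 𝓘(ℝ, E) (chartAt E x₀) x

/-- `omega` as a bilinear form. -/
noncomputable def omegaL (lam : OneForm E M) (x : M) : E →L[ℝ] E →L[ℝ] ℝ :=
  (extdL (localForm lam x) (chartAt E x x)).bilinearComp (chartDeriv x x) (chartDeriv x x)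

theorem omega_eq_omegaL {lam : OneForm E M} (hlam : SmoothOneForm lam) (x : M)
    (u w : TangentSpace 𝓘(ℝ, E) x) : omega lam x u w = omegaL lam x u w :=
  (omega_eq_extd hlam x u w).trans (extdL_apply _ _ _ _).symm

theorem omegaL_swap (lam : OneForm E M) (x : M) (u w : E) :
    omegaL lam x u w = -omegaL lam x w u := by
  simp only [omegaL, ContinuousLinearMap.bilinearComp_apply, extdL_apply]
  exact extd_swap _ _ _ _

theorem omegaL_self (lam : OneForm E M) (x : M) (u : E) : omegaL lam x u u = 0 := by
  simp only [omegaL, ContinuousLinearMap.bilinearComp_apply, extdL_apply]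
  exact extd_self _ _ _

theorem IsExactSymplectic.omegaL_injective {lam : OneForm E M} (hlam : IsExactSymplectic lam)
    (x : M) : Function.Injective (omegaL lam x) := by
  rw [injective_iff_map_eq_zero]
  intro u hu
  exact hlam.2 x u fun w => (omega_eq_omegaL hlam.1 x u w).trans (DFunLike.congr_fun hu w)

theorem finrank_dual_eq (V : Type*) [NormedAddCommGroup V] [NormedSpace ℝ V]
    [FiniteDimensional ℝ V] : Module.finrank ℝ V = Module.finrank ℝ (V →L[ℝ] ℝ) := by
  rw [(LinearMap.toContinuousLinearMap (𝕜 := ℝ) (E := V) (F' := ℝ)).symm.finrank_eq]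
  exact (Subspace.dual_finrank_eq (K := ℝ) (V := V)).symm

theorem IsExactSymplectic.omegaL_surjective {lam : OneForm E M} (hlam : IsExactSymplectic lam)
    (x : M) : Function.Surjective (omegaL lam x) :=
  (LinearMap.injective_iff_surjective_of_finrank_eq_finrank
    (f := (omegaL lam x : E →ₗ[ℝ] E →L[ℝ] ℝ)) (finrank_dual_eq E)).1 (hlam.omegaL_injective x)

/-- Non-degeneracy and equality of dimensions make `ω` an isomorphism onto the dual, so the vector
selected by `Classical.epsilon` exists. The sign comes from `X_h` being in the second slot. -/
theorem IsExactSymplectic.hamVF_spec {lam : OneForm E M} (hlam : IsExactSymplectic lam)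
    (h : M → ℝ) (x : M) (u : TangentSpace 𝓘(ℝ, E) x) :
    diff (E := E) h x u = omega lam x u (hamVF lam h x) := by
  have hex : ∃ X : TangentSpace 𝓘(ℝ, E) x,
      ∀ u : TangentSpace 𝓘(ℝ, E) x, diff (E := E) h x u = omega lam x u X := by
    obtain ⟨X, hX⟩ := hlam.omegaL_surjective x (-(diff (E := E) h x : E →L[ℝ] ℝ))
    refine ⟨X, fun u => ((omega_eq_omegaL hlam.1 x u X).trans ((omegaL_swap lam x u X).trans
      ((congrArg Neg.neg (DFunLike.congr_fun hX u)).trans (neg_neg _)))).symm⟩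
  exact Classical.epsilon_spec hex u

theorem IsExactSymplectic.liouvilleVF_spec {lam : OneForm E M} (hlam : IsExactSymplectic lam)
    (x : M) (u : TangentSpace 𝓘(ℝ, E) x) :
    lam x u = omega lam x (liouvilleVF lam x) u := by
  have hex : ∃ Y : TangentSpace 𝓘(ℝ, E) x,
      ∀ u : TangentSpace 𝓘(ℝ, E) x, lam x u = omega lam x Y u := by
    obtain ⟨X, hX⟩ := hlam.omegaL_surjective x (lam x : E →L[ℝ] ℝ)
    exact ⟨X, fun u => ((omega_eq_omegaL hlam.1 x X u).trans (DFunLike.congr_fun hX u)).symm⟩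
  exact Classical.epsilon_spec hex u

/-- `λ(X_h) = dh(Y)`. -/
theorem IsExactSymplectic.lam_hamVF {lam : OneForm E M} (hlam : IsExactSymplectic lam)
    (h : M → ℝ) (x : M) : lam x (hamVF lam h x) = diff h x (liouvilleVF lam x) := by
  rw [hlam.liouvilleVF_spec, hlam.hamVF_spec]

/-- `dh(X_h) = 0`. -/
theorem IsExactSymplectic.diff_hamVF {lam : OneForm E M} (hlam : IsExactSymplectic lam)
    (h : M → ℝ) (x : M) : diff h x (hamVF lam h x) = 0 :=
  (hlam.hamVF_spec h x _).trans ((omega_eq_omegaL hlam.1 x _ _).trans (omegaL_self lam x _))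

theorem diff_eq_fderiv_chart {h : M → ℝ} (x₀ : M) {x : M} (hx : x ∈ (chartAt E x₀).source)
    (hh : MDifferentiableAt 𝓘(ℝ, E) 𝓘(ℝ, ℝ) h x) (u : E) :
    diff (E := E) h x u =
      fderiv ℝ (fun y => h ((chartAt E x₀).symm y)) (chartAt E x₀ x) (chartDeriv x₀ x u) := by
  have hy := (chartAt E x₀).map_source hx
  have hl := (chartAt E x₀).left_inv hx
  have hcomp := mfderiv_comp_of_eq (I := 𝓘(ℝ, E)) (I' := 𝓘(ℝ, E)) (I'' := 𝓘(ℝ, ℝ)) hh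
    ((contMDiffAt_chartAt_symm x₀ hy).mdifferentiableAt (by simp)) hl
  have h0 : fderiv ℝ (fun y => h ((chartAt E x₀).symm y)) (chartAt E x₀ x) =
      mfderiv 𝓘(ℝ, E) 𝓘(ℝ, ℝ) (h ∘ (chartAt E x₀).symm) (chartAt E x₀ x) :=
    mfderiv_eq_fderiv.symm
  rw [h0, hcomp]
  have h1 := mfderiv_symm_chart_apply x₀ hx u
  exact (congrArg (fun w : E => (mfderiv 𝓘(ℝ, E) 𝓘(ℝ, ℝ) h
    ((chartAt E x₀).symm (chartAt E x₀ x)) w : ℝ)) h1).trans (by rw [hl]; rfl) |>.symm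

theorem omega_mfderiv_symm {lam : OneForm E M} (hlam : SmoothOneForm lam) (x₀ : M) {y : E}
    (hy : y ∈ (chartAt E x₀).target) (a : E) (X : TangentSpace 𝓘(ℝ, E) ((chartAt E x₀).symm y)) :
    omega lam ((chartAt E x₀).symm y) (mfderiv 𝓘(ℝ, E) 𝓘(ℝ, E) (chartAt E x₀).symm y a) X =
      extd (localForm lam x₀) y a (chartDeriv x₀ ((chartAt E x₀).symm y) X) :=
  (omega_eq_extd_chart hlam x₀ ((chartAt E x₀).map_target hy) _ _).trans
    ((congrArg (fun b : E => extd (localForm lam x₀) (chartAt E x₀ ((chartAt E x₀).symm y)) b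
      (chartDeriv x₀ ((chartAt E x₀).symm y) X)) (mfderiv_chart_symm_apply x₀ hy a)).trans
      (congrArg (fun z : E => extd (localForm lam x₀) z a
        (chartDeriv x₀ ((chartAt E x₀).symm y) X)) ((chartAt E x₀).right_inv hy)))

theorem diff_mfderiv_symm {h : M → ℝ} (x₀ : M) {y : E} (hy : y ∈ (chartAt E x₀).target)
    (hh : MDifferentiableAt 𝓘(ℝ, E) 𝓘(ℝ, ℝ) h ((chartAt E x₀).symm y)) (a : E) :
    diff (E := E) h ((chartAt E x₀).symm y)
      (mfderiv 𝓘(ℝ, E) 𝓘(ℝ, E) (chartAt E x₀).symm y a) =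
      fderiv ℝ (fun y => h ((chartAt E x₀).symm y)) y a :=
  (diff_eq_fderiv_chart x₀ ((chartAt E x₀).map_target hy) hh _).trans
    ((congrArg (fun b : E => fderiv ℝ (fun y => h ((chartAt E x₀).symm y))
      (chartAt E x₀ ((chartAt E x₀).symm y)) b) (mfderiv_chart_symm_apply x₀ hy a)).trans
      (congrArg (fun z : E => fderiv ℝ (fun y => h ((chartAt E x₀).symm y)) z a)
        ((chartAt E x₀).right_inv hy)))

variable {P : Type*} [NormedAddCommGroup P] [NormedSpace ℝ P]

/-- The flip places the unknown Hamiltonian vector in the first argument, so that the defining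
equation `dh = ω(·, X)` reads as a linear system with this invertible operator. -/
theorem IsExactSymplectic.extdL_injective {lam : OneForm E M} (hlam : IsExactSymplectic lam)
    (x₀ : M) {y : E} (hy : y ∈ (chartAt E x₀).target) :
    Function.Injective (extdL (localForm lam x₀) y).flip := by
  rw [injective_iff_map_eq_zero]
  intro b hb
  have hx := (chartAt E x₀).map_target hy
  have hr := (chartAt E x₀).right_inv hy
  have h0 : (mfderiv 𝓘(ℝ, E) 𝓘(ℝ, E) (chartAt E x₀).symm y b : E) = 0 := by
    refine hlam.2 ((chartAt E x₀).symm y) _ fun w => (omega_mfderiv_symm hlam.1 x₀ hy b w).trans ?_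
    rw [extd_swap, ← extdL_apply, neg_eq_zero]
    exact DFunLike.congr_fun hb _
  have h1 := mfderiv_chart_symm_apply x₀ hy b
  refine h1.symm.trans ?_
  exact (congrArg (fun w : E => (mfderiv 𝓘(ℝ, E) 𝓘(ℝ, E) (chartAt E x₀)
    ((chartAt E x₀).symm y) w : E)) h0).trans (ContinuousLinearMap.map_zero _)

/-- Hamiltonian vector fields depend smoothly on smooth parameters. -/
theorem IsExactSymplectic.smoothFamily_hamVF [FiniteDimensional ℝ P] {lam : OneForm E M}
    (hlam : IsExactSymplectic lam)
    {K : P → M → ℝ} (hK : ContMDiff (𝓘(ℝ, E).prod 𝓘(ℝ, P)) 𝓘(ℝ, ℝ) ∞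
      (fun q : M × P => K q.2 q.1)) : SmoothFamily (fun p x => hamVF lam (K p) x) := by
  refine smoothFamily_iff.2 fun x₀ => ?_
  rintro ⟨y, p⟩ ⟨hy, -⟩
  apply ContDiffAt.contDiffWithinAt
  set e := chartAt E x₀ with he
  set B : E → E →L[ℝ] E →L[ℝ] ℝ := fun y => (extdL (localForm lam x₀) y).flip with hB
  have hBs : ContDiffAt ℝ ∞ B y := by
    have h1 : ContDiffAt ℝ ∞ (fderiv ℝ (localForm lam x₀)) y :=
      (hlam.1.contDiffAt_localForm x₀ hy).fderiv_right (by simp)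
    have hfl : ∀ G : E → E →L[ℝ] E →L[ℝ] ℝ, ContDiffAt ℝ ∞ G y →
        ContDiffAt ℝ ∞ (fun z => (G z).flip) y := fun G hG =>
      ContDiffAt.comp y (g := fun b : E →L[ℝ] E →L[ℝ] ℝ => b.flip)
        (contDiff_of_linear _ (fun _ _ => rfl) (fun _ _ => rfl)).contDiffAt hG
    exact hfl _ (h1.sub (hfl _ h1))
  have hBinv : ∀ z ∈ e.target, ∃ F : E ≃L[ℝ] (E →L[ℝ] ℝ), (F : E →L[ℝ] E →L[ℝ] ℝ) = B z := by
    intro z hz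
    refine ⟨(LinearEquiv.ofInjectiveOfFinrankEq (B z : E →ₗ[ℝ] E →L[ℝ] ℝ)
      (hlam.extdL_injective x₀ hz) (finrank_dual_eq E)).toContinuousLinearEquiv, ?_⟩
    ext u w
    rfl
  set k : E × P → ℝ := fun q => K q.2 (e.symm q.1) with hk
  have hks : ∀ z ∈ e.target, ∀ p, ContDiffAt ℝ ∞ k (z, p) := by
    intro z hz p
    apply contMDiffAt_iff_contDiffAt.1
    have h1 : ContMDiffAt 𝓘(ℝ, E × P) (𝓘(ℝ, E).prod 𝓘(ℝ, P)) ∞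
        (fun q : E × P => (e.symm q.1, q.2)) (z, p) :=
      ContMDiffAt.prodMk (ContMDiffAt.comp (z, p) (contMDiffAt_chartAt_symm x₀ hz)
        contDiff_fst.contMDiff.contMDiffAt) contDiff_snd.contMDiff.contMDiffAt
    exact ContMDiffAt.comp (z, p) (hK (e.symm z, p)) h1
  have hkd : ContDiffAt ℝ ∞ (fun q : E × P => (fderiv ℝ k q).comp
      (ContinuousLinearMap.inl ℝ E P)) (y, p) :=
    ((hks y hy p).fderiv_right (by simp)).clm_comp contDiffAt_const
  -- In the chart the field is the solution `B⁻¹ (dK)` of a linear system, and inversion of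
  -- operators is smooth at isomorphisms.
  have hsol : ContDiffAt ℝ ∞ (fun q : E × P => ContinuousLinearMap.inverse (B q.1)
      ((fderiv ℝ k q).comp (ContinuousLinearMap.inl ℝ E P))) (y, p) := by
    obtain ⟨F, hF⟩ := hBinv y hy
    have h1 : ContDiffAt ℝ ∞ ContinuousLinearMap.inverse (B y) := by
      rw [← hF]; exact contDiffAt_map_inverse F
    have h2 : ContDiffAt ℝ ∞ (fun q : E × P => B q.1) (y, p) :=
      ContDiffAt.comp (y, p) (f := Prod.fst) hBs contDiffAt_fst
    have h3 : ContDiffAt ℝ ∞ (fun q : E × P => ContinuousLinearMap.inverse (B q.1)) (y, p) :=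
      ContDiffAt.comp (y, p) (f := fun q : E × P => B q.1) h1 h2
    exact h3.clm_apply hkd
  refine hsol.congr_of_eventuallyEq ?_
  have hev : ∀ᶠ q : E × P in 𝓝 (y, p), q.1 ∈ e.target :=
    continuousAt_fst.eventually_mem (e.open_target.mem_nhds hy)
  filter_upwards [hev] with q hq
  obtain ⟨z, p'⟩ := q
  obtain ⟨F, hF⟩ := hBinv z hq
  simp only at hq ⊢
  rw [← hF, ContinuousLinearMap.inverse_equiv]
  rw [← F.symm_apply_apply (chartVF (fun p x => hamVF lam (K p) x) x₀ (z, p'))]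
  change F.symm _ = F.symm _
  congr 1
  refine ContinuousLinearMap.ext fun a => ?_
  have hFB : F (chartVF (fun p x => hamVF lam (K p) x) x₀ (z, p')) =
    B z (chartVF (fun p x => hamVF lam (K p) x) x₀ (z, p')) := by rw [← hF]; rfl
  rw [hFB]
  have hx := e.map_target hq
  have hdK : MDifferentiableAt 𝓘(ℝ, E) 𝓘(ℝ, ℝ) (K p') (e.symm z) := by
    have hpr : ContMDiff 𝓘(ℝ, E) (𝓘(ℝ, E).prod 𝓘(ℝ, P)) ∞ (fun x : M => (x, p')) :=
      contMDiff_id.prodMk contMDiff_const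
    have h1 : ContMDiff 𝓘(ℝ, E) 𝓘(ℝ, ℝ) ∞ (K p') := 
      ContMDiff.comp (g := fun q : M × P => K q.2 q.1) (f := fun x : M => (x, p')) hK hpr
    exact h1.mdifferentiable (by simp) _
  have h4 : fderiv ℝ (fun y => K p' (e.symm y)) z a =
      ((fderiv ℝ k (z, p')).comp (ContinuousLinearMap.inl ℝ E P)) a := by
    have h5 : HasFDerivAt (fun y => k (y, p'))
        ((fderiv ℝ k (z, p')).comp (ContinuousLinearMap.inl ℝ E P)) z :=
      HasFDerivAt.comp (g := k) (f := fun y => (y, p')) z (((hks z hq p').differentiableAt (by simp)).hasFDerivAt)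
        (hasFDerivAt_prodMk_left z p')
    rw [← h5.fderiv]
  refine Eq.symm ?_
  exact h4.symm.trans ((diff_mfderiv_symm x₀ hq hdK a).symm.trans
    ((hlam.hamVF_spec (K p') (e.symm z) _).trans ((omega_mfderiv_symm hlam.1 x₀ hq a _).trans
      (extdL_apply _ _ _ _).symm)))

theorem SmoothFamily.smul {Z : P → (x : M) → TangentSpace 𝓘(ℝ, E) x} (hZ : SmoothFamily Z)
    {g : M × P → ℝ} (hg : ContMDiff (𝓘(ℝ, E).prod 𝓘(ℝ, P)) 𝓘(ℝ, ℝ) ∞ g) :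
    SmoothFamily (fun p x => g (x, p) • Z p x) := by
  refine smoothFamily_iff.2 fun x₀ => ?_
  rintro ⟨y, p⟩ hq
  apply ContDiffAt.contDiffWithinAt
  have hopen : IsOpen ((chartAt E x₀).target ×ˢ (univ : Set P)) :=
    (chartAt E x₀).open_target.prod isOpen_univ
  have h0 := (smoothFamily_iff.1 hZ x₀).contDiffAt (hopen.mem_nhds hq)
  have h1 : ContMDiffAt 𝓘(ℝ, E × P) (𝓘(ℝ, E).prod 𝓘(ℝ, P)) ∞
      (fun q : E × P => ((chartAt E x₀).symm q.1, q.2)) (y, p) :=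
    ContMDiffAt.prodMk (ContMDiffAt.comp (y, p) (contMDiffAt_chartAt_symm x₀ hq.1)
      contDiff_fst.contMDiff.contMDiffAt) contDiff_snd.contMDiff.contMDiffAt
  have h2 : ContDiffAt ℝ ∞ (fun q : E × P => g ((chartAt E x₀).symm q.1, q.2)) (y, p) :=
    contMDiffAt_iff_contDiffAt.1 (ContMDiffAt.comp (y, p) (hg _) h1)
  refine (h2.smul h0).congr_of_eventuallyEq (Filter.Eventually.of_forall fun q => ?_)
  exact (chartDeriv (E := E) (M := M) x₀ ((chartAt E x₀).symm q.1)).map_smul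
    (g ((chartAt E x₀).symm q.1, q.2)) (Z q.2 ((chartAt E x₀).symm q.1))

/-- Evaluation of a smooth one-form on a smooth family of vector fields. -/
theorem SmoothOneForm.contMDiff_apply {lam : OneForm E M} (hlam : SmoothOneForm lam)
    {Z : P → (x : M) → TangentSpace 𝓘(ℝ, E) x} (hZ : SmoothFamily Z) :
    ContMDiff (𝓘(ℝ, E).prod 𝓘(ℝ, P)) 𝓘(ℝ, ℝ) ∞ (fun q : M × P => (lam q.1 (Z q.2 q.1) : ℝ)) := by
  intro q
  have hfst : ContMDiffAt (𝓘(ℝ, E).prod 𝓘(ℝ, P)) 𝓘(ℝ, E) ∞ (Prod.fst : M × P → M) q :=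
    contMDiffAt_fst
  have hphi := ContMDiffAt.comp q (hlam q.1) hfst
  have h := ContMDiffAt.clm_bundle_apply (E₂ := Bundle.Trivial M ℝ)
    (ϕ := fun q : M × P => lam q.1) hphi (hZ q)
  rw [Bundle.contMDiffAt_totalSpace] at h
  exact h.2

end Forms
/-! ### Tangent spaces of Lagrangian submanifolds -/

/-! ### Half-dimensional subspaces and the dimension count for non-degeneracy -/

section LinearAlgebra

variable {V W : Type*} [NormedAddCommGroup V] [NormedSpace ℝ V] [FiniteDimensional ℝ V]

theorem finrank_inf_ker_add_one (T : Submodule ℝ V) (k : V →L[ℝ] ℝ) {Y : V} (hY : Y ∈ T)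
    (hk : k Y ≠ 0) :
    Module.finrank ℝ (T ⊓ LinearMap.ker k.toLinearMap : Submodule ℝ V) + 1 =
      Module.finrank ℝ T := by
  set f : T →ₗ[ℝ] ℝ := k.toLinearMap.comp T.subtype with hf
  have hsurj : LinearMap.range f = ⊤ := by
    rw [LinearMap.range_eq_top]
    intro r
    refine ⟨(r / k Y) • ⟨Y, hY⟩, ?_⟩
    have : f ⟨Y, hY⟩ = k Y := rfl
    rw [map_smul, this, smul_eq_mul, div_mul_cancel₀ _ hk]
  have h1 := f.finrank_range_add_finrank_ker
  rw [hsurj, finrank_top, Module.finrank_self] at h1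
  have h2 : Submodule.map T.subtype (LinearMap.ker f) = T ⊓ LinearMap.ker k.toLinearMap := by
    rw [hf, LinearMap.ker_comp, Submodule.map_comap_subtype]
  rw [← h2, Submodule.finrank_map_subtype_eq]
  omega

/-- The dimension count behind the notion of non-degeneracy of a chord. -/
theorem sup_eq_ker_and_disjoint_iff {T₀ T₁ : Submodule ℝ V} {k₀ k₁ : V →L[ℝ] ℝ}
    {D : V × ℝ →L[ℝ] V} (hD : ∀ u, k₀ u = 0 → ∀ r, k₁ (D (u, r)) = 0)
    (h₀ : 2 * Module.finrank ℝ T₀ = Module.finrank ℝ V)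
    (h₁ : 2 * Module.finrank ℝ T₁ = Module.finrank ℝ V)
    {Y₀ Y₁ : V} (hY₀ : Y₀ ∈ T₀) (hk₀ : k₀ Y₀ ≠ 0) (hY₁ : Y₁ ∈ T₁) (hk₁ : k₁ Y₁ ≠ 0) :
    (Submodule.map D.toLinearMap ((T₀ ⊓ LinearMap.ker k₀.toLinearMap).prod ⊤) ⊔
        (T₁ ⊓ LinearMap.ker k₁.toLinearMap) = LinearMap.ker k₁.toLinearMap ∧
      Disjoint (Submodule.map D.toLinearMap ((T₀ ⊓ LinearMap.ker k₀.toLinearMap).prod ⊤))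
        (T₁ ⊓ LinearMap.ker k₁.toLinearMap)) ↔
    ∀ u ∈ T₀, k₀ u = 0 → ∀ r, D (u, r) ∈ T₁ → u = 0 ∧ r = 0 := by
  set N₀ := T₀ ⊓ LinearMap.ker k₀.toLinearMap with hN₀
  set N₁ := T₁ ⊓ LinearMap.ker k₁.toLinearMap with hN₁
  set I := Submodule.map D.toLinearMap (N₀.prod (⊤ : Submodule ℝ ℝ)) with hI
  -- If `dim V = 2m`, then `N₀` and `N₁` have dimension `m - 1`, the source `N₀ × ℝ` has dimension
  -- `m`, and `ker k₁` has dimension `2m - 1 = m + (m - 1)`. Hence being complementary in `ker k₁`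
  -- amounts to `D` being injective on `N₀ × ℝ` with image meeting `N₁` trivially.
  have d₀ : Module.finrank ℝ N₀ + 1 = _ := finrank_inf_ker_add_one T₀ k₀ hY₀ hk₀
  have d₁ : Module.finrank ℝ N₁ + 1 = _ := finrank_inf_ker_add_one T₁ k₁ hY₁ hk₁
  have dk := finrank_inf_ker_add_one ⊤ k₁ (Submodule.mem_top (x := Y₁)) hk₁
  rw [top_inf_eq, finrank_top] at dk
  have dp : Module.finrank ℝ (N₀.prod (⊤ : Submodule ℝ ℝ)) = Module.finrank ℝ N₀ + 1 := by
    let F : N₀.prod (⊤ : Submodule ℝ ℝ) ≃ₗ[ℝ] N₀ × ℝ :=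
      { toFun := fun x => (⟨x.1.1, x.2.1⟩, x.1.2)
        invFun := fun x => ⟨(x.1.1, x.2), x.1.2, trivial⟩
        map_add' := fun _ _ => rfl
        map_smul' := fun _ _ => rfl
        left_inv := fun _ => rfl
        right_inv := fun _ => rfl }
    rw [F.finrank_eq, Module.finrank_prod, Module.finrank_self]
  have hIk : I ≤ LinearMap.ker k₁.toLinearMap := by
    rintro _ ⟨⟨u, r⟩, ⟨hu, -⟩, rfl⟩
    exact hD u hu.2 r
  have hsum := Submodule.finrank_sup_add_finrank_inf_eq I N₁
  constructor
  · rintro ⟨hsup, hdisj⟩ u hu hku r hr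
    rw [hsup, hdisj.eq_bot, finrank_bot] at hsum
    set f := D.toLinearMap.domRestrict (N₀.prod (⊤ : Submodule ℝ ℝ)) with hf
    have hrange : LinearMap.range f = I := by
      rw [hf, hI, LinearMap.range_domRestrict]
    have hrk := f.finrank_range_add_finrank_ker
    rw [hrange] at hrk
    have hker : LinearMap.ker f = ⊥ := by
      rw [← Submodule.finrank_eq_zero (R := ℝ)]
      omega
    have hmem : (u, r) ∈ N₀.prod (⊤ : Submodule ℝ ℝ) := ⟨⟨hu, hku⟩, trivial⟩
    have hz : D (u, r) = 0 :=
      Submodule.disjoint_def.1 hdisj _ ⟨_, hmem, rfl⟩ ⟨hr, hD u hku r⟩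
    have h0 : (⟨(u, r), hmem⟩ : N₀.prod (⊤ : Submodule ℝ ℝ)) = 0 :=
      LinearMap.ker_eq_bot'.1 hker _ hz
    exact Prod.mk_eq_zero.1 (congrArg Subtype.val h0)
  · intro h
    have hdisj : Disjoint I N₁ := by
      rw [Submodule.disjoint_def]
      rintro _ ⟨⟨u, r⟩, ⟨hu, -⟩, rfl⟩ hy
      obtain ⟨rfl, rfl⟩ := h u hu.1 hu.2 r hy.1
      exact D.map_zero
    refine ⟨?_, hdisj⟩
    have hfr : Module.finrank ℝ I = Module.finrank ℝ (N₀.prod (⊤ : Submodule ℝ ℝ)) := by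
      set f := D.toLinearMap.domRestrict (N₀.prod (⊤ : Submodule ℝ ℝ)) with hf
      have hrange : LinearMap.range f = I := by
        rw [hf, hI, LinearMap.range_domRestrict]
      rw [← hrange]
      apply LinearMap.finrank_range_of_inj
      rw [← LinearMap.ker_eq_bot, LinearMap.ker_eq_bot']
      rintro ⟨⟨u, r⟩, ⟨hu, hr⟩⟩ hz
      have hz' : D (u, r) = 0 := hz
      obtain ⟨rfl, rfl⟩ := h u hu.1 hu.2 r (by rw [hz']; exact zero_mem _)
      rfl
    rw [hdisj.eq_bot, finrank_bot] at hsum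
    refine Submodule.eq_of_le_of_finrank_eq (sup_le hIk inf_le_right) ?_
    omega

/-- A subspace which is its own orthogonal complement has half the dimension. -/
theorem two_mul_finrank_of_isotropic {b : V →L[ℝ] V →L[ℝ] ℝ} (hsw : ∀ u w, b u w = -b w u)
    (hinj : Function.Injective b) {T : Submodule ℝ V} (hT : ∀ u, u ∈ T ↔ ∀ w ∈ T, b u w = 0) :
    2 * Module.finrank ℝ T = Module.finrank ℝ V := by
  set B : LinearMap.BilinForm ℝ V :=
    { toFun := fun u => (b u).toLinearMap
      map_add' := fun u v => by ext; simp
      map_smul' := fun r v => by ext; simp } with hB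
  have hBa : ∀ u w, B u w = b u w := fun _ _ => rfl
  have hrefl : B.IsRefl := by
    intro u w h
    rw [hBa] at h ⊢
    rw [hsw, h, neg_zero]
  have hnd : B.Nondegenerate := by
    refine (LinearMap.IsRefl.nondegenerate_iff_separatingLeft hrefl).2 ?_
    intro u hu
    exact (injective_iff_map_eq_zero b).1 hinj u (ContinuousLinearMap.ext hu)
  have horth : B.orthogonal T = T := by
    ext u
    rw [LinearMap.BilinForm.mem_orthogonal_iff, hT u]
    refine forall₂_congr fun w hw => ?_
    change b w u = 0 ↔ _
    rw [hsw, neg_eq_zero]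
  have h := LinearMap.BilinForm.finrank_orthogonal hnd T
  rw [horth] at h
  have := Submodule.finrank_le T
  omega

end LinearAlgebra

/-! ### Tangent spaces of submanifolds in adapted charts -/

section Tangent

variable {E : Type*} [NormedAddCommGroup E] [NormedSpace ℝ E] [FiniteDimensional ℝ E]
  {M : Type*} [TopologicalSpace M] [ChartedSpace E M] [IsManifold 𝓘(ℝ, E) ∞ M]

theorem _root_.HasDerivAt.mem_submodule {f : ℝ → E} {f' : E} {t : ℝ} (hf : HasDerivAt f f' t)
    {W : Submodule ℝ E} (hW : ∀ᶠ s in 𝓝 t, f s ∈ W) : f' ∈ W := by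
  have hcl : IsClosed (W : Set E) := W.closed_of_finiteDimensional
  refine hcl.mem_of_tendsto (hasDerivAt_iff_tendsto_slope.1 hf) ?_
  have ht := hW.self_of_nhds
  filter_upwards [nhdsWithin_le_nhds hW] with s hs
  exact W.smul_mem _ (W.sub_mem hs ht)

variable {φ : OpenPartialHomeomorph M E}

theorem mdifferentiable_of_mem_maximalAtlas
    (hφ : φ ∈ IsManifold.maximalAtlas 𝓘(ℝ, E) ∞ M) : φ.MDifferentiable 𝓘(ℝ, E) 𝓘(ℝ, E) :=
  ⟨(contMDiffOn_of_mem_maximalAtlas hφ).mdifferentiableOn (by simp),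
    (contMDiffOn_symm_of_mem_maximalAtlas hφ).mdifferentiableOn (by simp)⟩

theorem mem_tangent_of_hasMFDerivAt {L : Set M} {c : ℝ → M} {t : ℝ}
    (hL : ∀ᶠ s in 𝓝 t, c s ∈ L) {c' : ℝ →L[ℝ] TangentSpace 𝓘(ℝ, E) (c t)}
    (hc : HasMFDerivAt 𝓘(ℝ, ℝ) 𝓘(ℝ, E) c t c') : c' 1 ∈ tangent L (c t) := by
  refine Submodule.subset_span ⟨fun s => c (s + t), by simp, ?_, c', ?_, rfl⟩
  · have : Tendsto (fun s : ℝ => s + t) (𝓝 0) (𝓝 t) := by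
      have h : Continuous fun s : ℝ => s + t := by fun_prop
      simpa using h.tendsto 0
    exact this.eventually hL
  · have h1 : HasMFDerivAt 𝓘(ℝ, ℝ) 𝓘(ℝ, ℝ) (fun s : ℝ => s + t) 0
        (ContinuousLinearMap.id ℝ ℝ) :=
      (((hasFDerivAt_id (𝕜 := ℝ) (0 : ℝ)).add_const t)).hasMFDerivAt
    have hc' : HasMFDerivAt 𝓘(ℝ, ℝ) 𝓘(ℝ, E) c ((0 : ℝ) + t) c' := by
      have h0 : (0 : ℝ) + t = t := zero_add t
      rw [h0]; exact hc
    exact (HasMFDerivAt.comp (0 : ℝ) hc' h1)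

/-- In the adapted chart a curve in `L` stays in the closed subspace `W`, and so does its velocity.
Conversely, a vector of `W` is the velocity of a straight line in `W`, carried back by the inverse
chart. -/
theorem mem_tangent_iff (hφ : φ ∈ IsManifold.maximalAtlas 𝓘(ℝ, E) ∞ M) {L : Set M}
    {W : Submodule ℝ E} (hW : ∀ y ∈ φ.source, y ∈ L ↔ φ y ∈ W) {x : M} (hx : x ∈ φ.source)
    (hxL : x ∈ L) (u : TangentSpace 𝓘(ℝ, E) x) :
    u ∈ tangent L x ↔ (mfderiv 𝓘(ℝ, E) 𝓘(ℝ, E) φ x u : E) ∈ W := by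
  have hmd := mdifferentiable_of_mem_maximalAtlas hφ
  constructor
  · intro hu
    set D : E →L[ℝ] E := mfderiv 𝓘(ℝ, E) 𝓘(ℝ, E) φ x with hDdef
    have hle : (tangent L x : Submodule ℝ E) ≤
        W.comap (D : E →ₗ[ℝ] E) := by
      refine Submodule.span_le.2 ?_
      rintro _ ⟨c, hc0, hcL, c', hc', rfl⟩
      subst hc0
      have h1 := HasMFDerivAt.comp (0 : ℝ) (hmd.mdifferentiableAt hx).hasMFDerivAt hc'
      have h3 : HasFDerivAt (φ ∘ c) (D.comp (c' : ℝ →L[ℝ] E)) 0 :=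
        hasMFDerivAt_iff_hasFDerivAt.1 h1
      have h2 : HasDerivAt (φ ∘ c) (D.comp (c' : ℝ →L[ℝ] E) 1) 0 := h3.hasDerivAt
      refine h2.mem_submodule ?_
      have hcont : ContinuousAt c 0 := hc'.continuousAt
      filter_upwards [hcL, hcont.eventually_mem (φ.open_source.mem_nhds hx)] with t ht hts
      exact (hW _ hts).1 ht
    exact hle hu
  · intro hu
    set w : E := (mfderiv 𝓘(ℝ, E) 𝓘(ℝ, E) φ x u : E) with hw
    have hline : HasDerivAt (fun t : ℝ => φ x + t • w) w 0 := by
      have h1 : HasDerivAt (fun t : ℝ => t • w) ((1 : ℝ) • w) 0 :=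
        (hasDerivAt_id (0 : ℝ)).smul_const w
      rw [one_smul] at h1
      exact h1.const_add _
    have h0 : φ x + (0 : ℝ) • w = φ x := by simp
    set ℓ : ℝ →L[ℝ] E := ContinuousLinearMap.toSpanSingleton ℝ w with hℓ
    have hy : φ x ∈ φ.target := φ.map_source hx
    have hcont : Tendsto (fun t : ℝ => φ x + t • w) (𝓝 0) (𝓝 (φ x)) := by
      have := hline.continuousAt.tendsto
      rwa [h0] at this
    refine Submodule.subset_span ⟨fun t => φ.symm (φ x + t • w), ?_, ?_,
      (mfderiv 𝓘(ℝ, E) 𝓘(ℝ, E) φ.symm (φ x)).comp ℓ, ?_, ?_⟩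
    · simp [hx]
    · filter_upwards [hcont.eventually_mem (φ.open_target.mem_nhds hy)] with t ht
      rw [hW _ (φ.map_target ht), φ.right_inv ht]
      exact W.add_mem ((hW x hx).1 hxL) (W.smul_mem _ hu)
    · have h1 := (hmd.mdifferentiableAt_symm hy).hasMFDerivAt
      rw [← h0] at h1
      have h2 := HasMFDerivAt.comp (0 : ℝ) h1 hline.hasFDerivAt.hasMFDerivAt
      rw [h0] at h2
      exact h2
    · have h2 := DFunLike.congr_fun (hmd.symm_comp_deriv hx) u
      refine Eq.trans ?_ h2
      exact congrArg (fun e : E => (mfderiv 𝓘(ℝ, E) 𝓘(ℝ, E) φ.symm (φ x) e : E)) (one_smul ℝ w)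

/-- The Liouville vector field is tangent to exact Lagrangians. -/
theorem liouvilleVF_mem_tangent {lam : OneForm E M} (hlam : IsExactSymplectic lam) {L : Set M}
    (hL : IsExactLagrangian lam L) {x : M} (hx : x ∈ L) :
    liouvilleVF lam x ∈ tangent (E := E) L x :=
  (hL.2.2.1 x hx _).2 fun w hw => (hlam.liouvilleVF_spec x w).symm.trans (hL.2.2.2 x hx w hw)

theorem two_mul_finrank_tangent {lam : OneForm E M} (hlam : IsExactSymplectic lam) {L : Set M}
    (hL : IsExactLagrangian lam L) {x : M} (hx : x ∈ L) :
    2 * Module.finrank ℝ (tangent L x : Submodule ℝ E) = Module.finrank ℝ E := by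
  refine two_mul_finrank_of_isotropic (fun u w => omegaL_swap lam x u w)
    (hlam.omegaL_injective x) fun u => (hL.2.2.1 x hx u).trans ?_
  exact forall₂_congr fun w _ => by rw [← omega_eq_omegaL hlam.1 x u w]

end Tangent

/-! ### The path space -/

section PathSpace

variable {E : Type*} [NormedAddCommGroup E] [NormedSpace ℝ E] [FiniteDimensional ℝ E]
  {M : Type*} [TopologicalSpace M] [ChartedSpace E M] [IsManifold 𝓘(ℝ, E) ∞ M]
  {P : Type*} [NormedAddCommGroup P] [NormedSpace ℝ P] {L₀ L₁ : Set M}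

theorem PathSpace.extend_apply (v : PathSpace E L₀ L₁) {t : ℝ} (ht : t ∈ Icc (0 : ℝ) 1) :
    v.extend t = v.toFun ⟨t, ht⟩ := IccExtend_of_mem _ _ ht

theorem PathSpace.continuous_apply {g : M → ℝ} (hg : ContMDiff 𝓘(ℝ, E) 𝓘(ℝ, ℝ) ∞ g)
    (t : Icc (0 : ℝ) 1) : Continuous fun v : PathSpace E L₀ L₁ => g (v.toFun t) := by
  have h1 : Continuous (fun v : PathSpace E L₀ L₁ => UniformOnFun.ofFun {Icc (0 : ℝ) 1}
      (iteratedDerivWithin 0 (fun t => g (v.extend t)) (Icc 0 1))) :=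
    continuous_iInf_dom (i := ⟨g, hg⟩) (continuous_iInf_dom (i := 0) continuous_induced_dom)
  have h2 := (UniformOnFun.uniformContinuous_eval_of_mem ℝ {Icc (0 : ℝ) 1} t.2
    (mem_singleton _)).continuous.comp h1
  refine h2.congr fun v => ?_
  simp only [Function.comp, Function.eval, UniformOnFun.toFun_ofFun, iteratedDerivWithin_zero,
    v.extend_apply t.2]

/-- Smooth functions separate the points of `M`, so the continuous maps `v ↦ g (v t)` separate
paths. The Hausdorff property is needed to identify limits of chords. -/
theorem PathSpace.t2Space [T2Space M] [SecondCountableTopology M] :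
    T2Space (PathSpace E L₀ L₁) := by
  have : LocallyCompactSpace M := Manifold.locallyCompact_of_finiteDimensional 𝓘(ℝ, E)
  have : SigmaCompactSpace M := sigmaCompactSpace_of_locallyCompact_secondCountable
  refine T2Space.of_injective_continuous (f := fun (v : PathSpace E L₀ L₁)
    (q : {g : M → ℝ // ContMDiff 𝓘(ℝ, E) 𝓘(ℝ, ℝ) ∞ g} × Icc (0 : ℝ) 1) => q.1.1 (v.toFun q.2))
    ?_ (continuous_pi fun q => PathSpace.continuous_apply q.1.2 q.2)
  intro v w hvw
  ext t
  by_contra hne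
  obtain ⟨f, hf0, hf1, -⟩ := exists_contMDiffMap_zero_one_of_isClosed (n := ⊤) 𝓘(ℝ, E)
    (isClosed_singleton (x := v.toFun t)) (isClosed_singleton (x := w.toFun t))
    (by simpa using hne)
  have h := congrFun hvw (⟨f, f.contMDiff⟩, t)
  have h0 : f (v.toFun t) = 0 := hf0 rfl
  have h1 : f (w.toFun t) = 1 := hf1 rfl
  simp only at h
  rw [h0, h1] at h
  exact zero_ne_one h

/-- Applied to functions along a flow, this controls all time derivatives jointly in time and
initial data; applied to the Hamiltonians, it gives continuity of their parameter derivative. -/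
theorem contMDiff_deriv {G : ℝ × M × P → ℝ}
    (hG : ContMDiff (𝓘(ℝ, ℝ).prod (𝓘(ℝ, E).prod 𝓘(ℝ, P))) 𝓘(ℝ, ℝ) ∞ G) :
    ContMDiff (𝓘(ℝ, ℝ).prod (𝓘(ℝ, E).prod 𝓘(ℝ, P))) 𝓘(ℝ, ℝ) ∞
      (fun q : ℝ × M × P => deriv (fun t => G (t, q.2)) q.1) := by
  rintro ⟨t₀, x₀, p₀⟩
  set e := chartAt E x₀ with he
  set G' : ℝ × E × P → ℝ := fun q => G (q.1, e.symm q.2.1, q.2.2) with hG'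
  have hG's : ∀ q : ℝ × E × P, q.2.1 ∈ e.target → ContDiffAt ℝ ∞ G' q := by
    intro q hq
    apply contMDiffAt_iff_contDiffAt.1
    have h1 : ContMDiffAt 𝓘(ℝ, ℝ × E × P) 𝓘(ℝ, E) ∞
        (fun q : ℝ × E × P => e.symm q.2.1) q :=
      ContMDiffAt.comp q (contMDiffAt_chartAt_symm x₀ hq)
        (contDiff_fst.comp contDiff_snd).contMDiff.contMDiffAt
    have h2 : ContMDiffAt 𝓘(ℝ, ℝ × E × P) 𝓘(ℝ, ℝ) ∞ (fun q : ℝ × E × P => q.1) q :=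
      contDiff_fst.contMDiff.contMDiffAt
    have h3 : ContMDiffAt 𝓘(ℝ, ℝ × E × P) 𝓘(ℝ, P) ∞ (fun q : ℝ × E × P => q.2.2) q :=
      (contDiff_snd.comp contDiff_snd).contMDiff.contMDiffAt
    exact ContMDiffAt.comp q (g := G) (f := fun q : ℝ × E × P => (q.1, e.symm q.2.1, q.2.2))
      (hG _) (h2.prodMk (h1.prodMk h3))
  have hx₀ : x₀ ∈ e.source := mem_chart_source E x₀
  set d : ℝ × E × P → ℝ := fun q => fderiv ℝ G' q (1, 0, 0) with hd
  have hds : ContDiffAt ℝ ∞ d (t₀, e x₀, p₀) :=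
    ((hG's (t₀, e x₀, p₀) (e.map_source hx₀)).fderiv_right (m := ∞) (by simp)).clm_apply
      contDiffAt_const
  have hch : ContMDiffAt (𝓘(ℝ, ℝ).prod (𝓘(ℝ, E).prod 𝓘(ℝ, P))) 𝓘(ℝ, ℝ × E × P) ∞
      (fun q : ℝ × M × P => (q.1, e q.2.1, q.2.2)) (t₀, x₀, p₀) := by
    have hx : ContMDiffAt (𝓘(ℝ, ℝ).prod (𝓘(ℝ, E).prod 𝓘(ℝ, P))) 𝓘(ℝ, E) ∞
        (fun q : ℝ × M × P => q.2.1) (t₀, x₀, p₀) := contMDiffAt_fst.comp _ contMDiffAt_snd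
    have h1 : ContMDiffAt (𝓘(ℝ, ℝ).prod (𝓘(ℝ, E).prod 𝓘(ℝ, P))) 𝓘(ℝ, E) ∞
        (fun q : ℝ × M × P => e q.2.1) (t₀, x₀, p₀) :=
      ContMDiffAt.comp (t₀, x₀, p₀) (f := fun q : ℝ × M × P => q.2.1)
        (contMDiffAt_chartAt x₀ hx₀) hx
    have h2 : ContMDiffAt (𝓘(ℝ, ℝ).prod (𝓘(ℝ, E).prod 𝓘(ℝ, P))) 𝓘(ℝ, P) ∞
        (fun q : ℝ × M × P => q.2.2) (t₀, x₀, p₀) := contMDiffAt_snd.comp _ contMDiffAt_snd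
    exact contMDiffAt_fst.prodMk_space (h1.prodMk_space h2)
  refine (ContMDiffAt.comp (t₀, x₀, p₀) (g := d) hds.contMDiffAt hch).congr_of_eventuallyEq ?_
  have hev : ∀ᶠ q : ℝ × M × P in 𝓝 (t₀, x₀, p₀), q.2.1 ∈ e.source :=
    ((continuous_fst.comp continuous_snd).continuousAt).eventually_mem
      (e.open_source.mem_nhds hx₀)
  filter_upwards [hev] with q hq
  obtain ⟨t, x, p⟩ := q
  have h1 : (fun t => G (t, x, p)) = fun t => G' (t, e x, p) := by
    funext t
    simp only [hG', e.left_inv hq]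
  have h2 : HasDerivAt (fun t : ℝ => ((t, e x, p) : ℝ × E × P)) (1, 0, 0) t :=
    (hasDerivAt_id t).prodMk ((hasDerivAt_const t _).prodMk (hasDerivAt_const t _))
  have h3 := ((hG's (t, e x, p) (e.map_source hq)).differentiableAt (by simp)).hasFDerivAt
  simp only [Function.comp]
  rw [h1]
  exact (h3.comp_hasDerivAt t h2).deriv

theorem contMDiff_iteratedDeriv {G : ℝ × M × P → ℝ}
    (hG : ContMDiff (𝓘(ℝ, ℝ).prod (𝓘(ℝ, E).prod 𝓘(ℝ, P))) 𝓘(ℝ, ℝ) ∞ G) (k : ℕ) :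
    ContMDiff (𝓘(ℝ, ℝ).prod (𝓘(ℝ, E).prod 𝓘(ℝ, P))) 𝓘(ℝ, ℝ) ∞
      (fun q : ℝ × M × P => iteratedDeriv k (fun t => G (t, q.2)) q.1) := by
  induction k with
  | zero => simpa using hG
  | succ k ih =>
    simp only [iteratedDeriv_succ]
    exact contMDiff_deriv ih

variable {φ : ℝ × M × P → M}

theorem contMDiff_time (hφ : ContMDiff (𝓘(ℝ, ℝ).prod (𝓘(ℝ, E).prod 𝓘(ℝ, P))) 𝓘(ℝ, E) ∞ φ)
    (z : M × P) : ContMDiff 𝓘(ℝ, ℝ) 𝓘(ℝ, E) ∞ fun t => φ (t, z) := by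
  have h : ContMDiff 𝓘(ℝ, ℝ) (𝓘(ℝ, ℝ).prod (𝓘(ℝ, E).prod 𝓘(ℝ, P))) ∞
      (fun t : ℝ => (t, z)) := contMDiff_id.prodMk contMDiff_const
  exact ContMDiff.comp hφ h

/-- The path `t ↦ φ (t, z)`, `t ∈ [0,1]`. -/
noncomputable def flowPath
    (hφ : ContMDiff (𝓘(ℝ, ℝ).prod (𝓘(ℝ, E).prod 𝓘(ℝ, P))) 𝓘(ℝ, E) ∞ φ)
    (z : M × P) (h₀ : φ (0, z) ∈ L₀) (h₁ : φ (1, z) ∈ L₁) : PathSpace E L₀ L₁ where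
  toFun t := φ (t, z)
  smooth := ContMDiff.comp (g := fun t => φ (t, z)) (f := fun t : Icc (0 : ℝ) 1 => (t : ℝ))
    (contMDiff_time hφ z) contMDiff_subtypeVal_Icc
  source := h₀
  target := h₁

theorem flowPath_extend
    (hφ : ContMDiff (𝓘(ℝ, ℝ).prod (𝓘(ℝ, E).prod 𝓘(ℝ, P))) 𝓘(ℝ, E) ∞ φ)
    (z : M × P) (h₀ : φ (0, z) ∈ L₀) (h₁ : φ (1, z) ∈ L₁) {t : ℝ} (ht : t ∈ Icc (0 : ℝ) 1) :
    (flowPath hφ z h₀ h₁).extend t = φ (t, z) :=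
  (PathSpace.extend_apply (flowPath hφ z h₀ h₁) ht).trans rfl

/-- Every time derivative of `g ∘ φ` is jointly continuous in time and initial data. Currying yields
continuity for the compact-open topology, that is, uniform convergence on `[0,1]`, which is what the
`C^∞`-topology asks for each `g` and `k`. -/
theorem continuous_flowPath
    (hφ : ContMDiff (𝓘(ℝ, ℝ).prod (𝓘(ℝ, E).prod 𝓘(ℝ, P))) 𝓘(ℝ, E) ∞ φ)
    {Z : Type*} [TopologicalSpace Z] {ζ : Z → M × P} (hζ : Continuous ζ)
    (h₀ : ∀ z, φ (0, ζ z) ∈ L₀) (h₁ : ∀ z, φ (1, ζ z) ∈ L₁) :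
    Continuous fun z => flowPath (L₀ := L₀) (L₁ := L₁) hφ (ζ z) (h₀ z) (h₁ z) := by
  refine continuous_iInf_rng.2 fun g => continuous_iInf_rng.2 fun k => continuous_induced_rng.2 ?_
  have hG : ContMDiff (𝓘(ℝ, ℝ).prod (𝓘(ℝ, E).prod 𝓘(ℝ, P))) 𝓘(ℝ, ℝ) ∞ (fun q => g.1 (φ q)) :=
    ContMDiff.comp g.2 hφ
  set F : C(Z × ℝ, ℝ) := ⟨fun q => iteratedDeriv k (fun t => g.1 (φ (t, ζ q.1))) q.2, by
    have h1 := (contMDiff_iteratedDeriv hG k).continuous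
    have h2 : Continuous fun q : Z × ℝ => (q.2, ζ q.1) := by fun_prop
    exact h1.comp h2⟩ with hF
  rw [continuous_iff_continuousAt]
  intro z₀
  have h1 := (ContinuousMap.tendsto_iff_forall_isCompact_tendstoUniformlyOn.1
    (F.curry.continuous.tendsto z₀)) (Icc 0 1) isCompact_Icc
  refine UniformOnFun.tendsto_iff_tendstoUniformlyOn.2 fun s hs => ?_
  rw [mem_singleton_iff] at hs
  subst hs
  have hder : ∀ z, ∀ t ∈ Icc (0 : ℝ) 1, iteratedDerivWithin k
      (fun t => g.1 ((flowPath (L₀ := L₀) (L₁ := L₁) hφ (ζ z) (h₀ z) (h₁ z)).extend t))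
        (Icc 0 1) t = F.curry z t := by
    intro z t ht
    have hs : ContDiff ℝ ∞ (fun t => g.1 (φ (t, ζ z))) :=
      contMDiff_iff_contDiff.1 (ContMDiff.comp g.2 (contMDiff_time hφ (ζ z)))
    rw [iteratedDerivWithin_congr (g := fun t => g.1 (φ (t, ζ z)))
      (fun s hs => by simp only [flowPath_extend hφ _ _ _ hs]) ht]
    exact iteratedDerivWithin_eq_iteratedDeriv (uniqueDiffOn_Icc zero_lt_one)
      (hs.contDiffAt.of_le (by exact_mod_cast le_top)) ht
  refine (h1.congr ?_).congr_right ?_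
  · exact Eventually.of_forall fun z t ht => (hder z t ht).symm
  · exact fun t ht => (hder z₀ t ht).symm

end PathSpace

/-! ### Chords as trajectories of a cut-off Hamiltonian flow -/

section CutoffFlow

variable {E : Type*} [NormedAddCommGroup E] [NormedSpace ℝ E] [FiniteDimensional ℝ E]
  {M : Type*} [TopologicalSpace M] [ChartedSpace E M] [IsManifold 𝓘(ℝ, E) ∞ M]
  {L₀ L₁ : Set M}

/-- The tangent space of a submanifold, as a subspace of the model space. -/
noncomputable def tangentE (L : Set M) (x : M) : Submodule ℝ E := tangent L x

/-- The differential of a function, as a linear form on the model space. -/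
noncomputable def diffE (h : M → ℝ) (x : M) : E →L[ℝ] ℝ := diff h x

/-- A smooth family `K s` of Hamiltonians satisfying the contact condition for `s ∈ I`, and the
flow `φ (t, x, s, τ)` of the vector field `τ X_{K s}`, cut off away from the zero sets of `K s`,
`s ∈ I`. -/
structure CutoffFlow (lam : OneForm E M) (K : ℝ → M → ℝ) (I : Set ℝ) (χ : M → ℝ)
    (φ : ℝ × M × ℝ × ℝ → M) : Prop where
  exact_symplectic : IsExactSymplectic lam
  smooth_ham : ContMDiff (𝓘(ℝ, E).prod 𝓘(ℝ, ℝ)) 𝓘(ℝ, ℝ) ∞ (fun q : M × ℝ => K q.2 q.1)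
  flow : IsSmoothFlow (fun (p : ℝ × ℝ) x => (χ x * p.2) • hamVF lam (K p.1) x) φ
  cutoff : ∀ s ∈ I, ∀ x, K s x = 0 → ∀ᶠ y in 𝓝 x, χ y = 1
  contact : ∀ s ∈ I, ∀ x, K s x = 0 → 0 < diff (K s) x (liouvilleVF lam x)

namespace CutoffFlow

variable {lam : OneForm E M} {K : ℝ → M → ℝ} {I : Set ℝ} {χ : M → ℝ} {φ : ℝ × M × ℝ × ℝ → M}

theorem smooth_slice (h : CutoffFlow lam K I χ φ) (s : ℝ) :
    ContMDiff 𝓘(ℝ, E) 𝓘(ℝ, ℝ) ∞ (K s) := by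
  have hpr : ContMDiff 𝓘(ℝ, E) (𝓘(ℝ, E).prod 𝓘(ℝ, ℝ)) ∞ (fun x : M => (x, s)) :=
    contMDiff_id.prodMk contMDiff_const
  exact ContMDiff.comp (g := fun q : M × ℝ => K q.2 q.1) (f := fun x : M => (x, s))
    h.smooth_ham hpr

theorem contMDiff_hamVF (h : CutoffFlow lam K I χ φ) (s τ : ℝ) :
    ContMDiff 𝓘(ℝ, E) 𝓘(ℝ, E).tangent 1
      (fun x : M => (⟨x, τ • hamVF lam (K s) x⟩ : TangentBundle 𝓘(ℝ, E) M)) := by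
  have h1 : SmoothFamily (fun s x => hamVF lam (K s) x) :=
    h.exact_symplectic.smoothFamily_hamVF h.smooth_ham
  exact (h1.smul (g := fun _ => τ) contMDiff_const).contMDiff_one s

/-- The cut-off field is a pointwise multiple of `X_{K s}`, and `dK(X_K) = 0`, so energy is
conserved even where the cut-off is not `1`. -/
theorem ham_flow (h : CutoffFlow lam K I χ φ) (t : ℝ) (x : M) (s τ : ℝ) :
    K s (φ (t, x, s, τ)) = K s x := by
  have hd : ∀ t, HasDerivAt (fun t => K s (φ (t, x, s, τ))) 0 t := by
    intro t
    have h1 := h.flow.curve x (s, τ) t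
    have h2 := ((h.smooth_slice s).mdifferentiable (by simp) (φ (t, x, s, τ))).hasMFDerivAt
    have h3 := HasMFDerivAt.comp t h2 h1
    set v : E := hamVF lam (K s) (φ (t, x, s, τ)) with hv
    have h4 : HasFDerivAt (fun t => K s (φ (t, x, s, τ)))
        ((diffE (E := E) (K s) (φ (t, x, s, τ))).comp ((1 : ℝ →L[ℝ] ℝ).smulRight
          ((χ (φ (t, x, s, τ)) * τ) • v))) t := hasMFDerivAt_iff_hasFDerivAt.1 h3
    have h5 : diffE (E := E) (K s) (φ (t, x, s, τ)) v = 0 :=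
      h.exact_symplectic.diff_hamVF (K s) (φ (t, x, s, τ))
    simpa [h5] using h4.hasDerivAt
  have hc := is_const_of_deriv_eq_zero (fun t => (hd t).differentiableAt) (fun t => (hd t).deriv)
  have := hc t 0
  simp only [h.flow.zero] at this
  exact this

/-- A trajectory starting on the zero level remains there, where the cut-off equals `1`; the cut-off
is invisible to chords. -/
theorem isMIntegralCurve (h : CutoffFlow lam K I χ φ) {s : ℝ} (hs : s ∈ I) {x : M}
    (hx : K s x = 0) (τ : ℝ) : IsMIntegralCurve (I := 𝓘(ℝ, E)) (fun t => φ (t, x, s, τ))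
      (fun y => τ • hamVF lam (K s) y) := by
  intro t
  have h1 := h.flow.curve x (s, τ) t
  have h2 : χ (φ (t, x, s, τ)) = 1 :=
    (h.cutoff s hs _ ((h.ham_flow t x s τ).trans hx)).self_of_nhds
  simp only [h2, one_mul] at h1
  exact h1

theorem eqOn_of_isMIntegralCurveOn [T2Space M] (h : CutoffFlow lam K I χ φ) {s : ℝ} (hs : s ∈ I)
    {c : ℝ → M} {τ : ℝ} (hx : K s (c 0) = 0)
    (hc : IsMIntegralCurveOn (I := 𝓘(ℝ, E)) c (fun y => τ • hamVF lam (K s) y) (Icc 0 1)) :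
    EqOn c (fun t => φ (t, c 0, s, τ)) (Icc 0 1) :=
  eqOn_Icc_of_isMIntegralCurveOn (h.contMDiff_hamVF s τ) one_pos hc
    ((h.isMIntegralCurve hs hx τ).isMIntegralCurveOn _) (h.flow.zero _ _).symm

/-- Near the initial point of a chord, the flow of the Hamiltonian vector field agrees with the
cut-off flow. -/
theorem flow_eventuallyEq [T2Space M] (h : CutoffFlow lam K I χ φ) {s : ℝ} (hs : s ∈ I) {x₀ : M}
    (hx : K s x₀ = 0) {τ₀ : ℝ} (hτ : 0 < τ₀) :
    (fun q : M × ℝ => Chords.flow (hamVF lam (K s)) q.2 q.1) =ᶠ[𝓝 (x₀, τ₀)]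
      fun q => φ (1, q.1, s, q.2) := by
  have hcont : Continuous fun r : ℝ × M × ℝ => φ (r.1, r.2.1, s, r.2.2) :=
    h.flow.smooth.continuous.comp (by fun_prop)
  have hloc : ∀ t ∈ Icc (-1 : ℝ) 2, ∀ᶠ r : ℝ × M × ℝ in 𝓝 (t, (x₀, τ₀)),
      χ (φ (r.1, r.2.1, s, r.2.2)) = 1 := fun t _ =>
    hcont.continuousAt.eventually (h.cutoff s hs _ ((h.ham_flow t x₀ s τ₀).trans hx))
  -- By the tube lemma, the cut-off equals `1` along all nearby trajectories, on neighbouring levels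
  -- too. The interval `[-1, 2]` leaves room around `[0, 1]` for uniqueness on an open interval.
  have htube : ∀ᶠ q : M × ℝ in 𝓝 (x₀, τ₀), ∀ t ∈ Icc (-1 : ℝ) 2, χ (φ (t, q.1, s, q.2)) = 1 := by
    refine isCompact_Icc.eventually_forall_of_forall_eventually fun t ht => ?_
    have h1 : Tendsto (fun r : (M × ℝ) × ℝ => (r.2, r.1)) (𝓝 ((x₀, τ₀), t)) (𝓝 (t, (x₀, τ₀))) :=
      Continuous.tendsto' (by fun_prop) _ _ rfl
    exact h1.eventually (hloc t ht)
  have hpos : ∀ᶠ q : M × ℝ in 𝓝 (x₀, τ₀), 0 < q.2 :=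
    continuousAt_snd.eventually (lt_mem_nhds hτ)
  filter_upwards [htube, hpos] with q hq hqτ
  obtain ⟨x, τ⟩ := q
  simp only at hq hqτ ⊢
  have hγ0 : IsMIntegralCurveOn (I := 𝓘(ℝ, E)) (fun t => φ (t, x, s, τ))
      (τ • fun y => hamVF lam (K s) y) (Ioo (-1) 2) := by
    intro t ht
    have h1 := h.flow.curve x (s, τ) t
    simp only [hq t (Ioo_subset_Icc_self ht), one_mul] at h1
    exact h1.hasMFDerivWithinAt
  -- Time `1` of the flow of `τ X` is time `τ` of the flow of `X`.
  have hγ : IsMIntegralCurveOn (I := 𝓘(ℝ, E)) (fun t => φ (t * τ⁻¹, x, s, τ))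
      (fun y => hamVF lam (K s) y) (Ioo (-τ) (τ + τ)) := by
    have h1 := hγ0.comp_mul τ⁻¹
    rw [smul_smul, inv_mul_cancel₀ hqτ.ne', one_smul] at h1
    refine h1.mono ?_
    intro t ht
    simp only [mem_ofPred_eq, ← div_eq_mul_inv, mem_Ioo, lt_div_iff₀ hqτ, div_lt_iff₀ hqτ]
    constructor <;> linarith [ht.1, ht.2]
  -- All integral curves from `x` have the same endpoint, so the choice made in `flow` is
  -- immaterial.
  have hend : ∀ c : ℝ → M, c 0 = x → IsMIntegralCurveOn (I := 𝓘(ℝ, E)) c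
      (fun y => hamVF lam (K s) y) (uIcc 0 τ) → c τ = φ (1, x, s, τ) := by
    intro c hc0 hc
    rw [uIcc_of_le hqτ.le] at hc
    have hv := h.contMDiff_hamVF s 1
    simp only [one_smul] at hv
    have h2 := eqOn_Icc_of_isMIntegralCurveOn hv hqτ hc hγ
      (by simp only [zero_mul]; rw [hc0, h.flow.zero])
    have h3 := h2 (right_mem_Icc.2 hqτ.le)
    simpa only [mul_inv_cancel₀ hqτ.ne'] using h3
  have hex : ∃ y, Reaches (hamVF lam (K s)) τ x y := by
    refine ⟨_, fun t => φ (t * τ⁻¹, x, s, τ), by simp only [zero_mul]; exact h.flow.zero _ _,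
      rfl, ?_⟩
    rw [uIcc_of_le hqτ.le]
    exact hγ.mono (fun t ht => ⟨by linarith [ht.1], by linarith [ht.2]⟩)
  rw [Chords.flow, dif_pos hex]
  obtain ⟨c, hc0, hc1, hc⟩ := hex.choose_spec
  rw [← hc1]
  exact hend c hc0 hc

/-- The differential of `(x, τ) ↦ φ (1, x, s, τ)`. -/
noncomputable def endDeriv (φ : ℝ × M × ℝ × ℝ → M) (x : M) (s τ : ℝ) : E × ℝ →L[ℝ] E :=
  mfderiv (𝓘(ℝ, E).prod 𝓘(ℝ, ℝ)) 𝓘(ℝ, E) (fun q : M × ℝ => φ (1, q.1, s, q.2)) (x, τ)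

theorem contMDiff_end (h : CutoffFlow lam K I χ φ) (s : ℝ) :
    ContMDiff (𝓘(ℝ, E).prod 𝓘(ℝ, ℝ)) 𝓘(ℝ, E) ∞ (fun q : M × ℝ => φ (1, q.1, s, q.2)) := by
  have hpr : ContMDiff (𝓘(ℝ, E).prod 𝓘(ℝ, ℝ)) (𝓘(ℝ, ℝ).prod (𝓘(ℝ, E).prod 𝓘(ℝ, ℝ × ℝ))) ∞
      (fun q : M × ℝ => ((1 : ℝ), q.1, s, q.2)) :=
    contMDiff_const.prodMk (contMDiff_fst.prodMk (contMDiff_const.prodMk_space contMDiff_snd))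
  exact ContMDiff.comp h.flow.smooth hpr

/-- Differentiate the conservation of energy `K s (φ (1, x, s, τ)) = K s x` in `(x, τ)`. -/
theorem diff_endDeriv (h : CutoffFlow lam K I χ φ) (x : M) (s τ : ℝ) (u : E) (r : ℝ) :
    diffE (K s) (φ (1, x, s, τ)) (endDeriv (E := E) φ x s τ (u, r)) = diffE (K s) x u := by
  have h1 := ((h.smooth_slice s).mdifferentiable (by simp) (φ (1, x, s, τ))).hasMFDerivAt
  have h2 := ((h.contMDiff_end s).mdifferentiable (by simp) (x, τ)).hasMFDerivAt
  have h3 := HasMFDerivAt.comp (x, τ) h1 h2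
  have h4 : (K s ∘ fun q : M × ℝ => φ (1, q.1, s, q.2)) = fun q : M × ℝ => K s q.1 := by
    funext q
    exact h.ham_flow 1 q.1 s q.2
  rw [h4] at h3
  have h5 := ((h.smooth_slice s).mdifferentiable (by simp) x).hasMFDerivAt
  have h6 := HasMFDerivAt.comp (x, τ) h5
    (hasMFDerivAt_fst (I := 𝓘(ℝ, E)) (I' := 𝓘(ℝ, ℝ)) (x, τ))
  have h7 := hasMFDerivAt_unique h3 h6
  exact DFunLike.congr_fun h7 (u, r)

/-- The Hamiltonian flow may be replaced by the cut-off flow near the chord. Exact Lagrangians have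
half dimension and contain the Liouville direction, on which `dK` is positive, so the dimension
count turns the direct sum into an injectivity condition. -/
theorem nondegenerate_iff [T2Space M] (h : CutoffFlow lam K I χ φ)
    (hL₀ : IsExactLagrangian lam L₀) (hL₁ : IsExactLagrangian lam L₁)
    {p : PathSpace E L₀ L₁ × Ioi (0 : ℝ)} {s τ : ℝ} (hs : s ∈ I) {x : M} (hp : p.1.toFun 0 = x)
    (hpτ : (p.2 : ℝ) = τ) (hx : K s x = 0) (hx₁ : φ (1, x, s, τ) ∈ L₁) :
    Nondegenerate lam (K s) p ↔ ∀ u ∈ tangentE (E := E) L₀ x, diffE (K s) x u = 0 →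
      ∀ r : ℝ, endDeriv φ x s τ (u, r) ∈ tangentE (E := E) L₁ (φ (1, x, s, τ)) →
        u = 0 ∧ r = 0 := by
  have hτ : 0 < τ := hpτ ▸ p.2.2
  have hx₀ : x ∈ L₀ := hp ▸ p.1.source
  have hev := h.flow_eventuallyEq hs hx hτ
  have hy : Chords.flow (hamVF lam (K s)) τ x = φ (1, x, s, τ) := hev.self_of_nhds
  have hD : (mfderiv (𝓘(ℝ, E).prod 𝓘(ℝ, ℝ)) 𝓘(ℝ, E)
      (fun q : M × ℝ => Chords.flow (hamVF lam (K s)) q.2 q.1) (x, τ) : E × ℝ →L[ℝ] E) =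
      endDeriv (E := E) φ x s τ := hev.mfderiv_eq
  have hy0 : K s (φ (1, x, s, τ)) = 0 := (h.ham_flow 1 x s τ).trans hx
  refine Iff.trans ?_ (sup_eq_ker_and_disjoint_iff (V := E) (T₀ := tangentE L₀ x)
    (T₁ := tangentE L₁ (φ (1, x, s, τ))) (k₀ := diffE (E := E) (K s) x)
    (k₁ := diffE (E := E) (K s) (φ (1, x, s, τ))) (D := endDeriv (E := E) φ x s τ)
    (fun u hu r => (h.diff_endDeriv x s τ u r).trans hu)
    (two_mul_finrank_tangent h.exact_symplectic hL₀ hx₀)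
    (two_mul_finrank_tangent h.exact_symplectic hL₁ hx₁)
    (liouvilleVF_mem_tangent h.exact_symplectic hL₀ hx₀) (h.contact s hs x hx).ne'
    (liouvilleVF_mem_tangent h.exact_symplectic hL₁ hx₁) (h.contact s hs _ hy0).ne')
  subst hp hpτ
  rw [← hy, ← hD]
  exact Iff.rfl

end CutoffFlow

end CutoffFlow

/-! ### Non-degenerate chords persist and are isolated -/

namespace CutoffFlow

variable {E : Type*} [NormedAddCommGroup E] [NormedSpace ℝ E] [FiniteDimensional ℝ E]
  {M : Type*} [TopologicalSpace M] [ChartedSpace E M] [IsManifold 𝓘(ℝ, E) ∞ M]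
  {L₀ L₁ : Set M} {lam : OneForm E M} {K : ℝ → M → ℝ} {I : Set ℝ} {χ : M → ℝ}
  {φ : ℝ × M × ℝ × ℝ → M}

/-- The linearised non-degeneracy condition at `z = (x, s, τ)`. -/
def TransverseAt (E : Type*) [NormedAddCommGroup E] [NormedSpace ℝ E] [ChartedSpace E M]
    (K : ℝ → M → ℝ) (φ : ℝ × M × ℝ × ℝ → M) (L₀ L₁ : Set M) (z : M × ℝ × ℝ) :
    Prop :=
  ∀ u ∈ tangentE (E := E) L₀ z.1, diffE (K z.2.1) z.1 u = 0 → ∀ r : ℝ,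
    endDeriv φ z.1 z.2.1 z.2.2 (u, r) ∈ tangentE (E := E) L₁ (φ (1, z)) → u = 0 ∧ r = 0

variable {W₀ C : Submodule ℝ E}

/-- The equations for chords in adapted charts. -/
def chordEq (K : ℝ → M → ℝ) (φ : ℝ × M × ℝ × ℝ → M) (φ₀ φ₁ : OpenPartialHomeomorph M E)
    (π : E →L[ℝ] C) (a : W₀ × ℝ × ℝ) : ℝ × ℝ × C :=
  (a.2.1, K a.2.1 (φ₀.symm a.1), π (φ₁ (φ (1, φ₀.symm a.1, a.2))))

variable {φ₀ φ₁ : OpenPartialHomeomorph M E} {π : E →L[ℝ] C}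

theorem contMDiffAt_symm_coe (hφ₀ : φ₀ ∈ IsManifold.maximalAtlas 𝓘(ℝ, E) ∞ M) {ξ : W₀}
    (hξ : (ξ : E) ∈ φ₀.target) :
    ContMDiffAt 𝓘(ℝ, W₀) 𝓘(ℝ, E) ∞ (fun ξ : W₀ => φ₀.symm ξ) ξ :=
  ContMDiffAt.comp ξ (g := φ₀.symm) (f := fun ξ : W₀ => (ξ : E))
    (contMDiffAt_symm_of_mem_maximalAtlas hφ₀ hξ) W₀.subtypeL.contDiff.contMDiff.contMDiffAt

theorem contDiffAt_chordEq (h : CutoffFlow lam K I χ φ)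
    (hφ₀ : φ₀ ∈ IsManifold.maximalAtlas 𝓘(ℝ, E) ∞ M)
    (hφ₁ : φ₁ ∈ IsManifold.maximalAtlas 𝓘(ℝ, E) ∞ M) {a : W₀ × ℝ × ℝ}
    (ha₀ : (a.1 : E) ∈ φ₀.target) (ha₁ : φ (1, φ₀.symm a.1, a.2) ∈ φ₁.source) :
    ContDiffAt ℝ ∞ (chordEq K φ φ₀ φ₁ π) a := by
  have hx : ContMDiffAt 𝓘(ℝ, W₀ × ℝ × ℝ) 𝓘(ℝ, E) ∞ (fun a : W₀ × ℝ × ℝ => φ₀.symm a.1) a :=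
    ContMDiffAt.comp a (g := fun ξ : W₀ => φ₀.symm ξ) (f := fun a : W₀ × ℝ × ℝ => a.1)
      (contMDiffAt_symm_coe hφ₀ ha₀) contDiff_fst.contMDiff.contMDiffAt
  have h2 : ContMDiffAt 𝓘(ℝ, W₀ × ℝ × ℝ) 𝓘(ℝ, ℝ × ℝ) ∞ (fun a : W₀ × ℝ × ℝ => a.2) a :=
    contDiff_snd.contMDiff.contMDiffAt
  have hs : ContMDiffAt 𝓘(ℝ, W₀ × ℝ × ℝ) 𝓘(ℝ, ℝ) ∞ (fun a : W₀ × ℝ × ℝ => a.2.1) a :=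
    (contDiff_fst.comp contDiff_snd).contMDiff.contMDiffAt
  have hK : ContMDiffAt 𝓘(ℝ, W₀ × ℝ × ℝ) 𝓘(ℝ, ℝ) ∞
      (fun a : W₀ × ℝ × ℝ => K a.2.1 (φ₀.symm a.1)) a :=
    ContMDiffAt.comp a (g := fun q : M × ℝ => K q.2 q.1)
      (f := fun a : W₀ × ℝ × ℝ => (φ₀.symm a.1, a.2.1)) (h.smooth_ham _) (hx.prodMk hs)
  have hone : ContMDiffAt 𝓘(ℝ, W₀ × ℝ × ℝ) 𝓘(ℝ, ℝ) ∞ (fun _ : W₀ × ℝ × ℝ => (1 : ℝ)) a :=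
    contMDiffAt_const
  have hend : ContMDiffAt 𝓘(ℝ, W₀ × ℝ × ℝ) 𝓘(ℝ, E) ∞
      (fun a : W₀ × ℝ × ℝ => φ (1, φ₀.symm a.1, a.2)) a :=
    ContMDiffAt.comp a (g := φ) (f := fun a : W₀ × ℝ × ℝ => (1, φ₀.symm a.1, a.2))
      (h.flow.smooth _) (hone.prodMk (hx.prodMk h2))
  have hend' : ContMDiffAt 𝓘(ℝ, W₀ × ℝ × ℝ) 𝓘(ℝ, E) ∞
      (fun a : W₀ × ℝ × ℝ => φ₁ (φ (1, φ₀.symm a.1, a.2))) a :=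
    ContMDiffAt.comp a (g := φ₁) (f := fun a : W₀ × ℝ × ℝ => φ (1, φ₀.symm a.1, a.2))
      (contMDiffAt_of_mem_maximalAtlas hφ₁ ha₁) hend
  have h3 : ContDiffAt ℝ ∞ (fun a : W₀ × ℝ × ℝ => π (φ₁ (φ (1, φ₀.symm a.1, a.2)))) a :=
    π.contDiff.contDiffAt.comp a (contMDiffAt_iff_contDiffAt.1 hend')
  exact (contMDiffAt_iff_contDiffAt.1 hs).prodMk ((contMDiffAt_iff_contDiffAt.1 hK).prodMk h3)

/-- The differential of an inverse chart, as a map between vector spaces. -/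
noncomputable def symmDeriv (φ₀ : OpenPartialHomeomorph M E) (ξ : E) : E →L[ℝ] E :=
  mfderiv 𝓘(ℝ, E) 𝓘(ℝ, E) φ₀.symm ξ

/-- The differential of a chart, as a map between vector spaces. -/
noncomputable def homeoDeriv (φ₁ : OpenPartialHomeomorph M E) (y : M) : E →L[ℝ] E :=
  mfderiv 𝓘(ℝ, E) 𝓘(ℝ, E) φ₁ y

/-- Only directions fixing the parameter are needed: the first component of the equations is the
parameter itself, so every kernel vector has this form. -/
theorem fderiv_chordEq (h : CutoffFlow lam K I χ φ)
    (hφ₀ : φ₀ ∈ IsManifold.maximalAtlas 𝓘(ℝ, E) ∞ M)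
    (hφ₁ : φ₁ ∈ IsManifold.maximalAtlas 𝓘(ℝ, E) ∞ M) {ξ : W₀} {s τ : ℝ}
    (ha₀ : (ξ : E) ∈ φ₀.target) (ha₁ : φ (1, φ₀.symm ξ, s, τ) ∈ φ₁.source) (w : W₀) (r : ℝ) :
    fderiv ℝ (chordEq K φ φ₀ φ₁ π) (ξ, s, τ) (w, 0, r) =
      (0, diffE (K s) (φ₀.symm ξ) (symmDeriv φ₀ ξ w),
        π (homeoDeriv φ₁ (φ (1, φ₀.symm ξ, s, τ))
          (endDeriv φ (φ₀.symm ξ) s τ (symmDeriv φ₀ ξ w, r)))) := by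
  have hG := ((contDiffAt_chordEq (π := π) h hφ₀ hφ₁ (a := (ξ, s, τ)) ha₀ ha₁).differentiableAt
    (by simp)).hasFDerivAt
  set ι : W₀ × ℝ →L[ℝ] W₀ × ℝ × ℝ := (ContinuousLinearMap.fst ℝ W₀ ℝ).prod
    ((0 : W₀ × ℝ →L[ℝ] ℝ).prod (ContinuousLinearMap.snd ℝ W₀ ℝ)) with hι
  have hins : HasFDerivAt (fun b : W₀ × ℝ => (b.1, s, b.2)) ι (ξ, τ) :=
    hasFDerivAt_fst.prodMk ((hasFDerivAt_const s _).prodMk hasFDerivAt_snd)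
  have hcomp : HasFDerivAt (fun b : W₀ × ℝ => chordEq K φ φ₀ φ₁ π (b.1, s, b.2))
      ((fderiv ℝ (chordEq K φ φ₀ φ₁ π) (ξ, s, τ)).comp ι) (ξ, τ) :=
    HasFDerivAt.comp (g := chordEq K φ φ₀ φ₁ π) (f := fun b : W₀ × ℝ => (b.1, s, b.2)) (ξ, τ)
      hG hins
  have hsymm : HasMFDerivAt 𝓘(ℝ, W₀ × ℝ) 𝓘(ℝ, E) (fun b : W₀ × ℝ => φ₀.symm b.1) (ξ, τ)
      ((symmDeriv φ₀ ξ).comp (W₀.subtypeL.comp (ContinuousLinearMap.fst ℝ W₀ ℝ))) := by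
    have h1 := ((contMDiffAt_symm_of_mem_maximalAtlas hφ₀ ha₀).mdifferentiableAt
      (by simp)).hasMFDerivAt
    exact HasMFDerivAt.comp (ξ, τ) (g := φ₀.symm) (f := fun b : W₀ × ℝ => (b.1 : E)) h1
      (W₀.subtypeL.comp (ContinuousLinearMap.fst ℝ W₀ ℝ)).hasFDerivAt.hasMFDerivAt
  have hsnd : HasMFDerivAt 𝓘(ℝ, W₀ × ℝ) 𝓘(ℝ, ℝ) (fun b : W₀ × ℝ => b.2) (ξ, τ)
      (ContinuousLinearMap.snd ℝ W₀ ℝ) := hasFDerivAt_snd.hasMFDerivAt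
  have hK : HasFDerivAt (fun b : W₀ × ℝ => K s (φ₀.symm b.1))
      ((diffE (K s) (φ₀.symm ξ)).comp
        ((symmDeriv φ₀ ξ).comp (W₀.subtypeL.comp (ContinuousLinearMap.fst ℝ W₀ ℝ)))) (ξ, τ) :=
    hasMFDerivAt_iff_hasFDerivAt.1 (HasMFDerivAt.comp (ξ, τ) (g := K s)
      (f := fun b : W₀ × ℝ => φ₀.symm b.1)
      ((h.smooth_slice s).mdifferentiable (by simp) (φ₀.symm ξ)).hasMFDerivAt hsymm)
  have hpair := hsymm.prodMk hsnd
  have hend := HasMFDerivAt.comp (ξ, τ) (g := fun q : M × ℝ => φ (1, q.1, s, q.2))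
    (f := fun b : W₀ × ℝ => (φ₀.symm b.1, b.2))
    ((h.contMDiff_end s).mdifferentiable (by simp) (φ₀.symm ξ, τ)).hasMFDerivAt hpair
  have hend1 := HasMFDerivAt.comp (ξ, τ) (g := φ₁)
    (f := fun b : W₀ × ℝ => φ (1, φ₀.symm b.1, s, b.2))
    ((contMDiffAt_of_mem_maximalAtlas hφ₁ ha₁).mdifferentiableAt (by simp)).hasMFDerivAt hend
  have hend2 : HasFDerivAt (fun b : W₀ × ℝ => φ₁ (φ (1, φ₀.symm b.1, s, b.2)))
      ((homeoDeriv φ₁ (φ (1, φ₀.symm ξ, s, τ))).comp ((endDeriv φ (φ₀.symm ξ) s τ).comp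
        (((symmDeriv φ₀ ξ).comp (W₀.subtypeL.comp (ContinuousLinearMap.fst ℝ W₀ ℝ))).prod
          (ContinuousLinearMap.snd ℝ W₀ ℝ)))) (ξ, τ) := hasMFDerivAt_iff_hasFDerivAt.1 hend1
  have hend3 := π.hasFDerivAt.comp (ξ, τ) hend2
  have htot := (hasFDerivAt_const s ((ξ, τ) : W₀ × ℝ)).prodMk (hK.prodMk hend3)
  have huniq := hcomp.unique htot
  have hwr := DFunLike.congr_fun huniq (w, r)
  exact hwr

theorem fderiv_chordEq_fst (h : CutoffFlow lam K I χ φ)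
    (hφ₀ : φ₀ ∈ IsManifold.maximalAtlas 𝓘(ℝ, E) ∞ M)
    (hφ₁ : φ₁ ∈ IsManifold.maximalAtlas 𝓘(ℝ, E) ∞ M) {a : W₀ × ℝ × ℝ}
    (ha₀ : (a.1 : E) ∈ φ₀.target) (ha₁ : φ (1, φ₀.symm a.1, a.2) ∈ φ₁.source)
    (w : W₀ × ℝ × ℝ) : (fderiv ℝ (chordEq K φ φ₀ φ₁ π) a w).1 = w.2.1 := by
  have hG := ((contDiffAt_chordEq (π := π) h hφ₀ hφ₁ ha₀ ha₁).differentiableAt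
    (by simp)).hasFDerivAt
  have h1 : HasFDerivAt (fun a : W₀ × ℝ × ℝ => a.2.1)
      ((ContinuousLinearMap.fst ℝ ℝ (ℝ × C)).comp (fderiv ℝ (chordEq K φ φ₀ φ₁ π) a)) a :=
    (ContinuousLinearMap.fst ℝ ℝ (ℝ × C)).hasFDerivAt.comp a hG
  have h2 : HasFDerivAt (fun a : W₀ × ℝ × ℝ => a.2.1)
      ((ContinuousLinearMap.fst ℝ ℝ ℝ).comp (ContinuousLinearMap.snd ℝ W₀ (ℝ × ℝ))) a :=
    ((ContinuousLinearMap.fst ℝ ℝ ℝ).comp (ContinuousLinearMap.snd ℝ W₀ (ℝ × ℝ))).hasFDerivAt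
  exact DFunLike.congr_fun (h1.unique h2) w

/-- In adapted charts, non-degeneracy means that the differential of the chord equations is
injective. -/
theorem transverseAt_iff (h : CutoffFlow lam K I χ φ)
    (hφ₀ : φ₀ ∈ IsManifold.maximalAtlas 𝓘(ℝ, E) ∞ M)
    (hφ₁ : φ₁ ∈ IsManifold.maximalAtlas 𝓘(ℝ, E) ∞ M)
    (hW₀ : ∀ y ∈ φ₀.source, y ∈ L₀ ↔ φ₀ y ∈ W₀) {W₁ : Submodule ℝ E}
    (hW₁ : ∀ y ∈ φ₁.source, y ∈ L₁ ↔ φ₁ y ∈ W₁) (hπ : ∀ e, π e = 0 ↔ e ∈ W₁)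
    {a : W₀ × ℝ × ℝ} (ha₀ : (a.1 : E) ∈ φ₀.target)
    (ha₁ : φ (1, φ₀.symm a.1, a.2) ∈ φ₁.source) (hL₁ : φ (1, φ₀.symm a.1, a.2) ∈ L₁) :
    TransverseAt E K φ L₀ L₁ (φ₀.symm a.1, a.2) ↔
      Function.Injective (fderiv ℝ (chordEq K φ φ₀ φ₁ π) a) := by
  obtain ⟨ξ, s, τ⟩ := a
  simp only at ha₀ ha₁ hL₁ ⊢
  have hx : φ₀.symm ξ ∈ φ₀.source := φ₀.map_target ha₀
  have hr : φ₀ (φ₀.symm ξ) = ξ := φ₀.right_inv ha₀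
  have hxL : φ₀.symm ξ ∈ L₀ := by
    rw [hW₀ _ hx, hr]
    exact ξ.2
  have hmd₀ := mdifferentiable_of_mem_maximalAtlas hφ₀
  have hinv₁ : ∀ w : E, homeoDeriv φ₀ (φ₀.symm ξ) (symmDeriv φ₀ ξ w) = w := fun w =>
    DFunLike.congr_fun (hmd₀.comp_symm_deriv ha₀) w
  have hinv₂ : ∀ w : E, symmDeriv φ₀ ξ (homeoDeriv φ₀ (φ₀.symm ξ) w) = w := by
    intro w
    have h1 := DFunLike.congr_fun (hmd₀.symm_comp_deriv hx) w
    have h2 : symmDeriv φ₀ (φ₀ (φ₀.symm ξ)) (homeoDeriv φ₀ (φ₀.symm ξ) w) = w := h1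
    rwa [hr] at h2
  have ht₀ : ∀ u : E, u ∈ tangentE (E := E) L₀ (φ₀.symm ξ) ↔
      homeoDeriv φ₀ (φ₀.symm ξ) u ∈ W₀ := fun u => mem_tangent_iff hφ₀ hW₀ hx hxL u
  have ht₁ : ∀ u : E, u ∈ tangentE (E := E) L₁ (φ (1, φ₀.symm ξ, s, τ)) ↔
      π (homeoDeriv φ₁ (φ (1, φ₀.symm ξ, s, τ)) u) = 0 := fun u =>
    (mem_tangent_iff hφ₁ hW₁ ha₁ hL₁ u).trans (hπ _).symm
  have hfd := fderiv_chordEq (π := π) h hφ₀ hφ₁ ha₀ ha₁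
  constructor
  · intro htr
    rw [injective_iff_map_eq_zero]
    rintro ⟨w, σ, r⟩ hz
    have hσ : σ = 0 := by
      have h1 := fderiv_chordEq_fst (π := π) h hφ₀ hφ₁ (a := (ξ, s, τ)) ha₀ ha₁ (w, σ, r)
      rw [hz] at h1
      exact h1.symm
    subst hσ
    rw [hfd, Prod.mk_eq_zero, Prod.mk_eq_zero] at hz
    obtain ⟨h1, h2⟩ := htr (symmDeriv φ₀ ξ w) ((ht₀ _).2 (by rw [hinv₁]; exact w.2)) hz.2.1 r
      ((ht₁ _).2 hz.2.2)
    have h3 : (w : E) = 0 := by rw [← hinv₁ w, h1, map_zero]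
    have h4 : w = 0 := Subtype.ext h3
    rw [h2, h4]
    rfl
  · intro hinj u hu hk r hr'
    have hu' := (ht₀ u).1 hu
    have h1 : fderiv ℝ (chordEq K φ φ₀ φ₁ π) (ξ, s, τ)
        (⟨homeoDeriv φ₀ (φ₀.symm ξ) u, hu'⟩, 0, r) = 0 := by
      rw [hfd]
      simp only [hinv₂]
      rw [Prod.mk_eq_zero, Prod.mk_eq_zero]
      exact ⟨rfl, hk, (ht₁ _).1 hr'⟩
    have h2 := (injective_iff_map_eq_zero _).1 hinj _ h1
    rw [Prod.mk_eq_zero, Prod.mk_eq_zero] at h2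
    refine ⟨?_, h2.2.2⟩
    have h3 : homeoDeriv φ₀ (φ₀.symm ξ) u = 0 := congrArg Subtype.val h2.1
    rw [← hinv₂ u, h3, map_zero]

end CutoffFlow

/-! ### The smooth branch of chords through a non-degenerate chord -/

namespace CutoffFlow

variable {E : Type*} [NormedAddCommGroup E] [NormedSpace ℝ E] [FiniteDimensional ℝ E]
  {M : Type*} [TopologicalSpace M] [ChartedSpace E M] [IsManifold 𝓘(ℝ, E) ∞ M]
  {L₀ L₁ : Set M} {lam : OneForm E M} {K : ℝ → M → ℝ} {I : Set ℝ} {χ : M → ℝ}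
  {φ : ℝ × M × ℝ × ℝ → M}

theorem exists_projection (W : Submodule ℝ E) : ∃ ρ : E →L[ℝ] W, ∀ w : W, ρ w = w := by
  obtain ⟨C, hC⟩ := W.exists_isCompl
  exact ⟨LinearMap.toContinuousLinearMap (W.projectionOnto C hC),
    Submodule.projectionOnto_apply_left hC⟩

theorem exists_quotient_projection (W : Submodule ℝ E) :
    ∃ C : Submodule ℝ E, ∃ π : E →L[ℝ] C, (∀ e, π e = 0 ↔ e ∈ W) ∧
      Module.finrank ℝ C + Module.finrank ℝ W = Module.finrank ℝ E := by
  obtain ⟨C, hC⟩ := W.exists_isCompl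
  refine ⟨C, LinearMap.toContinuousLinearMap (C.projectionOnto W hC.symm), fun e =>
    Submodule.projectionOnto_apply_eq_zero_iff hC.symm,
    Submodule.finrank_add_eq_of_isCompl hC.symm⟩

theorem finrank_eq_of_adapted {φ₀ : OpenPartialHomeomorph M E}
    (hφ₀ : φ₀ ∈ IsManifold.maximalAtlas 𝓘(ℝ, E) ∞ M) {L : Set M} {W : Submodule ℝ E}
    (hW : ∀ y ∈ φ₀.source, y ∈ L ↔ φ₀ y ∈ W) {x : M} (hx : x ∈ φ₀.source) (hxL : x ∈ L) :
    Module.finrank ℝ (tangentE (E := E) L x) = Module.finrank ℝ W := by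
  have hmd := mdifferentiable_of_mem_maximalAtlas hφ₀
  have hinj : Function.Injective (homeoDeriv φ₀ x) := hmd.mfderiv_injective hx
  have hsurj : Function.Surjective (homeoDeriv φ₀ x) := hmd.mfderiv_surjective hx
  have hmap : (tangentE (E := E) L x).map (homeoDeriv φ₀ x).toLinearMap = W := by
    ext w
    constructor
    · rintro ⟨u, hu, rfl⟩
      exact (mem_tangent_iff hφ₀ hW hx hxL u).1 hu
    · intro hw
      obtain ⟨u, rfl⟩ := hsurj w
      exact ⟨u, (mem_tangent_iff hφ₀ hW hx hxL u).2 hw, rfl⟩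
  rw [← hmap]
  exact (Submodule.equivMapOfInjective (homeoDeriv φ₀ x).toLinearMap hinj _).finrank_eq

/-- Near a non-degenerate chord, the chords form a smooth family parametrised by `s`. -/
theorem exists_branch [T2Space M] (h : CutoffFlow lam K I χ φ)
    (hL₀ : IsExactLagrangian lam L₀) (hL₁ : IsExactLagrangian lam L₁) {z₀ : M × ℝ × ℝ}
    (hK : K z₀.2.1 z₀.1 = 0) (hx₀ : z₀.1 ∈ L₀) (hx₁ : φ (1, z₀) ∈ L₁) (hτ : 0 < z₀.2.2)
    (htr : TransverseAt E K φ L₀ L₁ z₀) :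
    ∃ (N : Set (M × ℝ × ℝ)) (β : ℝ → M × ℝ × ℝ) (J : Set ℝ), IsOpen N ∧ z₀ ∈ N ∧ IsOpen J ∧
      ContMDiffOn 𝓘(ℝ, ℝ) (𝓘(ℝ, E).prod 𝓘(ℝ, ℝ × ℝ)) ∞ β J ∧
      (∀ s ∈ J, (β s).2.1 = s ∧ (β s).1 ∈ L₀ ∧ φ (1, β s) ∈ L₁ ∧ K s (β s).1 = 0 ∧
        0 < (β s).2.2 ∧ TransverseAt E K φ L₀ L₁ (β s)) ∧
      ∀ z ∈ N, z.1 ∈ L₀ → φ (1, z) ∈ L₁ → K z.2.1 z.1 = 0 → z.2.1 ∈ J ∧ z = β z.2.1 := by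
  obtain ⟨x₀, s₀, τ₀⟩ := z₀
  simp only at hK hx₀ hx₁ hτ
  obtain ⟨φ₀, hφ₀, hxs, W₀, hW₀⟩ := hL₀.2.1 x₀ hx₀
  obtain ⟨φ₁, hφ₁, hys, W₁, hW₁⟩ := hL₁.2.1 _ hx₁
  obtain ⟨ρ, hρ⟩ := exists_projection W₀
  obtain ⟨C, π, hπ, hC⟩ := exists_quotient_projection W₁
  -- Both Lagrangians have half dimension, so with `dim E = 2m` both sides are `m + 2`, and
  -- injectivity of the differential suffices for the inverse function theorem.
  have hdim : Module.finrank ℝ (W₀ × ℝ × ℝ) = Module.finrank ℝ (ℝ × ℝ × C) := by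
    have h1 : 2 * Module.finrank ℝ (tangentE (E := E) L₀ x₀) = _ :=
      two_mul_finrank_tangent h.exact_symplectic hL₀ hx₀
    have h2 : 2 * Module.finrank ℝ (tangentE (E := E) L₁ (φ (1, x₀, s₀, τ₀))) = _ :=
      two_mul_finrank_tangent h.exact_symplectic hL₁ hx₁
    have h3 := finrank_eq_of_adapted hφ₀ hW₀ hxs hx₀
    have h4 := finrank_eq_of_adapted hφ₁ hW₁ hys hx₁
    simp only [Module.finrank_prod, Module.finrank_self]
    omega
  set G : W₀ × ℝ × ℝ → ℝ × ℝ × C := chordEq K φ φ₀ φ₁ π with hG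
  set O : Set (W₀ × ℝ × ℝ) := {a | (a.1 : E) ∈ φ₀.target} with hO
  have hOopen : IsOpen O := φ₀.open_target.preimage (continuous_subtype_val.comp continuous_fst)
  have hcontE : ContinuousOn (fun a : W₀ × ℝ × ℝ => φ (1, φ₀.symm a.1, a.2)) O := by
    refine h.flow.smooth.continuous.comp_continuousOn ?_
    refine continuousOn_const.prodMk (ContinuousOn.prodMk ?_ continuousOn_snd)
    exact φ₀.continuousOn_symm.comp (continuous_subtype_val.comp continuous_fst).continuousOn
      (fun a ha => ha)
  set U : Set (W₀ × ℝ × ℝ) := (O ∩ (fun a => φ (1, φ₀.symm a.1, a.2)) ⁻¹' φ₁.source) ∩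
    {a | 0 < a.2.2} with hU
  have hUopen : IsOpen U := (hcontE.isOpen_inter_preimage hOopen φ₁.open_source).inter
    (isOpen_lt continuous_const (continuous_snd.comp continuous_snd))
  have hGs : ContDiffOn ℝ ∞ G U := fun a ha =>
    (contDiffAt_chordEq h hφ₀ hφ₁ ha.1.1 ha.1.2).contDiffWithinAt
  set a₀ : W₀ × ℝ × ℝ := (⟨φ₀ x₀, (hW₀ _ hxs).1 hx₀⟩, s₀, τ₀) with ha₀
  have hinv : φ₀.symm (φ₀ x₀) = x₀ := φ₀.left_inv hxs
  have ha₀U : a₀ ∈ U := by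
    refine ⟨⟨φ₀.map_source hxs, ?_⟩, hτ⟩
    change φ (1, φ₀.symm (φ₀ x₀), s₀, τ₀) ∈ φ₁.source
    rwa [hinv]
  have hsubst : (φ₀.symm a₀.1, a₀.2) = (x₀, s₀, τ₀) := Prod.ext hinv rfl
  have hinj : Function.Injective (fderiv ℝ G a₀) := by
    refine (transverseAt_iff h hφ₀ hφ₁ hW₀ hW₁ hπ ha₀U.1.1 ha₀U.1.2 ?_).1 ?_
    · rwa [hsubst]
    · rwa [hsubst]
  obtain ⟨e, hae, heU, heG, hes, heinj⟩ := exists_smooth_localInverse hUopen hGs ha₀U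
    ((LinearEquiv.ofInjectiveOfFinrankEq (fderiv ℝ G a₀ : W₀ × ℝ × ℝ →ₗ[ℝ] ℝ × ℝ × C) hinj
      hdim).toContinuousLinearEquiv) 
    (ContinuousLinearMap.ext fun _ => rfl)
  -- Chords with parameter `s` are the solutions of `chordEq = (s, 0, 0)`; the branch is the
  -- preimage of this line.
  set α : ℝ → W₀ × ℝ × ℝ := fun s => e.symm (s, 0, 0) with hα
  set J : Set ℝ := (fun s : ℝ => ((s, 0, 0) : ℝ × ℝ × C)) ⁻¹' e.target with hJ
  have hJopen : IsOpen J := e.open_target.preimage (by fun_prop)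
  have hαJ : ∀ s ∈ J, α s ∈ e.source ∧ G (α s) = (s, 0, 0) := fun s hs =>
    ⟨e.map_target hs, (heG _).symm.trans (e.right_inv hs)⟩
  -- The projection `ρ` onto `W₀` extends the coordinates on `L₀` to a neighbourhood in `M`, so that
  -- `N` is open in the space of all triples.
  set N : Set (M × ℝ × ℝ) := (φ₀.source ×ˢ univ) ∩
    (fun z : M × ℝ × ℝ => ((ρ (φ₀ z.1), z.2) : W₀ × ℝ × ℝ)) ⁻¹' e.source with hN
  have hNopen : IsOpen N := by
    refine ContinuousOn.isOpen_inter_preimage ?_ (φ₀.open_source.prod isOpen_univ) e.open_source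
    refine ContinuousOn.prodMk ?_ continuousOn_snd
    exact ρ.continuous.comp_continuousOn (φ₀.continuousOn.comp continuousOn_fst fun z hz => hz.1)
  have hcoord : ∀ z : M × ℝ × ℝ, z.1 ∈ φ₀.source → z.1 ∈ L₀ →
      (φ₀.symm (ρ (φ₀ z.1)), z.2) = z ∧ ((ρ (φ₀ z.1) : W₀) : E) = φ₀ z.1 := by
    intro z hz hzL
    have h1 : ((ρ (φ₀ z.1) : W₀) : E) = φ₀ z.1 :=
      congrArg Subtype.val (hρ ⟨φ₀ z.1, (hW₀ _ hz).1 hzL⟩)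
    refine ⟨Prod.ext ?_ rfl, h1⟩
    simp only [h1, φ₀.left_inv hz]
  refine ⟨N, fun s => (φ₀.symm (α s).1, (α s).2), J, hNopen, ⟨⟨hxs, trivial⟩, ?_⟩, hJopen,
    ?_, ?_, ?_⟩
  · have h1 : ((ρ (φ₀ x₀), (s₀, τ₀)) : W₀ × ℝ × ℝ) = a₀ :=
      Prod.ext (hρ ⟨φ₀ x₀, (hW₀ _ hxs).1 hx₀⟩) rfl
    change ((ρ (φ₀ x₀), (s₀, τ₀)) : W₀ × ℝ × ℝ) ∈ e.source
    rwa [h1]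
  · intro s hs
    apply ContMDiffAt.contMDiffWithinAt
    have h1 : ContDiffAt ℝ ∞ α s := by
      have h2 : ContDiffAt ℝ ∞ e.symm ((s, 0, 0) : ℝ × ℝ × C) :=
        hes.contDiffAt (e.open_target.mem_nhds hs)
      exact ContDiffAt.comp s (g := e.symm) (f := fun s : ℝ => ((s, 0, 0) : ℝ × ℝ × C)) h2
        (contDiffAt_id.prodMk contDiffAt_const)
    have h3 : ContMDiffAt 𝓘(ℝ, ℝ) 𝓘(ℝ, E) ∞ (fun s => φ₀.symm (α s).1) s :=
      ContMDiffAt.comp s (g := fun ξ : W₀ => φ₀.symm ξ) (f := fun s => (α s).1)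
        (contMDiffAt_symm_coe hφ₀ (heU (hαJ s hs).1).1.1) (contDiffAt_fst.comp s h1).contMDiffAt
    exact h3.prodMk (contDiffAt_snd.comp s h1).contMDiffAt
  · intro s hs
    obtain ⟨h1, h2⟩ := hαJ s hs
    have hu := heU h1
    have hs1 : (α s).2.1 = s := congrArg Prod.fst h2
    have hk : K (α s).2.1 (φ₀.symm (α s).1) = 0 := congrArg (fun b => b.2.1) h2
    have hp : π (φ₁ (φ (1, φ₀.symm (α s).1, (α s).2))) = 0 := congrArg (fun b => b.2.2) h2
    have hsrc := φ₀.map_target hu.1.1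
    have hl₁ : φ (1, φ₀.symm (α s).1, (α s).2) ∈ L₁ := (hW₁ _ hu.1.2).2 ((hπ _).1 hp)
    refine ⟨hs1, ?_, hl₁, ?_, hu.2, ?_⟩
    · rw [hW₀ _ hsrc, φ₀.right_inv hu.1.1]
      exact (α s).1.2
    · rwa [hs1] at hk
    · exact (transverseAt_iff h hφ₀ hφ₁ hW₀ hW₁ hπ hu.1.1 hu.1.2 hl₁).2 (heinj _ h1)
  · rintro z ⟨⟨hz, -⟩, hze⟩ hz₀ hz₁ hzK
    obtain ⟨h1, h2⟩ := hcoord z hz hz₀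
    set a : W₀ × ℝ × ℝ := (ρ (φ₀ z.1), z.2) with ha
    have haz : (φ₀.symm a.1, a.2) = z := h1
    have hGa : G a = (z.2.1, 0, 0) := by
      have hx : φ₀.symm (a.1 : E) = z.1 := congrArg Prod.fst haz
      have hzz : ((φ₀.symm (a.1 : E), a.2) : M × ℝ × ℝ) = z := haz
      have h3 : π (φ₁ (φ (1, φ₀.symm a.1, a.2))) = 0 := by
        rw [hzz]
        exact (hπ _).2 ((hW₁ _ (hzz ▸ (heU hze).1.2)).1 hz₁)
      have h4 : K a.2.1 (φ₀.symm a.1) = 0 := by rw [hx]; exact hzK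
      simp only [hG, chordEq, h3, h4]
      rfl
    have hJz : z.2.1 ∈ J := by
      change ((z.2.1, 0, 0) : ℝ × ℝ × C) ∈ e.target
      rw [← hGa, ← heG]
      exact e.map_source hze
    refine ⟨hJz, ?_⟩
    have h5 : α z.2.1 = a := by
      change e.symm (z.2.1, 0, 0) = a
      rw [← hGa, ← heG]
      exact e.left_inv hze
    simp only [h5]
    exact haz.symm

end CutoffFlow

/-! ### The chord determined by its initial point, parameter and period -/

namespace CutoffFlow

variable {E : Type*} [NormedAddCommGroup E] [NormedSpace ℝ E] [FiniteDimensional ℝ E]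
  {M : Type*} [TopologicalSpace M] [ChartedSpace E M] [IsManifold 𝓘(ℝ, E) ∞ M]
  {L₀ L₁ : Set M} {lam : OneForm E M} {K : ℝ → M → ℝ} {I : Set ℝ} {χ : M → ℝ}
  {φ : ℝ × M × ℝ × ℝ → M}

/-- The triples `(x, s, τ)` whose trajectory runs from `L₀` to `L₁`. -/
def state (φ : ℝ × M × ℝ × ℝ → M) (L₀ L₁ : Set M) : Set (M × ℝ × ℝ) :=
  {z | z.1 ∈ L₀ ∧ φ (1, z) ∈ L₁ ∧ 0 < z.2.2}

theorem flow_zero_mem (h : CutoffFlow lam K I χ φ) {z : M × ℝ × ℝ} (hz : z ∈ state φ L₀ L₁) :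
    φ (0, z) ∈ L₀ := by
  have h1 : φ (0, z) = z.1 := h.flow.zero z.1 z.2
  rw [h1]
  exact hz.1

/-- The path and the period determined by `z = (x, s, τ)`. -/
noncomputable def toChord (h : CutoffFlow lam K I χ φ) (z : state φ L₀ L₁) :
    PathSpace E L₀ L₁ × Ioi (0 : ℝ) :=
  (flowPath h.flow.smooth z.1 (h.flow_zero_mem z.2) z.2.2.1, ⟨z.1.2.2, z.2.2.2⟩)

theorem continuous_toChord (h : CutoffFlow lam K I χ φ) :
    Continuous (h.toChord (L₀ := L₀) (L₁ := L₁)) :=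
  (continuous_flowPath h.flow.smooth continuous_subtype_val _ _).prodMk
    (Continuous.subtype_mk (by fun_prop) _)

theorem toChord_extend (h : CutoffFlow lam K I χ φ) (z : state φ L₀ L₁) {t : ℝ}
    (ht : t ∈ Icc (0 : ℝ) 1) : (h.toChord z).1.extend t = φ (t, z) :=
  flowPath_extend h.flow.smooth _ _ _ ht

theorem toChord_zero (h : CutoffFlow lam K I χ φ) (z : state φ L₀ L₁) :
    (h.toChord z).1.toFun 0 = z.1.1 := h.flow.zero z.1.1 z.1.2

theorem isChord_toChord (h : CutoffFlow lam K I χ φ) (z : state φ L₀ L₁) (hs : z.1.2.1 ∈ I)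
    (hz : K z.1.2.1 z.1.1 = 0) : IsChord lam (K z.1.2.1) (h.toChord z) := by
  refine ⟨fun t ht => ?_, fun t ht => ?_⟩
  · rw [h.toChord_extend z ht]
    exact (h.ham_flow t _ _ _).trans hz
  · have h1 := (h.isMIntegralCurve hs hz z.1.2.2).isMIntegralCurveOn (Icc 0 1) t ht
    have h2 : EqOn (h.toChord z).1.extend (fun t => φ (t, z)) (Icc 0 1) :=
      fun t ht => h.toChord_extend z ht
    have h3 := HasMFDerivWithinAt.congr_of_eventuallyEq h1
      (eventually_nhdsWithin_of_forall h2) (h2 ht)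
    have h4 : (h.toChord z).1.extend t = φ (t, z.1.1, z.1.2.1, z.1.2.2) := h2 ht
    have h5 : ∀ y, y = φ (t, z.1.1, z.1.2.1, z.1.2.2) → HasMFDerivWithinAt 𝓘(ℝ, ℝ) 𝓘(ℝ, E)
        (h.toChord z).1.extend (Icc 0 1) t ((1 : ℝ →L[ℝ] ℝ).smulRight
          (z.1.2.2 • hamVF lam (K z.1.2.1) y : E)) := by
      rintro _ rfl
      exact h3
    exact h5 _ h4

/-- Every chord comes from a triple. -/
theorem exists_toChord_eq [T2Space M] (h : CutoffFlow lam K I χ φ)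
    (p : PathSpace E L₀ L₁ × Ioi (0 : ℝ)) {s : ℝ} (hs : s ∈ I) (hp : IsChord lam (K s) p) :
    ∃ hz : (p.1.toFun 0, s, (p.2 : ℝ)) ∈ state φ L₀ L₁, K s (p.1.toFun 0) = 0 ∧
      h.toChord ⟨_, hz⟩ = p := by
  have h0 : p.1.extend 0 = p.1.toFun 0 := p.1.extend_apply (left_mem_Icc.2 zero_le_one)
  have h1 : p.1.extend 1 = p.1.toFun 1 := p.1.extend_apply (right_mem_Icc.2 zero_le_one)
  have hK := hp.1 0 (left_mem_Icc.2 zero_le_one)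
  have heq := h.eqOn_of_isMIntegralCurveOn hs hK hp.2
  rw [h0] at hK heq
  have hz : (p.1.toFun 0, s, (p.2 : ℝ)) ∈ state φ L₀ L₁ := by
    refine ⟨p.1.source, ?_, p.2.2⟩
    have h2 := heq (right_mem_Icc.2 zero_le_one)
    have h4 : p.1.toFun 1 = φ (1, p.1.toFun 0, s, p.2) := h1.symm.trans h2
    rw [← h4]
    exact p.1.target
  refine ⟨hz, hK, Prod.ext (PathSpace.ext (funext fun t => ?_)) rfl⟩
  have h3 := heq t.2
  rw [p.1.extend_apply t.2] at h3
  exact h3.symm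

theorem nondegenerate_toChord_iff [T2Space M] (h : CutoffFlow lam K I χ φ)
    (hL₀ : IsExactLagrangian lam L₀) (hL₁ : IsExactLagrangian lam L₁) (z : state φ L₀ L₁)
    (hs : z.1.2.1 ∈ I) (hz : K z.1.2.1 z.1.1 = 0) :
    Nondegenerate lam (K z.1.2.1) (h.toChord z) ↔ TransverseAt E K φ L₀ L₁ z :=
  h.nondegenerate_iff hL₀ hL₁ hs (h.toChord_zero z) rfl hz z.2.2.1

/-- The function `λ(X_{K s}) = dK_s(Y)`. -/
noncomputable def speed (lam : OneForm E M) (K : ℝ → M → ℝ) (x : M) (s : ℝ) : ℝ :=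
  lam x (hamVF lam (K s) x)

theorem contMDiff_speed (h : CutoffFlow lam K I χ φ) :
    ContMDiff (𝓘(ℝ, E).prod 𝓘(ℝ, ℝ)) 𝓘(ℝ, ℝ) ∞ (fun q : M × ℝ => speed lam K q.1 q.2) :=
  h.exact_symplectic.1.contMDiff_apply (h.exact_symplectic.smoothFamily_hamVF h.smooth_ham)

theorem speed_pos (h : CutoffFlow lam K I χ φ) {s : ℝ} (hs : s ∈ I) {x : M} (hx : K s x = 0) :
    0 < speed lam K x s := by
  rw [speed, h.exact_symplectic.lam_hamVF]
  exact h.contact s hs x hx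

/-- The action of the chord determined by `z`. -/
noncomputable def chordAction (lam : OneForm E M) (K : ℝ → M → ℝ) (φ : ℝ × M × ℝ × ℝ → M)
    (z : M × ℝ × ℝ) : ℝ :=
  z.2.2 * ∫ t in (0 : ℝ)..1, speed lam K (φ (t, z)) z.2.1

theorem continuous_chordAction (h : CutoffFlow lam K I χ φ) :
    Continuous (chordAction lam K φ) := by
  refine Continuous.mul (by fun_prop) ?_
  refine intervalIntegral.continuous_parametric_intervalIntegral_of_continuous' ?_ 0 1
  have h1 := h.contMDiff_speed.continuous
  have h2 := h.flow.smooth.continuous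
  exact h1.comp ((h2.comp (by fun_prop)).prodMk (by fun_prop))

/-- The Hamiltonian term vanishes because a chord lies on the zero level, and its velocity `τ X`
gives `λ(∂ₜ v) = τ λ(X)`. -/
theorem action_toChord (h : CutoffFlow lam K I χ φ) (z : state φ L₀ L₁) (hs : z.1.2.1 ∈ I)
    (hz : K z.1.2.1 z.1.1 = 0) :
    action lam (K z.1.2.1) (h.toChord z) = chordAction lam K φ z := by
  have hch := h.isChord_toChord z hs hz
  have h01 : uIcc (0 : ℝ) 1 = Icc 0 1 := uIcc_of_le zero_le_one
  have h1 : (∫ t in (0 : ℝ)..1, K z.1.2.1 ((h.toChord z).1.extend t)) = 0 := by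
    rw [intervalIntegral.integral_congr (g := fun _ => (0 : ℝ))]
    · simp
    · rw [h01]
      exact fun t ht => hch.1 t ht
  have h2 : (∫ t in (0 : ℝ)..1, lam ((h.toChord z).1.extend t)
      (mfderivWithin 𝓘(ℝ, ℝ) 𝓘(ℝ, E) (h.toChord z).1.extend (Icc 0 1) t (1 : ℝ))) =
      ∫ t in (0 : ℝ)..1, z.1.2.2 * speed lam K (φ (t, z)) z.1.2.1 := by
    apply intervalIntegral.integral_congr
    rw [h01]
    intro t ht
    have h3 := (hch.2 t ht).mfderivWithin
      ((uniqueDiffOn_Icc zero_lt_one t ht).uniqueMDiffWithinAt)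
    simp only
    rw [h3, ← h.toChord_extend z ht]
    set y := (h.toChord z).1.extend t
    set X : E := hamVF lam (K z.1.2.1) y
    have h4 : ∀ l : E →L[ℝ] ℝ, l (((1 : ℝ →L[ℝ] ℝ).smulRight (z.1.2.2 • X)) 1) =
        z.1.2.2 * l X := by
      intro l
      simp
    exact h4 (lam y)
  rw [action, h1, h2, chordAction, intervalIntegral.integral_const_mul]
  simp

end CutoffFlow

/-! ### The first variation of the action -/

/-- Differentiate under the integral and use `∂ₛ(α(∂ₜ)) = dα(∂ₛ, ∂ₜ) + ∂ₜ(α(∂ₛ))`. The last term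
integrates to the boundary contribution. -/
theorem hasDerivAt_integral_oneForm {α : ℝ × ℝ → ℝ × ℝ →L[ℝ] ℝ} {J : Set ℝ} (hJ : IsOpen J)
    (hα : ∀ t, ∀ s ∈ J, ContDiffAt ℝ ∞ α (t, s)) {s : ℝ} (hs : s ∈ J) :
    HasDerivAt (fun s => ∫ t in (0 : ℝ)..1, α (t, s) (1, 0))
      ((∫ t in (0 : ℝ)..1, extd α (t, s) (0, 1) (1, 0)) + (α (1, s) (0, 1) - α (0, s) (0, 1)))
      s := by
  have hd : ∀ t, ∀ s ∈ J, HasFDerivAt α (fderiv ℝ α (t, s)) (t, s) := fun t s hs =>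
    ((hα t s hs).differentiableAt (by simp)).hasFDerivAt
  have hc1 : ∀ t, ∀ s ∈ J, ContinuousAt (fderiv ℝ α) (t, s) := fun t s hs =>
    ((hα t s hs).fderiv_right (m := ∞) (by simp)).continuousAt
  have hline : ∀ s : ℝ, Continuous fun t : ℝ => ((t, s) : ℝ × ℝ) := fun s => by fun_prop
  have hcα : ∀ s ∈ J, Continuous fun t => α (t, s) := fun s hs =>
    continuous_iff_continuousAt.2 fun t =>
      ContinuousAt.comp (g := α) (hα t s hs).continuousAt (hline s).continuousAt
  have hcd : ∀ s ∈ J, Continuous fun t => fderiv ℝ α (t, s) := fun s hs =>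
    continuous_iff_continuousAt.2 fun t =>
      ContinuousAt.comp (g := fderiv ℝ α) (hc1 t s hs) (hline s).continuousAt
  obtain ⟨r, hr, hball⟩ := Metric.nhds_basis_closedBall.mem_iff.1 (hJ.mem_nhds hs)
  have hcomp : IsCompact (Icc (0 : ℝ) 1 ×ˢ Metric.closedBall s r) :=
    isCompact_Icc.prod (isCompact_closedBall s r)
  obtain ⟨B, hB⟩ := hcomp.exists_bound_of_continuousOn
    (f := fun q : ℝ × ℝ => fderiv ℝ α q (0, 1) (1, 0)) (fun q hq => by
      have := hc1 q.1 q.2 (hball hq.2)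
      exact ((this.clm_apply continuousAt_const).clm_apply continuousAt_const).continuousWithinAt)
  have hkey := intervalIntegral.hasDerivAt_integral_of_dominated_loc_of_deriv_le
    (μ := MeasureTheory.volume) (a := 0) (b := 1) (F := fun s t => α (t, s) (1, 0))
    (F' := fun s t => fderiv ℝ α (t, s) (0, 1) (1, 0)) (x₀ := s) (s := Metric.closedBall s r)
    (bound := fun _ => B) (Metric.closedBall_mem_nhds s hr) ?_ ?_ ?_ ?_ ?_ ?_
  · refine hkey.2.congr_deriv (Eq.symm ?_)
    have hFTC : ∫ t in (0 : ℝ)..1, fderiv ℝ α (t, s) (1, 0) (0, 1) =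
        α (1, s) (0, 1) - α (0, s) (0, 1) := by
      refine intervalIntegral.integral_eq_sub_of_hasDerivAt
        (f := fun t => α (t, s) (0, 1)) (fun t _ => ?_)
        ((((hcd s hs).clm_apply continuous_const).clm_apply
          continuous_const).intervalIntegrable 0 1)
      have h1 : HasDerivAt (fun t : ℝ => ((t, s) : ℝ × ℝ)) (1, 0) t :=
        (hasDerivAt_id t).prodMk (hasDerivAt_const t s)
      have h2 := (hd t s hs).comp_hasDerivAt t h1
      simpa using h2.clm_apply (hasDerivAt_const t ((0, 1) : ℝ × ℝ))
    rw [← hFTC, ← intervalIntegral.integral_add]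
    · simp [extd]
    · exact ((((hcd s hs).clm_apply continuous_const).clm_apply continuous_const).sub
        (((hcd s hs).clm_apply continuous_const).clm_apply continuous_const)).intervalIntegrable _ _
    · exact (((hcd s hs).clm_apply continuous_const).clm_apply
        continuous_const).intervalIntegrable _ _
  · filter_upwards [Metric.closedBall_mem_nhds s hr] with s' hs'
    exact ((hcα s' (hball hs')).clm_apply continuous_const).aestronglyMeasurable
  · exact ((hcα s hs).clm_apply continuous_const).intervalIntegrable _ _
  · exact (((hcd s hs).clm_apply continuous_const).clm_apply continuous_const).aestronglyMeasurable
  · refine Eventually.of_forall fun t ht s' hs' => ?_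
    rw [uIoc_of_le zero_le_one] at ht
    exact hB (t, s') ⟨Ioc_subset_Icc_self ht, hs'⟩
  · exact intervalIntegrable_const
  · refine Eventually.of_forall fun t _ s' hs' => ?_
    have h1 : HasDerivAt (fun s : ℝ => ((t, s) : ℝ × ℝ)) (0, 1) s' :=
      (hasDerivAt_const s' t).prodMk (hasDerivAt_id s')
    have h2 := (hd t s' (hball hs')).comp_hasDerivAt s' h1
    simpa using h2.clm_apply (hasDerivAt_const s' ((1, 0) : ℝ × ℝ))

namespace CutoffFlow

variable {E : Type*} [NormedAddCommGroup E] [NormedSpace ℝ E] [FiniteDimensional ℝ E]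
  {M : Type*} [TopologicalSpace M] [ChartedSpace E M] [IsManifold 𝓘(ℝ, E) ∞ M]
  {L₀ L₁ : Set M} {lam : OneForm E M} {K : ℝ → M → ℝ} {I : Set ℝ} {χ : M → ℝ}
  {φ : ℝ × M × ℝ × ℝ → M}

theorem _root_.ContMDiffAt.contDiffAt_pull {V : Type*} [NormedAddCommGroup V] [NormedSpace ℝ V]
    (hlam : SmoothOneForm lam) {u : V → M} {v : V} (hu : ContMDiffAt 𝓘(ℝ, V) 𝓘(ℝ, E) ∞ u v) :
    ContDiffAt ℝ ∞ (pull lam u) v := by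
  have hx := mem_chart_source E (u v)
  refine ContDiffAt.congr_of_eventuallyEq ?_ (pull_eventuallyEq lam (u v) hu hx)
  have h1 : ContDiffAt ℝ ∞ (fun z => chartAt E (u v) (u z)) v :=
    contMDiffAt_iff_contDiffAt.1 (ContMDiffAt.comp v (contMDiffAt_chartAt (u v) hx) hu)
  have h2 : ContDiffAt ℝ ∞ (localForm lam (u v)) (chartAt E (u v) (u v)) :=
    hlam.contDiffAt_localForm (u v) ((chartAt E (u v)).map_source hx)
  exact (ContDiffAt.comp v (f := fun z => chartAt E (u v) (u z)) h2 h1).clm_comp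
    (h1.fderiv_right (by simp))

/-- Along a curve contained in the zero sets of a family of functions, the derivative of the
functions in the direction of the curve cancels their derivative in the parameter. -/
theorem diffE_eq_neg_deriv (h : CutoffFlow lam K I χ φ) {u : ℝ → M} {s : ℝ}
    (hu : ContMDiffAt 𝓘(ℝ, ℝ) 𝓘(ℝ, E) ∞ u s) (hK : ∀ᶠ s' in 𝓝 s, K s' (u s') = 0)
    {u' : ℝ →L[ℝ] E} (hu' : HasMFDerivAt 𝓘(ℝ, ℝ) 𝓘(ℝ, E) u s u') :
    diffE (K s) (u s) (u' 1) = -deriv (fun s' => K s' (u s)) s := by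
  set g : ℝ × ℝ → ℝ := fun r => K r.2 (u r.1) with hg
  have hgs : ContDiffAt ℝ ∞ g (s, s) := by
    apply contMDiffAt_iff_contDiffAt.1
    have h1 : ContMDiffAt 𝓘(ℝ, ℝ × ℝ) 𝓘(ℝ, E) ∞ (fun r : ℝ × ℝ => u r.1) (s, s) :=
      ContMDiffAt.comp (s, s) (g := u) (f := fun r : ℝ × ℝ => r.1) hu
        contDiff_fst.contMDiff.contMDiffAt
    have h2 : ContMDiffAt 𝓘(ℝ, ℝ × ℝ) 𝓘(ℝ, ℝ) ∞ (fun r : ℝ × ℝ => r.2) (s, s) :=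
      contDiff_snd.contMDiff.contMDiffAt
    exact ContMDiffAt.comp (s, s) (g := fun q : M × ℝ => K q.2 q.1)
      (f := fun r : ℝ × ℝ => (u r.1, r.2)) (h.smooth_ham _) (h1.prodMk h2)
  have hgd := (hgs.differentiableAt (by simp)).hasFDerivAt
  have e1 : HasDerivAt (fun s' => g (s', s)) (fderiv ℝ g (s, s) (1, 0)) s :=
    hgd.comp_hasDerivAt s (f := fun s' => (s', s)) ((hasDerivAt_id s).prodMk (hasDerivAt_const s s))
  have e2 : HasDerivAt (fun s' => g (s, s')) (fderiv ℝ g (s, s) (0, 1)) s :=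
    hgd.comp_hasDerivAt s ((hasDerivAt_const s s).prodMk (hasDerivAt_id s))
  have e3 : HasDerivAt (fun s' => g (s', s')) (fderiv ℝ g (s, s) (1, 1)) s :=
    hgd.comp_hasDerivAt s (f := fun s' => (s', s')) ((hasDerivAt_id s).prodMk (hasDerivAt_id s))
  have e4 : HasDerivAt (fun s' => g (s', s')) 0 s :=
    (hasDerivAt_const s (0 : ℝ)).congr_of_eventuallyEq hK
  have e5 : HasFDerivAt (fun s' => g (s', s)) ((diffE (K s) (u s)).comp u') s :=
    hasMFDerivAt_iff_hasFDerivAt.1 (HasMFDerivAt.comp s (g := K s) (f := u)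
      ((h.smooth_slice s).mdifferentiable (by simp) (u s)).hasMFDerivAt hu')
  have e6 : diffE (K s) (u s) (u' 1) = fderiv ℝ g (s, s) (1, 0) := by
    have := e5.hasDerivAt.unique e1
    exact this
  have e7 : deriv (fun s' => K s' (u s)) s = fderiv ℝ g (s, s) (0, 1) := e2.deriv
  have e8 := e3.unique e4
  have e9 : ((1, 1) : ℝ × ℝ) = (1, 0) + (0, 1) := by simp
  rw [e9, map_add] at e8
  rw [e6, e7]
  linarith

/-- The first variation of the action along a smooth family of chords. -/
theorem hasDerivAt_chordAction (h : CutoffFlow lam K I χ φ)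
    (hL₀ : IsExactLagrangian lam L₀) (hL₁ : IsExactLagrangian lam L₁) {q : ℝ → M × ℝ × ℝ}
    {J : Set ℝ} (hJ : IsOpen J) (hJI : J ⊆ I)
    (hq : ContMDiffOn 𝓘(ℝ, ℝ) (𝓘(ℝ, E).prod 𝓘(ℝ, ℝ × ℝ)) ∞ q J)
    (hqs : ∀ s ∈ J, (q s).2.1 = s) (hq₀ : ∀ s ∈ J, (q s).1 ∈ L₀)
    (hq₁ : ∀ s ∈ J, φ (1, q s) ∈ L₁) (hqK : ∀ s ∈ J, K s (q s).1 = 0) {s : ℝ} (hs : s ∈ J) :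
    HasDerivAt (fun s => chordAction lam K φ (q s))
      (-((q s).2.2 * ∫ t in (0 : ℝ)..1, deriv (fun s' => K s' (φ (t, q s))) s)) s := by
  -- The two-parameter map `(t, s) ↦ v_s(t)`: the action is the integral of the pull-back of `λ`
  -- along its horizontal lines.
  set v : ℝ × ℝ → M := fun r => φ (r.1, (q r.2).1, r.2, (q r.2).2.2) with hv
  have hvq : ∀ t, ∀ s ∈ J, v (t, s) = φ (t, q s) := by
    intro t s hs
    have h1 : q s = ((q s).1, s, (q s).2.2) := Prod.ext rfl (Prod.ext (hqs s hs) rfl)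
    conv_rhs => rw [h1]
  have hvs : ∀ t, ∀ s ∈ J, ContMDiffAt 𝓘(ℝ, ℝ × ℝ) 𝓘(ℝ, E) ∞ v (t, s) := by
    intro t s hs
    have h1 : ContMDiffAt 𝓘(ℝ, ℝ × ℝ) (𝓘(ℝ, E).prod 𝓘(ℝ, ℝ × ℝ)) ∞
        (fun r : ℝ × ℝ => q r.2) (t, s) :=
      ContMDiffAt.comp (t, s) (g := q) (f := fun r : ℝ × ℝ => r.2)
        (hq.contMDiffAt (hJ.mem_nhds hs)) contDiff_snd.contMDiff.contMDiffAt
    have h2 : ContMDiffAt 𝓘(ℝ, ℝ × ℝ) 𝓘(ℝ, E) ∞ (fun r : ℝ × ℝ => (q r.2).1) (t, s) :=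
      contMDiffAt_fst.comp (t, s) h1
    have h3 : ContMDiffAt 𝓘(ℝ, ℝ × ℝ) 𝓘(ℝ, ℝ × ℝ) ∞ (fun r : ℝ × ℝ => (q r.2).2) (t, s) :=
      contMDiffAt_snd.comp (t, s) h1
    have h4 : ContDiffAt ℝ ∞ (fun r : ℝ × ℝ => (r.2, (q r.2).2.2)) (t, s) :=
      contDiffAt_snd.prodMk (contDiffAt_snd.comp (t, s) (contMDiffAt_iff_contDiffAt.1 h3))
    have h5 : ContMDiffAt 𝓘(ℝ, ℝ × ℝ) 𝓘(ℝ, ℝ) ∞ (fun r : ℝ × ℝ => r.1) (t, s) :=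
      contDiff_fst.contMDiff.contMDiffAt
    exact ContMDiffAt.comp (t, s) (g := φ)
      (f := fun r : ℝ × ℝ => (r.1, (q r.2).1, r.2, (q r.2).2.2)) (h.flow.smooth _)
      (h5.prodMk (h2.prodMk h4.contMDiffAt))
  set dv : ℝ → ℝ → ℝ × ℝ →L[ℝ] E := fun t s => mfderiv 𝓘(ℝ, ℝ × ℝ) 𝓘(ℝ, E) v (t, s) with hdv
  have hvd : ∀ t, ∀ s ∈ J, HasMFDerivAt 𝓘(ℝ, ℝ × ℝ) 𝓘(ℝ, E) v (t, s) (dv t s) := fun t s hs =>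
    ((hvs t s hs).mdifferentiableAt (by simp)).hasMFDerivAt
  have hvK : ∀ t, ∀ s ∈ J, K s (v (t, s)) = 0 := fun t s hs =>
    (h.ham_flow t (q s).1 s (q s).2.2).trans (hqK s hs)
  -- the velocity in the direction of `t`
  have hdt : ∀ t, ∀ s ∈ J, dv t s (1, 0) = (q s).2.2 • (hamVF lam (K s) (v (t, s)) : E) := by
    intro t s hs
    have h1 := h.isMIntegralCurve (hJI hs) (hqK s hs) (q s).2.2 t
    have h2 : HasMFDerivAt 𝓘(ℝ, ℝ) 𝓘(ℝ, ℝ × ℝ) (fun t : ℝ => ((t, s) : ℝ × ℝ)) t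
        (ContinuousLinearMap.inl ℝ ℝ ℝ) := (hasFDerivAt_prodMk_left t s).hasMFDerivAt
    have h3 := HasMFDerivAt.comp t (g := v) (f := fun t : ℝ => ((t, s) : ℝ × ℝ)) (hvd t s hs) h2
    have h4 := DFunLike.congr_fun (hasMFDerivAt_unique h3 h1) (1 : ℝ)
    refine Eq.trans ?_ (Eq.trans h4 ?_)
    · rfl
    · exact one_smul ℝ ((q s).2.2 • (hamVF lam (K s) (v (t, s)) : E))
  -- the velocity in the direction of `s`
  have hds : ∀ t, ∀ s ∈ J, HasMFDerivAt 𝓘(ℝ, ℝ) 𝓘(ℝ, E) (fun s => v (t, s)) s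
      ((dv t s).comp (ContinuousLinearMap.inr ℝ ℝ ℝ)) := by
    intro t s hs
    have h2 : HasMFDerivAt 𝓘(ℝ, ℝ) 𝓘(ℝ, ℝ × ℝ) (fun s : ℝ => ((t, s) : ℝ × ℝ)) s
        (ContinuousLinearMap.inr ℝ ℝ ℝ) := (hasFDerivAt_prodMk_right t s).hasMFDerivAt
    exact HasMFDerivAt.comp s (g := v) (f := fun s : ℝ => ((t, s) : ℝ × ℝ)) (hvd t s hs) h2
  set α : ℝ × ℝ → ℝ × ℝ →L[ℝ] ℝ := pull lam v with hα
  have hαapp : ∀ t s (a : ℝ × ℝ), α (t, s) a = (lam (v (t, s)) : E →L[ℝ] ℝ) (dv t s a) :=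
    fun _ _ _ => rfl
  have hαs : ∀ t, ∀ s ∈ J, ContDiffAt ℝ ∞ α (t, s) := fun t s hs =>
    (hvs t s hs).contDiffAt_pull h.exact_symplectic.1
  have hact : (fun s => chordAction lam K φ (q s)) =ᶠ[𝓝 s]
      fun s => ∫ t in (0 : ℝ)..1, α (t, s) (1, 0) := by
    filter_upwards [hJ.mem_nhds hs] with s hs
    rw [chordAction, ← intervalIntegral.integral_const_mul]
    refine intervalIntegral.integral_congr fun t _ => ?_
    rw [hαapp, hdt t s hs, map_smul, smul_eq_mul, hqs s hs, ← hvq t s hs]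
    rfl
  refine ((hasDerivAt_integral_oneForm hJ hαs hs).congr_of_eventuallyEq hact).congr_deriv ?_
  -- The endpoints move inside `L₀` and `L₁`, on whose tangent spaces `λ` vanishes.
  have hb₀ : α (0, s) (0, 1) = 0 := by
    have h1 : ∀ s ∈ J, v (0, s) ∈ L₀ := fun s hs => by
      have h2 : v (0, s) = (q s).1 := h.flow.zero _ _
      rw [h2]; exact hq₀ s hs
    have hev : ∀ᶠ s' in 𝓝 s, v (0, s') ∈ L₀ := by
      filter_upwards [hJ.mem_nhds hs] with s hs using h1 s hs
    have hmem := mem_tangent_of_hasMFDerivAt (c := fun s => v (0, s)) hev (hds 0 s hs)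
    exact hL₀.2.2.2 (v (0, s)) (h1 s hs) (dv 0 s (0, 1)) hmem
  have hb₁ : α (1, s) (0, 1) = 0 := by
    have h1 : ∀ s ∈ J, v (1, s) ∈ L₁ := fun s hs => by
      rw [hvq 1 s hs]; exact hq₁ s hs
    have hev : ∀ᶠ s' in 𝓝 s, v (1, s') ∈ L₁ := by
      filter_upwards [hJ.mem_nhds hs] with s hs using h1 s hs
    have hmem := mem_tangent_of_hasMFDerivAt (c := fun s => v (1, s)) hev (hds 1 s hs)
    exact hL₁.2.2.2 (v (1, s)) (h1 s hs) (dv 1 s (0, 1)) hmem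
  rw [hb₀, hb₁, sub_zero, add_zero, ← intervalIntegral.integral_const_mul,
    ← intervalIntegral.integral_neg]
  refine intervalIntegral.integral_congr fun t _ => ?_
  -- The integrand is `ω(∂ₛ v, τ X_K) = τ dK(∂ₛ v)`, and differentiating `K s (v (t, s)) = 0` in `s`
  -- gives `dK(∂ₛ v) = -∂ₛ K`.
  have h1 : extd α (t, s) (0, 1) (1, 0) = omegaL lam (v (t, s)) (dv t s (0, 1)) (dv t s (1, 0)) :=
    (extd_pull_eq_omega h.exact_symplectic.1 (hvs t s hs) (0, 1) (1, 0)).trans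
      (omega_eq_omegaL h.exact_symplectic.1 _ _ _)
  have h2 : diffE (K s) (v (t, s)) (dv t s (0, 1)) =
      omegaL lam (v (t, s)) (dv t s (0, 1)) (hamVF lam (K s) (v (t, s))) :=
    (h.exact_symplectic.hamVF_spec (K s) (v (t, s)) _).trans
      (omega_eq_omegaL h.exact_symplectic.1 _ _ _)
  have hline : ContMDiffAt 𝓘(ℝ, ℝ) 𝓘(ℝ, E) ∞ (fun s => v (t, s)) s :=
    ContMDiffAt.comp s (g := v) (f := fun s : ℝ => ((t, s) : ℝ × ℝ)) (hvs t s hs)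
      (contDiff_const.prodMk contDiff_id).contMDiff.contMDiffAt
  have h3 := h.diffE_eq_neg_deriv hline
    (by filter_upwards [hJ.mem_nhds hs] with s hs using hvK t s hs) (hds t s hs)
  have h4 : omegaL lam (v (t, s)) (dv t s (0, 1)) (hamVF lam (K s) (v (t, s))) =
      -deriv (fun s' => K s' (v (t, s))) s := h2.symm.trans h3
  have h5 : omegaL lam (v (t, s)) (dv t s (0, 1)) (dv t s (1, 0)) =
      (q s).2.2 * -deriv (fun s' => K s' (v (t, s))) s :=
    (congrArg _ (hdt t s hs)).trans ((map_smul _ _ _).trans (congrArg _ h4))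
  rw [h1, h5, hvq t s hs, mul_neg]

end CutoffFlow

/-! ### Limits of curves -/

/-- A bounded derivative makes `g` Lipschitz, and a Lipschitz function extends continuously past the
endpoint. -/
theorem exists_tendsto_of_hasDerivAt_bound {g g' : ℝ → ℝ} {a b C : ℝ} (hab : a < b)
    (hg : ∀ s ∈ Ioo a b, HasDerivAt g (g' s) s) (hC : ∀ s ∈ Ioo a b, |g' s| ≤ C) :
    ∃ l, Tendsto g (𝓝[<] b) (𝓝 l) := by
  have hC0 : 0 ≤ C := (abs_nonneg _).trans (hC ((a + b) / 2) ⟨by linarith, by linarith⟩)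
  have hlip : LipschitzOnWith ⟨C, hC0⟩ g (Ioo a b) :=
    (convex_Ioo a b).lipschitzOnWith_of_nnnorm_hasDerivWithin_le
      (fun s hs => (hg s hs).hasDerivWithinAt) (fun s hs => hC s hs)
  obtain ⟨G, hG, hgG⟩ := hlip.extend_real
  refine ⟨G b, ?_⟩
  refine ((hG.continuous.tendsto b).mono_left nhdsWithin_le_nhds).congr' ?_
  filter_upwards [Ioo_mem_nhdsLT hab] with s hs using (hgG hs).symm

section ClusterSet

variable {X : Type*} [TopologicalSpace X] [T2Space X] {q : ℝ → X} {a b : ℝ} {S : Set X}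

/-- The set of limit points of `q s` as `s` tends to `b` from the left. -/
def clusterSet (q : ℝ → X) (b : ℝ) : Set X := {z | MapClusterPt z (𝓝[<] b) q}

/-- If the curve kept returning to the compact set `S \ O`, it would have a limit point there,
outside `O`. -/
theorem eventually_mem_of_clusterSet_subset (hS : IsCompact S) (hq : ∀ᶠ s in 𝓝[<] b, q s ∈ S)
    {O : Set X} (hO : IsOpen O) (hsub : clusterSet q b ⊆ O) : ∀ᶠ s in 𝓝[<] b, q s ∈ O := by
  by_contra hne
  have hfr : ∃ᶠ s in 𝓝[<] b, q s ∈ S \ O := by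
    rw [not_eventually] at hne
    exact (hne.and_eventually hq).mono fun s hs => ⟨hs.2, hs.1⟩
  obtain ⟨z, hz, hcl⟩ := (hS.diff hO).exists_mapClusterPt_of_frequently hfr
  exact hz.2 (hsub hcl)

theorem clusterSet_nonempty (hS : IsCompact S) (hq : ∀ᶠ s in 𝓝[<] b, q s ∈ S) :
    (clusterSet q b).Nonempty := by
  obtain ⟨z, -, hz⟩ := hS.exists_mapClusterPt_of_frequently hq.frequently
  exact ⟨z, hz⟩

theorem clusterSet_subset (hS : IsClosed S) (hq : ∀ᶠ s in 𝓝[<] b, q s ∈ S) :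
    clusterSet q b ⊆ S := by
  intro z hz
  refine hS.closure_subset (mem_closure_iff_nhds.2 fun t ht => ?_)
  obtain ⟨s, hs, hs'⟩ := ((mapClusterPt_iff_frequently.1 hz t ht).and_eventually hq).exists
  exact ⟨q s, hs, hs'⟩

theorem isCompact_clusterSet (hS : IsCompact S) (hq : ∀ᶠ s in 𝓝[<] b, q s ∈ S) :
    IsCompact (clusterSet q b) :=
  hS.of_isClosed_subset isClosed_setOfPred_clusterPt (clusterSet_subset hS.isClosed hq)

/-- Two disjoint closed pieces of the compact cluster set have disjoint open neighbourhoods. The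
curve eventually stays in their union, and by connectedness its tail stays in one of them; no limit
point can lie in the other. -/
theorem isPreconnected_clusterSet (hS : IsCompact S) (hq : ∀ᶠ s in 𝓝[<] b, q s ∈ S)
    (hab : a < b) (hcont : ContinuousOn q (Ioo a b)) : IsPreconnected (clusterSet q b) := by
  have hcpt := isCompact_clusterSet hS hq
  rw [isPreconnected_iff_subset_of_fully_disjoint_closed hcpt.isClosed]
  intro u v hu hv huv hdisj
  have hsep : SeparatedNhds (clusterSet q b ∩ u) (clusterSet q b ∩ v) :=
    SeparatedNhds.of_isCompact_isCompact (hcpt.inter_right hu) (hcpt.inter_right hv)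
      (hdisj.mono inter_subset_right inter_subset_right)
  obtain ⟨U, V, hU, hV, huU, hvV, hUV⟩ := hsep
  have hsub : clusterSet q b ⊆ U ∪ V := fun z hz =>
    (huv hz).elim (fun h => Or.inl (huU ⟨hz, h⟩)) (fun h => Or.inr (hvV ⟨hz, h⟩))
  have hev := eventually_mem_of_clusterSet_subset hS hq (hU.union hV) hsub
  obtain ⟨a', ha', hsub'⟩ := (mem_nhdsLT_iff_exists_Ioo_subset' hab).1
    (hev.and (Ioo_mem_nhdsLT hab))
  have hpre : IsPreconnected (q '' Ioo a' b) :=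
    isPreconnected_Ioo.image q (hcont.mono fun s hs => (hsub' hs).2)
  have himg : q '' Ioo a' b ⊆ U ∪ V := by
    rintro _ ⟨s, hs, rfl⟩
    exact (hsub' hs).1
  have hkey : ∀ {A B : Set X}, IsOpen B → Disjoint A B → q '' Ioo a' b ⊆ A →
      ∀ z ∈ clusterSet q b, z ∉ B := by
    intro A B hB hAB hA z hz hzB
    obtain ⟨s, hs, hs'⟩ := ((mapClusterPt_iff_frequently.1 hz B (hB.mem_nhds hzB)).and_eventually
      (Ioo_mem_nhdsLT ha')).exists
    exact hAB.le_bot ⟨hA ⟨s, hs', rfl⟩, hs⟩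
  rcases hpre.subset_or_subset hU hV hUV himg with h | h
  · exact Or.inl fun z hz => (huv hz).elim id fun hzv => (hkey hV hUV h z hz (hvV ⟨hz, hzv⟩)).elim
  · exact Or.inr fun z hz =>
      (huv hz).elim (fun hzu => (hkey hU hUV.symm h z hz (huU ⟨hz, hzu⟩)).elim) id

theorem exists_seq_of_mem_clusterSet [FirstCountableTopology X] {z : X} (hz : z ∈ clusterSet q b)
    (hab : a < b) : ∃ u : ℕ → ℝ, (∀ n, u n ∈ Ioo a b) ∧ Tendsto u atTop (𝓝[<] b) ∧
      Tendsto (fun n => q (u n)) atTop (𝓝 z) := by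
  have hne : (comap q (𝓝 z) ⊓ 𝓝[<] b).NeBot := by
    have h1 : (𝓝 z ⊓ map q (𝓝[<] b)).NeBot := hz
    rwa [← Filter.push_pull', Filter.map_neBot_iff] at h1
  obtain ⟨u, hu⟩ := exists_seq_tendsto (comap q (𝓝 z) ⊓ 𝓝[<] b)
  have h1 := tendsto_inf.1 hu
  obtain ⟨N, hN⟩ := eventually_atTop.1 (h1.2.eventually (Ioo_mem_nhdsLT hab))
  refine ⟨fun n => u (n + N), fun n => hN _ (by omega), h1.2.comp (tendsto_add_atTop_nat N), ?_⟩
  exact (tendsto_comap_iff.1 h1.1).comp (tendsto_add_atTop_nat N)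

end ClusterSet

/-! ### A priori bounds for the action and the period along a family -/

namespace CutoffFlow

variable {E : Type*} [NormedAddCommGroup E] [NormedSpace ℝ E] [FiniteDimensional ℝ E]
  {M : Type*} [TopologicalSpace M] [ChartedSpace E M] [IsManifold 𝓘(ℝ, E) ∞ M] [T2Space M]
  {L₀ L₁ : Set M} {lam : OneForm E M} {K : ℝ → M → ℝ} {I : Set ℝ} {χ : M → ℝ}
  {φ : ℝ × M × ℝ × ℝ → M}

theorem continuous_deriv_param (h : CutoffFlow lam K I χ φ) :
    Continuous fun q : M × ℝ => deriv (fun s => K s q.1) q.2 := by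
  have hG : ContMDiff (𝓘(ℝ, ℝ).prod (𝓘(ℝ, E).prod 𝓘(ℝ, ℝ))) 𝓘(ℝ, ℝ) ∞
      (fun r : ℝ × M × ℝ => K r.1 r.2.1) := by
    have h1 : ContMDiff (𝓘(ℝ, ℝ).prod (𝓘(ℝ, E).prod 𝓘(ℝ, ℝ))) (𝓘(ℝ, E).prod 𝓘(ℝ, ℝ)) ∞
        (fun r : ℝ × M × ℝ => (r.2.1, r.1)) :=
      (contMDiff_fst.comp contMDiff_snd).prodMk contMDiff_fst
    exact ContMDiff.comp (g := fun q : M × ℝ => K q.2 q.1)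
      (f := fun r : ℝ × M × ℝ => (r.2.1, r.1)) h.smooth_ham h1
  have h2 : Continuous fun q : M × ℝ => ((q.2, q.1, 0) : ℝ × M × ℝ) := by fun_prop
  exact (contMDiff_deriv hG).continuous.comp h2

/-- The triples `(x, s, τ)` of chords with `s ∈ I` and `τ ∈ [m₁, m₂]`. -/
def boundedChords (K : ℝ → M → ℝ) (φ : ℝ × M × ℝ × ℝ → M) (I : Set ℝ) (L₀ L₁ : Set M)
    (m₁ m₂ : ℝ) : Set (M × ℝ × ℝ) :=
  {z | z.1 ∈ L₀ ∧ φ (1, z) ∈ L₁ ∧ (z.2.1 ∈ I ∧ K z.2.1 z.1 = 0) ∧ z.2.2 ∈ Icc m₁ m₂}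

theorem isCompact_boundedChords (h : CutoffFlow lam K I χ φ) (hL₀ : IsClosed L₀)
    (hL₁ : IsClosed L₁) (hZ : IsCompact {q : M × ℝ | q.2 ∈ I ∧ K q.2 q.1 = 0}) (m₁ m₂ : ℝ) :
    IsCompact (boundedChords K φ I L₀ L₁ m₁ m₂) := by
  have hc1 : Continuous fun z : M × ℝ × ℝ => φ (1, z) := h.flow.smooth.continuous.comp (by fun_prop)
  have hc2 : Continuous fun z : M × ℝ × ℝ => (z.1, z.2.1) := by fun_prop
  have hcl : IsClosed (boundedChords K φ I L₀ L₁ m₁ m₂) :=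
    (hL₀.preimage continuous_fst).inter ((hL₁.preimage hc1).inter ((hZ.isClosed.preimage hc2).inter
      (isClosed_Icc.preimage (continuous_snd.comp continuous_snd))))
  have himg : IsCompact ((fun p : (M × ℝ) × ℝ => (p.1.1, p.1.2, p.2)) ''
      ({q : M × ℝ | q.2 ∈ I ∧ K q.2 q.1 = 0} ×ˢ Icc m₁ m₂)) :=
    (hZ.prod isCompact_Icc).image (by fun_prop)
  refine himg.of_isClosed_subset hcl ?_
  rintro z ⟨-, -, hz, hτ⟩
  exact ⟨((z.1, z.2.1), z.2.2), ⟨hz, hτ⟩, rfl⟩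

/-- Along a smooth family of chords the action converges to a positive limit, and the periods
remain bounded and bounded away from zero. -/
theorem exists_tendsto_chordAction (h : CutoffFlow lam K I χ φ)
    (hL₀ : IsExactLagrangian lam L₀) (hL₁ : IsExactLagrangian lam L₁)
    (hZ : IsCompact {q : M × ℝ | q.2 ∈ I ∧ K q.2 q.1 = 0}) {q : ℝ → M × ℝ × ℝ} {a b : ℝ}
    (hab : a < b) (hI : Ioo a b ⊆ I)
    (hq : ContMDiffOn 𝓘(ℝ, ℝ) (𝓘(ℝ, E).prod 𝓘(ℝ, ℝ × ℝ)) ∞ q (Ioo a b))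
    (hqs : ∀ s ∈ Ioo a b, (q s).2.1 = s) (hqst : ∀ s ∈ Ioo a b, q s ∈ state φ L₀ L₁)
    (hqK : ∀ s ∈ Ioo a b, K s (q s).1 = 0) :
    (∃ A, Tendsto (fun s => chordAction lam K φ (q s)) (𝓝[<] b) (𝓝 A)) ∧
      ∃ m₁ > 0, ∃ m₂, ∀ᶠ s in 𝓝[<] b, q s ∈ boundedChords K φ I L₀ L₁ m₁ m₂ := by
  set Z : Set (M × ℝ) := {q : M × ℝ | q.2 ∈ I ∧ K q.2 q.1 = 0} with hZdef
  have hflowZ : ∀ s ∈ Ioo a b, ∀ t, (φ (t, q s), s) ∈ Z := by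
    intro s hs t
    refine ⟨hI hs, ?_⟩
    have h1 : q s = ((q s).1, s, (q s).2.2) := Prod.ext rfl (Prod.ext (hqs s hs) rfl)
    simp only
    rw [h1]
    exact (h.ham_flow t (q s).1 s (q s).2.2).trans (hqK s hs)
  have hsp : Continuous fun q : M × ℝ => speed lam K q.1 q.2 := h.contMDiff_speed.continuous
  have hdp := h.continuous_deriv_param
  have hmid : (a + b) / 2 ∈ Ioo a b := ⟨by linarith, by linarith⟩
  -- On the compact zero set, `κ₁ ≤ λ(X) ≤ κ₂` with `κ₁ > 0` by the contact condition, and `|∂ₛ K| ≤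
  -- κ₃`. These give `κ₁ τ ≤ A ≤ κ₂ τ` and `|A'| ≤ κ₃ τ`.
  obtain ⟨z₁, hz₁, hmin⟩ := hZ.exists_isMinOn ⟨_, hflowZ _ hmid 0⟩ hsp.continuousOn
  set κ₁ := speed lam K z₁.1 z₁.2 with hκ₁
  have hκ₁pos : 0 < κ₁ := h.speed_pos hz₁.1 hz₁.2
  obtain ⟨κ₂, hκ₂⟩ := hZ.exists_bound_of_continuousOn hsp.continuousOn
  obtain ⟨κ₃, hκ₃⟩ := hZ.exists_bound_of_continuousOn hdp.continuousOn
  have hκ₁₂ : κ₁ ≤ κ₂ := (le_abs_self _).trans (hκ₂ z₁ hz₁)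
  set A : ℝ → ℝ := fun s => chordAction lam K φ (q s) with hA
  have hcφ : ∀ s, Continuous fun t => φ (t, q s) := fun s =>
    h.flow.smooth.continuous.comp (by fun_prop)
  have hAform : ∀ s ∈ Ioo a b, A s = (q s).2.2 * ∫ t in (0 : ℝ)..1, speed lam K (φ (t, q s)) s := by
    intro s hs
    simp only [hA, chordAction, hqs s hs]
  have hint : ∀ s, IntervalIntegrable (fun t => speed lam K (φ (t, q s)) s)
      MeasureTheory.volume 0 1 := fun s =>
    (hsp.comp ((hcφ s).prodMk continuous_const)).intervalIntegrable _ _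
  have hAlow : ∀ s ∈ Ioo a b, κ₁ * (q s).2.2 ≤ A s := by
    intro s hs
    rw [hAform s hs, mul_comm]
    refine mul_le_mul_of_nonneg_left ?_ (hqst s hs).2.2.le
    have h1 := intervalIntegral.integral_mono_on (zero_le_one' ℝ)
      (intervalIntegrable_const (c := κ₁)) (hint s) (fun t _ => hmin (hflowZ s hs t))
    simpa using h1
  have hAup : ∀ s ∈ Ioo a b, A s ≤ κ₂ * (q s).2.2 := by
    intro s hs
    rw [hAform s hs, mul_comm κ₂]
    refine mul_le_mul_of_nonneg_left ?_ (hqst s hs).2.2.le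
    have h1 := intervalIntegral.integral_mono_on (zero_le_one' ℝ) (hint s)
      (intervalIntegrable_const (c := κ₂))
      (fun t _ => (le_abs_self _).trans (hκ₂ _ (hflowZ s hs t)))
    simpa using h1
  have hApos : ∀ s ∈ Ioo a b, 0 < A s := fun s hs =>
    (mul_pos hκ₁pos (hqst s hs).2.2).trans_le (hAlow s hs)
  set A' : ℝ → ℝ := fun s =>
    -((q s).2.2 * ∫ t in (0 : ℝ)..1, deriv (fun s' => K s' (φ (t, q s))) s) with hA'
  have hder : ∀ s ∈ Ioo a b, HasDerivAt A (A' s) s := fun s hs =>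
    h.hasDerivAt_chordAction hL₀ hL₁ isOpen_Ioo hI hq hqs (fun s hs => (hqst s hs).1)
      (fun s hs => (hqst s hs).2.1) hqK hs
  have hA'bd : ∀ s ∈ Ioo a b, |A' s| ≤ κ₃ * (q s).2.2 := by
    intro s hs
    have h1 := intervalIntegral.norm_integral_le_of_norm_le_const (a := 0) (b := 1)
      (f := fun t => deriv (fun s' => K s' (φ (t, q s))) s) (C := κ₃)
      (fun t _ => hκ₃ _ (hflowZ s hs t))
    rw [sub_zero, abs_one, mul_one, Real.norm_eq_abs] at h1
    rw [hA', abs_neg, abs_mul, abs_of_pos (hqst s hs).2.2, mul_comm]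
    exact mul_le_mul_of_nonneg_right h1 (hqst s hs).2.2.le
  have hκ₃ : 0 ≤ κ₃ := (norm_nonneg _).trans (hκ₃ z₁ hz₁)
  -- Passing to the logarithm turns `|A'| ≤ (κ₃ / κ₁) A` into a bounded derivative, and also keeps
  -- the limit `exp l` of `A` away from zero.
  obtain ⟨l, hl⟩ := exists_tendsto_of_hasDerivAt_bound hab (C := κ₃ / κ₁)
    (g := fun s => Real.log (A s)) (g' := fun s => A' s / A s)
    (fun s hs => (hder s hs).log (hApos s hs).ne') (fun s hs => by
      rw [abs_div, abs_of_pos (hApos s hs), div_le_div_iff₀ (hApos s hs) hκ₁pos]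
      calc |A' s| * κ₁ ≤ κ₃ * (q s).2.2 * κ₁ :=
            mul_le_mul_of_nonneg_right (hA'bd s hs) hκ₁pos.le
        _ = κ₃ * (κ₁ * (q s).2.2) := by ring
        _ ≤ κ₃ * A s := mul_le_mul_of_nonneg_left (hAlow s hs) hκ₃)
  have hIoo := Ioo_mem_nhdsLT hab
  have hlim : Tendsto A (𝓝[<] b) (𝓝 (Real.exp l)) := by
    refine ((Real.continuous_exp.tendsto l).comp hl).congr' ?_
    filter_upwards [hIoo] with s hs using Real.exp_log (hApos s hs)
  -- Eventually `A` lies between `exp l / 2` and `2 exp l`; dividing by `κ₂` and `κ₁` respectively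
  -- gives the bounds for `τ`.
  refine ⟨⟨_, hlim⟩, Real.exp l / 2 / κ₂, by have := hκ₁pos.trans_le hκ₁₂; positivity,
    2 * Real.exp l / κ₁, ?_⟩
  have hle := Real.exp_pos l
  filter_upwards [hIoo, hlim.eventually (Ioo_mem_nhds (a := Real.exp l / 2) (b := 2 * Real.exp l)
    (by linarith) (by linarith))] with s hs hAs
  refine ⟨(hqst s hs).1, (hqst s hs).2.1, ⟨?_, ?_⟩, ?_, ?_⟩
  · rw [hqs s hs]; exact hI hs
  · rw [hqs s hs]; exact hqK s hs
  · rw [div_le_iff₀ (hκ₁pos.trans_le hκ₁₂), mul_comm]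
    exact hAs.1.le.trans (hAup s hs)
  · rw [le_div_iff₀ hκ₁pos, mul_comm]
    exact (hAlow s hs).trans hAs.2.le

end CutoffFlow

/-! ### Reparametrisation of `[0,1]` by `[0,π]` -/

/-- A smooth map `ℝ → [0,1]` which restricts to an increasing homeomorphism `[0,π] → [0,1]`. -/
noncomputable def wave (s : ℝ) : ℝ := (1 - Real.cos s) / 2

/-- The inverse of `wave`. -/
noncomputable def waveInv (μ : ℝ) : ℝ := Real.arccos (1 - 2 * μ)

theorem wave_mem (s : ℝ) : wave s ∈ Icc (0 : ℝ) 1 := by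
  have h1 := Real.cos_le_one s
  have h2 := Real.neg_one_le_cos s
  constructor <;> unfold wave <;> linarith

theorem contDiff_wave : ContDiff ℝ ∞ wave := by
  unfold wave
  exact (contDiff_const.sub Real.contDiff_cos).div_const 2

theorem continuous_waveInv : Continuous waveInv := by
  unfold waveInv
  exact Real.continuous_arccos.comp (by fun_prop)

/-- Smoothness fails at the two ends, which is harmless: the inverse is differentiated only when a
family is continued past an interior parameter. -/
theorem contDiffAt_waveInv {μ : ℝ} (hμ : μ ∈ Ioo (0 : ℝ) 1) : ContDiffAt ℝ ∞ waveInv μ := by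
  have h1 : ContDiffAt ℝ ∞ Real.arccos (1 - 2 * μ) :=
    Real.contDiffAt_arccos (by linarith [hμ.2]) (by linarith [hμ.1])
  exact h1.comp μ (contDiffAt_const.sub (contDiffAt_const.mul contDiffAt_id))

theorem wave_waveInv {μ : ℝ} (hμ : μ ∈ Icc (0 : ℝ) 1) : wave (waveInv μ) = μ := by
  rw [wave, waveInv, Real.cos_arccos (by linarith [hμ.2]) (by linarith [hμ.1])]
  ring

theorem waveInv_wave {s : ℝ} (hs : s ∈ Icc (0 : ℝ) Real.pi) : waveInv (wave s) = s := by
  have h1 : 1 - 2 * wave s = Real.cos s := by unfold wave; ring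
  rw [waveInv, h1, Real.arccos_cos hs.1 hs.2]

theorem waveInv_mem (μ : ℝ) : waveInv μ ∈ Icc (0 : ℝ) Real.pi :=
  ⟨Real.arccos_nonneg _, Real.arccos_le_pi _⟩

theorem waveInv_lt {μ ν : ℝ} (hμ : 0 ≤ μ) (hν : ν ≤ 1) (h : μ < ν) : waveInv μ < waveInv ν :=
  Real.arccos_lt_arccos (by linarith) (by linarith) (by linarith)

theorem waveInv_zero : waveInv 0 = 0 := by simp [waveInv]

theorem wave_lt {s s' : ℝ} (hs : 0 ≤ s) (hs' : s' ≤ Real.pi) (h : s < s') : wave s < wave s' := by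
  have := Real.cos_lt_cos_of_nonneg_of_le_pi hs hs' h
  unfold wave
  linarith

theorem wave_mem_Ico {μ s : ℝ} (hμ : μ ∈ Icc (0 : ℝ) 1) (hs : s ∈ Ico 0 (waveInv μ)) :
    wave s ∈ Ico 0 μ := by
  refine ⟨(wave_mem s).1, ?_⟩
  have h := wave_lt hs.1 (waveInv_mem μ).2 hs.2
  rwa [wave_waveInv hμ] at h

theorem waveInv_mem_Ico {μ ν : ℝ} (hν : ν ≤ 1) (hμ : μ ∈ Ico 0 ν) :
    waveInv μ ∈ Ico 0 (waveInv ν) :=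
  ⟨(waveInv_mem μ).1, waveInv_lt hμ.1 hν hμ.2⟩

/-! ### The reparametrised Hamiltonians and the continuation of chord families -/

section Final

variable {E : Type*} [NormedAddCommGroup E] [NormedSpace ℝ E] [FiniteDimensional ℝ E]
  {M : Type*} [TopologicalSpace M] [ChartedSpace E M] [IsManifold 𝓘(ℝ, E) ∞ M] [T2Space M]
  {L₀ L₁ : Set M} {lam : OneForm E M} {H : ℝ → M → ℝ} {χ : M → ℝ}
  {φ : ℝ × M × ℝ × ℝ → M}

/-- The family of Hamiltonians, reparametrised by `[0,π]`. -/
noncomputable def reparam (H : ℝ → M → ℝ) (s : ℝ) : M → ℝ := H (wave s)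

theorem reparam_waveInv {μ : ℝ} (hμ : μ ∈ Icc (0 : ℝ) 1) : reparam H (waveInv μ) = H μ :=
  congrArg H (wave_waveInv hμ)

/-- Since `wave` maps all of `ℝ` into `[0,1]`, smoothness on `M × [0,1]` suffices for smoothness on
`M × ℝ`, with no extension of `H` beyond the interval. -/
theorem IsContactFamily.smooth_reparam (hH : IsContactFamily lam H) :
    ContMDiff (𝓘(ℝ, E).prod 𝓘(ℝ, ℝ)) 𝓘(ℝ, ℝ) ∞ (fun q : M × ℝ => reparam H q.2 q.1) := by
  have h1 : ContMDiff (𝓘(ℝ, E).prod 𝓘(ℝ, ℝ)) (𝓘(ℝ, E).prod 𝓘(ℝ, ℝ)) ∞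
      (fun q : M × ℝ => (q.1, wave q.2)) :=
    contMDiff_fst.prodMk (contDiff_wave.contMDiff.comp contMDiff_snd)
  exact ContMDiffOn.comp_contMDiff (g := fun q : M × ℝ => H q.2 q.1)
    (f := fun q : M × ℝ => (q.1, wave q.2)) hH.smooth h1 (fun q => ⟨trivial, wave_mem _⟩)

theorem IsContactFamily.isCompact_reparam (hH : IsContactFamily lam H) :
    IsCompact {q : M × ℝ | q.2 ∈ Icc (0 : ℝ) Real.pi ∧ reparam H q.2 q.1 = 0} := by
  have hc : Continuous fun q : M × ℝ => (q.1, waveInv q.2) :=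
    continuous_fst.prodMk (continuous_waveInv.comp continuous_snd)
  convert hH.compact.image hc using 1
  ext ⟨x, s⟩
  constructor
  · rintro ⟨hs, hx⟩
    exact ⟨(x, wave s), ⟨wave_mem s, hx⟩, Prod.ext rfl (waveInv_wave hs)⟩
  · rintro ⟨⟨y, μ⟩, ⟨hμ, hy⟩, hq⟩
    obtain ⟨rfl, rfl⟩ := Prod.mk.inj hq
    refine ⟨waveInv_mem μ, ?_⟩
    simp only
    rw [reparam_waveInv hμ]
    exact hy

/-- All zero sets project into one compact subset of `M`. A bump function equal to `1` near it and
supported in a compact set makes the Hamiltonian fields compactly supported, hence complete. -/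
theorem IsContactFamily.exists_cutoffFlow [SecondCountableTopology M]
    (hlam : IsExactSymplectic lam) (hH : IsContactFamily lam H) :
    ∃ χ φ, CutoffFlow lam (reparam H) (Icc 0 Real.pi) χ φ := by
  have : LocallyCompactSpace M := Manifold.locallyCompact_of_finiteDimensional 𝓘(ℝ, E)
  have : SigmaCompactSpace M := sigmaCompactSpace_of_locallyCompact_secondCountable
  set Z : Set M := Prod.fst '' {q : M × ℝ | q.2 ∈ Icc (0 : ℝ) Real.pi ∧ reparam H q.2 q.1 = 0}
    with hZ
  have hZc : IsCompact Z := hH.isCompact_reparam.image continuous_fst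
  obtain ⟨C, hC, hZC⟩ := exists_compact_superset hZc
  obtain ⟨f, hf1, hf0, -⟩ := exists_contMDiffMap_one_nhds_of_subset_interior (n := ⊤) 𝓘(ℝ, E)
    hZc.isClosed hZC
  have hham : SmoothFamily (fun (p : ℝ × ℝ) x => hamVF lam (reparam H p.1) x) := by
    refine hlam.smoothFamily_hamVF (K := fun p : ℝ × ℝ => reparam H p.1) ?_
    have h1 : ContMDiff (𝓘(ℝ, E).prod 𝓘(ℝ, ℝ × ℝ)) (𝓘(ℝ, E).prod 𝓘(ℝ, ℝ)) ∞
        (fun q : M × ℝ × ℝ => (q.1, q.2.1)) :=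
      contMDiff_fst.prodMk (contDiff_fst.contMDiff.comp contMDiff_snd)
    exact ContMDiff.comp (g := fun q : M × ℝ => reparam H q.2 q.1)
      (f := fun q : M × ℝ × ℝ => (q.1, q.2.1)) hH.smooth_reparam h1
  have hg : ContMDiff (𝓘(ℝ, E).prod 𝓘(ℝ, ℝ × ℝ)) 𝓘(ℝ, ℝ) ∞
      (fun q : M × ℝ × ℝ => f q.1 * q.2.2) := by
    have h1 : ContMDiff (𝓘(ℝ, E).prod 𝓘(ℝ, ℝ × ℝ)) 𝓘(ℝ, ℝ) ∞ (fun q : M × ℝ × ℝ => f q.1) :=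
      f.contMDiff.comp contMDiff_fst
    have h2 : ContMDiff (𝓘(ℝ, E).prod 𝓘(ℝ, ℝ × ℝ)) 𝓘(ℝ, ℝ) ∞ (fun q : M × ℝ × ℝ => q.2.2) :=
      contDiff_snd.contMDiff.comp contMDiff_snd
    exact h1.mul h2
  obtain ⟨φ, hφ⟩ := (hham.smul hg).exists_flow hC (fun p x hx => by
    have h1 : f x = 0 := hf0 x hx
    simp only [h1, zero_mul]
    exact zero_smul ℝ (hamVF lam (reparam H p.1) x : E))
  refine ⟨f, φ, hlam, hH.smooth_reparam, hφ, fun s hs x hx => ?_, fun s hs x hx =>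
    hH.contact _ (wave_mem s) x hx⟩
  have hxZ : x ∈ Z := ⟨(x, s), ⟨hs, hx⟩, rfl⟩
  exact hf1.filter_mono (nhds_le_nhdsSet hxZ)

/-- The initial point, the parameter and the period of the chords of a family. -/
noncomputable def trace (c : ℝ → PathSpace E L₀ L₁ × Ioi (0 : ℝ)) (s : ℝ) : M × ℝ × ℝ :=
  ((c (wave s)).1.toFun 0, s, (c (wave s)).2)

variable {c : ℝ → PathSpace E L₀ L₁ × Ioi (0 : ℝ)} {c₀ : PathSpace E L₀ L₁ × Ioi (0 : ℝ)}
  {μ₁ : ℝ}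

theorem IsChordFamily.trace_spec (hc : IsChordFamily lam H c₀ μ₁ c) (hμ : μ₁ ∈ Ioc (0 : ℝ) 1)
    (h : CutoffFlow lam (reparam H) (Icc 0 Real.pi) χ φ) {s : ℝ} (hs : s ∈ Ico 0 (waveInv μ₁)) :
    ∃ hz : trace c s ∈ CutoffFlow.state φ L₀ L₁, reparam H s (trace c s).1 = 0 ∧
      h.toChord ⟨_, hz⟩ = c (wave s) :=
  h.exists_toChord_eq (c (wave s)) ⟨hs.1, hs.2.le.trans (waveInv_mem μ₁).2⟩
    (hc.chord _ (wave_mem_Ico ⟨hμ.1.le, hμ.2⟩ hs))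

theorem IsChordFamily.contMDiffOn_trace (hc : IsChordFamily lam H c₀ μ₁ c)
    (hμ : μ₁ ∈ Ioc (0 : ℝ) 1) :
    ContMDiffOn 𝓘(ℝ, ℝ) (𝓘(ℝ, E).prod 𝓘(ℝ, ℝ × ℝ)) ∞ (trace c) (Ioo 0 (waveInv μ₁)) := by
  have hmaps : ∀ s ∈ Ioo 0 (waveInv μ₁), wave s ∈ Ico 0 μ₁ := fun s hs =>
    wave_mem_Ico ⟨hμ.1.le, hμ.2⟩ ⟨hs.1.le, hs.2⟩
  have h1 : ContMDiffOn 𝓘(ℝ, ℝ) 𝓘(ℝ, E) ∞ (fun s => (c (wave s)).1.extend 0)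
      (Ioo 0 (waveInv μ₁)) :=
    ContMDiffOn.comp (g := fun q : ℝ × ℝ => (c q.2).1.extend q.1) (f := fun s => ((0 : ℝ), wave s))
      hc.smooth_path (contDiff_const.prodMk contDiff_wave).contMDiff.contMDiffOn
      (fun s hs => ⟨left_mem_Icc.2 zero_le_one, hmaps s hs⟩)
  have h2 : ContDiffOn ℝ ∞ (fun s => ((c (wave s)).2 : ℝ)) (Ioo 0 (waveInv μ₁)) :=
    hc.smooth_period.comp contDiff_wave.contDiffOn hmaps
  have h3 : ContMDiffOn 𝓘(ℝ, ℝ) 𝓘(ℝ, ℝ × ℝ) ∞ (fun s => (s, ((c (wave s)).2 : ℝ)))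
      (Ioo 0 (waveInv μ₁)) := (contDiffOn_id.prodMk h2).contMDiffOn
  refine (h1.prodMk h3).congr fun s _ => ?_
  rw [trace, (c (wave s)).1.extend_apply (left_mem_Icc.2 zero_le_one)]
  rfl

/-- A chord family which converges along a smooth branch of non-degenerate chords can be
extended. -/
theorem IsChordFamily.exists_extension (hc : IsChordFamily lam H c₀ μ₁ c)
    (hμ : μ₁ ∈ Ioo (0 : ℝ) 1) (h : CutoffFlow lam (reparam H) (Icc 0 Real.pi) χ φ)
    (hL₀ : IsExactLagrangian lam L₀) (hL₁ : IsExactLagrangian lam L₁) {β : ℝ → M × ℝ × ℝ}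
    {J : Set ℝ} (hJ : IsOpen J) (hbJ : waveInv μ₁ ∈ J)
    (hβ : ContMDiffOn 𝓘(ℝ, ℝ) (𝓘(ℝ, E).prod 𝓘(ℝ, ℝ × ℝ)) ∞ β J)
    (hβs : ∀ s ∈ J, (β s).2.1 = s) (hβst : ∀ s ∈ J, β s ∈ CutoffFlow.state φ L₀ L₁)
    (hβK : ∀ s ∈ J, reparam H s (β s).1 = 0)
    (hβtr : ∀ s ∈ J, CutoffFlow.TransverseAt E (reparam H) φ L₀ L₁ (β s))
    (hev : ∀ᶠ s in 𝓝[<] waveInv μ₁, trace c s = β s) :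
    ∃ ν ∈ Ioc (0 : ℝ) 1, μ₁ < ν ∧ ∃ c', IsChordFamily lam H c₀ ν c' := by
  classical
  have hμ' : μ₁ ∈ Icc (0 : ℝ) 1 := Ioo_subset_Icc_self hμ
  have hb0 : 0 < waveInv μ₁ := by
    have := waveInv_lt le_rfl hμ.2.le hμ.1
    rwa [waveInv_zero] at this
  -- a neighbourhood of `μ₁` on which the branch is defined
  have hnear : ∀ᶠ μ in 𝓝 μ₁, waveInv μ ∈ J ∧ μ ∈ Ioo (0 : ℝ) 1 ∧
      (μ < μ₁ → trace c (waveInv μ) = β (waveInv μ)) := by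
    have h1 : Tendsto waveInv (𝓝 μ₁) (𝓝 (waveInv μ₁)) := continuous_waveInv.tendsto μ₁
    have h2 : ∀ᶠ s in 𝓝 (waveInv μ₁), s < waveInv μ₁ → trace c s = β s :=
      eventually_nhdsWithin_iff.1 hev
    filter_upwards [h1.eventually (hJ.mem_nhds hbJ), Ioo_mem_nhds hμ.1 hμ.2, h1.eventually h2]
      with μ h3 h4 h5
    exact ⟨h3, h4, fun h6 => h5 (waveInv_lt h4.1.le hμ.2.le h6)⟩
  obtain ⟨ε, hε, hball⟩ := Metric.eventually_nhds_iff.1 hnear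
  have hnear' : ∀ μ ∈ Ioo (μ₁ - ε) (μ₁ + ε), waveInv μ ∈ J ∧ μ ∈ Ioo (0 : ℝ) 1 ∧
      (μ < μ₁ → trace c (waveInv μ) = β (waveInv μ)) := fun μ hμ => hball (by
    rw [Real.dist_eq, abs_lt]
    constructor <;> linarith [hμ.1, hμ.2])
  set ν : ℝ := μ₁ + ε / 2 with hν
  have hν1 : ν ∈ Ioo (0 : ℝ) 1 := (hnear' ν ⟨by linarith, by linarith⟩).2.1
  -- The old family before `μ₁`, the branch from `μ₁` on; the value `c₀` is never used below `ν`.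
  set c' : ℝ → PathSpace E L₀ L₁ × Ioi (0 : ℝ) := fun μ =>
    if μ < μ₁ then c μ else if hs : waveInv μ ∈ J then h.toChord ⟨β (waveInv μ), hβst _ hs⟩ else c₀
    with hc'
  have hc'lt : ∀ μ < μ₁, c' μ = c μ := fun μ hμ => if_pos hμ
  -- Just before `μ₁` the old family already coincides with the branch. Near `μ₁` the new family is
  -- therefore the branch on both sides, which gives smoothness across `μ₁`.
  have hc'β : ∀ μ ∈ Ioo (μ₁ - ε) (μ₁ + ε), ∃ hs : waveInv μ ∈ J,
      c' μ = h.toChord ⟨β (waveInv μ), hβst _ hs⟩ := by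
    intro μ hμε
    obtain ⟨h1, h2, h3⟩ := hnear' μ hμε
    refine ⟨h1, ?_⟩
    rcases lt_or_ge μ μ₁ with hlt | hge
    · rw [hc'lt μ hlt]
      obtain ⟨hz, -, hch⟩ := hc.trace_spec ⟨hμ.1, hμ.2.le⟩ h
        (waveInv_mem_Ico hμ.2.le ⟨h2.1.le, hlt⟩)
      rw [wave_waveInv (Ioo_subset_Icc_self h2)] at hch
      rw [← hch]
      congr 1
      exact Subtype.ext (h3 hlt)
    · simp only [hc', if_neg hge.not_gt, dif_pos h1]
  have hβat : ∀ μ ∈ Ioo (μ₁ - ε) (μ₁ + ε), ContMDiffAt 𝓘(ℝ, ℝ) (𝓘(ℝ, E).prod 𝓘(ℝ, ℝ × ℝ)) ∞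
      (fun μ => β (waveInv μ)) μ := fun μ hμε => by
    obtain ⟨h1, h2, -⟩ := hnear' μ hμε
    exact ContMDiffAt.comp μ (g := β) (f := waveInv) (hβ.contMDiffAt (hJ.mem_nhds h1))
      (contDiffAt_waveInv h2).contMDiffAt
  have hgood : ∀ μ ∈ Ico 0 ν, μ₁ ≤ μ → μ ∈ Ioo (μ₁ - ε) (μ₁ + ε) := fun μ hμν hge =>
    ⟨by linarith, by linarith [hμν.2]⟩
  have hbranch : ∀ μ ∈ Ico 0 ν, μ₁ ≤ μ → IsChord lam (H μ) (c' μ) ∧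
      Nondegenerate lam (H μ) (c' μ) := by
    intro μ hμν hge
    obtain ⟨hs, hcs⟩ := hc'β μ (hgood μ hμν hge)
    obtain ⟨-, h2, -⟩ := hnear' μ (hgood μ hμν hge)
    have h3 : (β (waveInv μ)).2.1 = waveInv μ := hβs _ hs
    have h4 : reparam H (β (waveInv μ)).2.1 = H μ := by
      rw [h3, reparam_waveInv (Ioo_subset_Icc_self h2)]
    have h5 : (β (waveInv μ)).2.1 ∈ Icc 0 Real.pi := by rw [h3]; exact waveInv_mem μ
    have h6 : reparam H (β (waveInv μ)).2.1 (β (waveInv μ)).1 = 0 := by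
      rw [h3]; exact hβK _ hs
    rw [hcs, ← h4]
    exact ⟨h.isChord_toChord ⟨β (waveInv μ), hβst _ hs⟩ h5 h6,
      (h.nondegenerate_toChord_iff hL₀ hL₁ ⟨β (waveInv μ), hβst _ hs⟩ h5 h6).2 (hβtr _ hs)⟩
  refine ⟨ν, ⟨hν1.1, hν1.2.le⟩, by linarith, c', ?_, ?_, ?_, ?_, ?_⟩
  · rw [hc'lt 0 hμ.1, hc.start]
  · rintro ⟨t, μ⟩ ⟨ht, hμν⟩
    rcases lt_or_ge μ μ₁ with hlt | hge
    · have hset : Icc (0 : ℝ) 1 ×ˢ Ico 0 μ₁ ∈ 𝓝[Icc (0 : ℝ) 1 ×ˢ Ico 0 ν] (t, μ) := by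
        have hopen : IsOpen {r : ℝ × ℝ | r.2 < μ₁} := isOpen_lt continuous_snd continuous_const
        filter_upwards [self_mem_nhdsWithin, mem_nhdsWithin_of_mem_nhds (hopen.mem_nhds hlt)]
          with r hr hr'
        exact ⟨hr.1, hr.2.1, hr'⟩
      refine ((hc.smooth_path (t, μ) ⟨ht, hμν.1, hlt⟩).mono_of_mem_nhdsWithin
        hset).congr_of_eventuallyEq ?_ (by simp only [hc'lt μ hlt])
      filter_upwards [hset] with r hr
      simp only [hc'lt r.2 hr.2.2]
    · have hgd := hgood μ hμν hge
      have h1 : ContMDiffAt 𝓘(ℝ, ℝ × ℝ) (𝓘(ℝ, E).prod 𝓘(ℝ, ℝ × ℝ)) ∞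
          (fun r : ℝ × ℝ => β (waveInv r.2)) (t, μ) :=
        ContMDiffAt.comp (t, μ) (g := fun μ => β (waveInv μ)) (f := fun r : ℝ × ℝ => r.2)
          (hβat μ hgd) contDiff_snd.contMDiff.contMDiffAt
      have h2 : ContMDiffAt 𝓘(ℝ, ℝ × ℝ) 𝓘(ℝ, ℝ) ∞ (fun r : ℝ × ℝ => r.1) (t, μ) :=
        contDiff_fst.contMDiff.contMDiffAt
      have h3 : ContMDiffAt 𝓘(ℝ, ℝ × ℝ) 𝓘(ℝ, E) ∞
          (fun r : ℝ × ℝ => φ (r.1, β (waveInv r.2))) (t, μ) :=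
        ContMDiffAt.comp (t, μ) (g := φ) (f := fun r : ℝ × ℝ => (r.1, β (waveInv r.2)))
          (h.flow.smooth _) (h2.prodMk h1)
      have heq : ∀ r : ℝ × ℝ, r.1 ∈ Icc (0 : ℝ) 1 → r.2 ∈ Ioo (μ₁ - ε) (μ₁ + ε) →
          (c' r.2).1.extend r.1 = φ (r.1, β (waveInv r.2)) := by
        intro r hr1 hr2
        obtain ⟨hs, hcs⟩ := hc'β r.2 hr2
        rw [hcs]
        exact h.toChord_extend _ hr1
      refine h3.contMDiffWithinAt.congr_of_eventuallyEq ?_ (heq (t, μ) ht hgd)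
      have hopen : IsOpen {r : ℝ × ℝ | r.2 ∈ Ioo (μ₁ - ε) (μ₁ + ε)} :=
        isOpen_Ioo.preimage continuous_snd
      filter_upwards [self_mem_nhdsWithin, mem_nhdsWithin_of_mem_nhds (hopen.mem_nhds hgd)]
        with r hr hr'
      exact heq r hr.1 hr'
  · intro μ hμν
    rcases lt_or_ge μ μ₁ with hlt | hge
    · have hset : Ico 0 μ₁ ∈ 𝓝[Ico 0 ν] μ := by
        filter_upwards [self_mem_nhdsWithin, mem_nhdsWithin_of_mem_nhds (Iio_mem_nhds hlt)]
          with r hr hr'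
        exact ⟨hr.1, hr'⟩
      refine ((hc.smooth_period μ ⟨hμν.1, hlt⟩).mono_of_mem_nhdsWithin
        hset).congr_of_eventuallyEq ?_ (by simp only [hc'lt μ hlt])
      filter_upwards [hset] with r hr
      simp only [hc'lt r hr.2]
    · have hgd := hgood μ hμν hge
      have h1 : ContDiffAt ℝ ∞ (fun μ => (β (waveInv μ)).2.2) μ := by
        have h2 : ContMDiffAt 𝓘(ℝ, ℝ) 𝓘(ℝ, ℝ × ℝ) ∞ (fun μ => (β (waveInv μ)).2) μ :=
          contMDiffAt_snd.comp μ (hβat μ hgd)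
        exact contDiffAt_snd.comp μ (contMDiffAt_iff_contDiffAt.1 h2)
      have heq : ∀ r ∈ Ioo (μ₁ - ε) (μ₁ + ε), ((c' r).2 : ℝ) = (β (waveInv r)).2.2 := by
        intro r hr
        obtain ⟨hs, hcs⟩ := hc'β r hr
        rw [hcs]
        rfl
      refine h1.contDiffWithinAt.congr_of_eventuallyEq ?_ (heq μ hgd)
      filter_upwards [mem_nhdsWithin_of_mem_nhds (isOpen_Ioo.mem_nhds hgd)] with r hr
      exact heq r hr
  · intro μ hμν
    rcases lt_or_ge μ μ₁ with hlt | hge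
    · rw [hc'lt μ hlt]
      exact hc.chord μ ⟨hμν.1, hlt⟩
    · exact (hbranch μ hμν hge).1
  · intro μ hμν
    rcases lt_or_ge μ μ₁ with hlt | hge
    · rw [hc'lt μ hlt]
      exact hc.nondegenerate μ ⟨hμν.1, hlt⟩
    · exact (hbranch μ hμν hge).2

end Final

/-! ### The Omega limit set -/

section OmegaLimit

variable {E : Type*} [NormedAddCommGroup E] [NormedSpace ℝ E] [FiniteDimensional ℝ E]
  {M : Type*} [TopologicalSpace M] [ChartedSpace E M] [IsManifold 𝓘(ℝ, E) ∞ M] [T2Space M]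
  [SecondCountableTopology M]
  {L₀ L₁ : Set M} {lam : OneForm E M} {H : ℝ → M → ℝ} {χ : M → ℝ}
  {φ : ℝ × M × ℝ × ℝ → M} {c : ℝ → PathSpace E L₀ L₁ × Ioi (0 : ℝ)}
  {c₀ : PathSpace E L₀ L₁ × Ioi (0 : ℝ)} {μ₁ : ℝ}

theorem waveInv_pos {μ : ℝ} (hμ : μ ∈ Ioc (0 : ℝ) 1) : 0 < waveInv μ := by
  have := waveInv_lt le_rfl hμ.2 hμ.1
  rwa [waveInv_zero] at this

/-- The period bounds confine the triples to a compact set of chord data with positive period. Limit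
points inherit the closed conditions, and their action is the limit of the actions by continuity. -/
theorem IsChordFamily.exists_compact_trace (hc : IsChordFamily lam H c₀ μ₁ c)
    (hμ : μ₁ ∈ Ioc (0 : ℝ) 1) (hH : IsContactFamily lam H) (hL₀ : IsExactLagrangian lam L₀)
    (hL₁ : IsExactLagrangian lam L₁) (h : CutoffFlow lam (reparam H) (Icc 0 Real.pi) χ φ) :
    ∃ (S : Set (M × ℝ × ℝ)) (A : ℝ), IsCompact S ∧ S ⊆ CutoffFlow.state φ L₀ L₁ ∧
      (∀ᶠ s in 𝓝[<] waveInv μ₁, trace c s ∈ S) ∧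
      ∀ z ∈ clusterSet (trace c) (waveInv μ₁), z.2.1 = waveInv μ₁ ∧ reparam H z.2.1 z.1 = 0 ∧
        CutoffFlow.chordAction lam (reparam H) φ z = A := by
  have hb := waveInv_pos hμ
  have hico : Ioo 0 (waveInv μ₁) ⊆ Ico 0 (waveInv μ₁) := Ioo_subset_Ico_self
  obtain ⟨⟨A, hA⟩, m₁, hm₁, m₂, hev⟩ := h.exists_tendsto_chordAction hL₀ hL₁ hH.isCompact_reparam
    hb (fun s hs => ⟨hs.1.le, hs.2.le.trans (waveInv_mem μ₁).2⟩) (hc.contMDiffOn_trace hμ)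
    (fun s _ => rfl) (fun s hs => (hc.trace_spec hμ h (hico hs)).1)
    (fun s hs => (hc.trace_spec hμ h (hico hs)).2.1)
  have hS := h.isCompact_boundedChords hL₀.1 hL₁.1 hH.isCompact_reparam m₁ m₂
  refine ⟨_, A, hS, fun z hz => ⟨hz.1, hz.2.1, hm₁.trans_le hz.2.2.2.1⟩, hev, fun z hz => ?_⟩
  have hzS := clusterSet_subset hS.isClosed hev hz
  obtain ⟨u, -, hu, huz⟩ := exists_seq_of_mem_clusterSet hz hb
  have h1 : Tendsto u atTop (𝓝 z.2.1) := ((continuous_snd.fst).tendsto z).comp huz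
  exact ⟨tendsto_nhds_unique h1 (hu.mono_right nhdsWithin_le_nhds), hzS.2.2.1.2,
    tendsto_nhds_unique ((h.continuous_chordAction.tendsto z).comp huz) (hA.comp hu)⟩

/-- If chords of the family converge, compactness of `S` gives a convergent subsequence of their
triples; the chord of its limit is the given one, because limits of paths are unique. Conversely,
convergence of triples implies convergence of chords by continuity of `toChord`. -/
theorem IsChordFamily.omegaLimitSet_eq (hc : IsChordFamily lam H c₀ μ₁ c)
    (hμ : μ₁ ∈ Ioc (0 : ℝ) 1) (h : CutoffFlow lam (reparam H) (Icc 0 Real.pi) χ φ)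
    {S : Set (M × ℝ × ℝ)} (hS : IsCompact S) (hSst : S ⊆ CutoffFlow.state φ L₀ L₁)
    (hev : ∀ᶠ s in 𝓝[<] waveInv μ₁, trace c s ∈ S) :
    omegaLimitSet μ₁ c =
      h.toChord '' (Subtype.val ⁻¹' clusterSet (trace c) (waveInv μ₁)) := by
  have : T2Space (PathSpace E L₀ L₁) := PathSpace.t2Space
  have hb := waveInv_pos hμ
  ext p
  constructor
  · rintro ⟨m, hm, hmμ, hmp⟩
    have hu : Tendsto (fun n => waveInv (m n)) atTop (𝓝[<] waveInv μ₁) :=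
      tendsto_nhdsWithin_iff.2 ⟨(continuous_waveInv.tendsto μ₁).comp hmμ,
        Eventually.of_forall fun n => (waveInv_mem_Ico hμ.2 (hm n)).2⟩
    choose hst _ hch using fun n => hc.trace_spec hμ h (waveInv_mem_Ico hμ.2 (hm n))
    have hwm : ∀ n, wave (waveInv (m n)) = m n := fun n =>
      wave_waveInv ⟨(hm n).1, (hm n).2.le.trans hμ.2⟩
    obtain ⟨z, hz, θ, hθ, hlim⟩ :=
      hS.isSeqCompact.subseq_of_frequently_in (hu.eventually hev).frequently
    have hzcl : z ∈ clusterSet (trace c) (waveInv μ₁) :=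
      MapClusterPt.of_comp (hu.comp hθ.tendsto_atTop) hlim.mapClusterPt
    refine ⟨⟨z, hSst hz⟩, hzcl, ?_⟩
    have h1 : Tendsto (fun n => (⟨_, hst (θ n)⟩ : CutoffFlow.state φ L₀ L₁)) atTop
        (𝓝 ⟨z, hSst hz⟩) := tendsto_subtype_rng.2 hlim
    have h2 := (h.continuous_toChord.tendsto _).comp h1
    refine tendsto_nhds_unique h2 ((hmp.comp hθ.tendsto_atTop).congr fun n => ?_)
    simp only [Function.comp_apply]
    rw [hch, hwm]
  · rintro ⟨z, hz, rfl⟩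
    obtain ⟨u, hu, hub, huz⟩ := exists_seq_of_mem_clusterSet hz hb
    have hu' : ∀ n, u n ∈ Ico 0 (waveInv μ₁) := fun n => Ioo_subset_Ico_self (hu n)
    refine ⟨fun n => wave (u n), fun n => wave_mem_Ico ⟨hμ.1.le, hμ.2⟩ (hu' n), ?_, ?_⟩
    · have h1 := (contDiff_wave.continuous.tendsto (waveInv μ₁)).comp
        (hub.mono_right nhdsWithin_le_nhds)
      rwa [wave_waveInv ⟨hμ.1.le, hμ.2⟩] at h1
    · choose hst _ hch using fun n => hc.trace_spec hμ h (hu' n)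
      have h1 : Tendsto (fun n => (⟨_, hst n⟩ : CutoffFlow.state φ L₀ L₁)) atTop (𝓝 z) :=
        tendsto_subtype_rng.2 huz
      exact ((h.continuous_toChord.tendsto _).comp h1).congr hch

end OmegaLimit

end Chords

/-! ### The main theorem -/

theorem theoremA
    {E : Type*} [NormedAddCommGroup E] [NormedSpace ℝ E] [FiniteDimensional ℝ E]
    {M : Type*} [TopologicalSpace M] [T2Space M] [SecondCountableTopology M]
    [ChartedSpace E M] [IsManifold 𝓘(ℝ, E) ∞ M]
    (lam : Chords.OneForm E M) (hlam : Chords.IsExactSymplectic lam)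
    (L₀ L₁ : Set M)
    (hL₀ : Chords.IsExactLagrangian lam L₀) (hL₁ : Chords.IsExactLagrangian lam L₁)
    (H : ℝ → M → ℝ) (hH : Chords.IsContactFamily lam H)
    (c₀ : Chords.PathSpace E L₀ L₁ × Ioi (0 : ℝ))
    (μInf : ℝ) (hμ : μInf ∈ Ioc (0 : ℝ) 1)
    (c : ℝ → Chords.PathSpace E L₀ L₁ × Ioi (0 : ℝ))
    (hc : Chords.IsChordFamily lam H c₀ μInf c)
    (hmax : ∀ b ∈ Ioc (0 : ℝ) 1, ∀ c', Chords.IsChordFamily lam H c₀ b c' → b ≤ μInf) :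
    (Chords.omegaLimitSet μInf c).Nonempty ∧
    IsCompact (Chords.omegaLimitSet μInf c) ∧
    IsConnected (Chords.omegaLimitSet μInf c) ∧
    (∀ p ∈ Chords.omegaLimitSet μInf c, Chords.IsChord lam (H μInf) p) ∧
    (∃ a : ℝ, ∀ p ∈ Chords.omegaLimitSet μInf c, Chords.action lam (H μInf) p = a) ∧
    (μInf < 1 →
      ∀ p ∈ Chords.omegaLimitSet μInf c, ¬ Chords.Nondegenerate lam (H μInf) p) ∧
    (μInf = 1 → (Chords.omegaLimitSet μInf c).Nontrivial →
      ∀ p ∈ Chords.omegaLimitSet μInf c, ¬ Chords.Nondegenerate lam (H μInf) p) := by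
  obtain ⟨χ, φ, h⟩ := hH.exists_cutoffFlow hlam
  obtain ⟨S, A, hS, hSst, hev, hΩ⟩ := hc.exists_compact_trace hμ hH hL₀ hL₁ h
  have hb := Chords.waveInv_pos hμ
  have hμI : μInf ∈ Icc (0 : ℝ) 1 := Ioc_subset_Icc_self hμ
  set b := Chords.waveInv μInf with hbdef
  set Ω := Chords.clusterSet (Chords.trace c) b with hΩdef
  have hΩst : Ω ⊆ Chords.CutoffFlow.state φ L₀ L₁ :=
    (Chords.clusterSet_subset hS.isClosed hev).trans hSst
  have himg : (Subtype.val '' (Subtype.val ⁻¹' Ω : Set (Chords.CutoffFlow.state φ L₀ L₁))) = Ω := by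
    rw [Subtype.image_preimage_coe]
    exact inter_eq_right.2 hΩst
  have heq := hc.omegaLimitSet_eq hμ h hS hSst hev
  have hcpt : IsCompact (Subtype.val ⁻¹' Ω : Set (Chords.CutoffFlow.state φ L₀ L₁)) := by
    rw [Subtype.isCompact_iff, himg]
    exact Chords.isCompact_clusterSet hS hev
  have hΩpre : IsPreconnected Ω :=
    Chords.isPreconnected_clusterSet hS hev hb (hc.contMDiffOn_trace hμ).continuousOn
  have hpre : IsPreconnected (Subtype.val ⁻¹' Ω : Set (Chords.CutoffFlow.state φ L₀ L₁)) := by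
    rw [← IsInducing.subtypeVal.isPreconnected_image, himg]
    exact hΩpre
  have hne : (Chords.omegaLimitSet μInf c).Nonempty := by
    obtain ⟨z, hz⟩ := Chords.clusterSet_nonempty hS hev
    rw [heq]
    exact ⟨_, ⟨z, hΩst hz⟩, hz, rfl⟩
  have hbI : b ∈ Icc 0 Real.pi := Chords.waveInv_mem μInf
  have hHb : ∀ z ∈ Ω, Chords.reparam H z.2.1 = H μInf := fun z hz => by
    rw [(hΩ z hz).1, Chords.reparam_waveInv hμI]
  have hzI : ∀ z ∈ Ω, z.2.1 ∈ Icc 0 Real.pi := fun z hz => by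
    rw [(hΩ z hz).1]
    exact hbI
  -- Both degeneracy claims follow from this: a single non-degenerate limit chord forces `μInf = 1`
  -- and `Ω` to be one point.
  have hdeg : ∀ p ∈ Chords.omegaLimitSet μInf c, Chords.Nondegenerate lam (H μInf) p →
      μInf = 1 ∧ (Chords.omegaLimitSet μInf c).Subsingleton := by
    intro p hp hnd
    rw [heq] at hp
    obtain ⟨z, hz, rfl⟩ := hp
    have hzΩ : z.1 ∈ Ω := hz
    rw [← hHb z.1 hzΩ, h.nondegenerate_toChord_iff hL₀ hL₁ z (hzI _ hzΩ) (hΩ _ hzΩ).2.1] at hnd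
    obtain ⟨N, β, J, hN, hzN, hJ, hβ, hβs, huniq⟩ :=
      h.exists_branch hL₀ hL₁ (hΩ _ hzΩ).2.1 z.2.1 z.2.2.1 z.2.2.2 hnd
    have hbJ : b ∈ J ∧ z.1 = β b := by
      have h1 := huniq z.1 hzN z.2.1 z.2.2.1 (hΩ _ hzΩ).2.1
      rwa [(hΩ _ hzΩ).1] at h1
    -- All points of the cluster set have parameter `b`, and the branch has only one point over `b`;
    -- so the non-degenerate chord is isolated.
    have hΩN : ∀ w ∈ Ω, w ∈ N → w = z.1 := fun w hw hwN => by
      have h1 := (huniq w hwN (hΩst hw).1 (hΩst hw).2.1 (hΩ w hw).2.1).2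
      rw [(hΩ w hw).1] at h1
      exact h1.trans hbJ.2.symm
    -- A point outside `N` would make both `N` and the complement of `z` meet the connected set `Ω`,
    -- hence meet it simultaneously, against isolation.
    have hsub : Ω ⊆ N := by
      intro w hw
      by_contra hwN
      have hcov : Ω ⊆ N ∪ {z.1}ᶜ := fun y _ => by
        by_cases hy : y = z.1
        · exact Or.inl (by rw [hy]; exact hzN)
        · exact Or.inr hy
      obtain ⟨y, hy, hyN, hyz⟩ := hΩpre N {z.1}ᶜ hN isOpen_compl_singleton hcov
        ⟨z.1, hzΩ, hzN⟩ ⟨w, hw, fun hwz => hwN ((mem_singleton_iff.1 hwz) ▸ hzN)⟩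
      exact hyz (hΩN y hy hyN)
    refine ⟨?_, ?_⟩
    · by_contra hne1
      have hlt : μInf < 1 := lt_of_le_of_ne hμ.2 hne1
      -- Since the whole cluster set lies in `N`, the family eventually enters `N`, where the only
      -- chords are those of the branch.
      have hevβ : ∀ᶠ s in 𝓝[<] b, Chords.trace c s = β s := by
        filter_upwards [Chords.eventually_mem_of_clusterSet_subset hS hev hN hsub,
          Ioo_mem_nhdsLT hb] with s hs hs'
        obtain ⟨hst, hK, -⟩ := hc.trace_spec hμ h ⟨hs'.1.le, hs'.2⟩
        exact (huniq _ hs hst.1 hst.2.1 hK).2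
      obtain ⟨ν, hν, hμν, c', hc'⟩ := hc.exists_extension ⟨hμ.1, hlt⟩ h hL₀ hL₁ hJ hbJ.1 hβ
        (fun s hs => (hβs s hs).1) (fun s hs => ⟨(hβs s hs).2.1, (hβs s hs).2.2.1,
          (hβs s hs).2.2.2.2.1⟩) (fun s hs => (hβs s hs).2.2.2.1)
        (fun s hs => (hβs s hs).2.2.2.2.2) hevβ
      exact (hmax ν hν c' hc').not_gt hμν
    · rw [heq]
      refine Set.Subsingleton.image (fun x hx y hy => Subtype.ext ?_) _
      rw [hΩN _ hx (hsub hx), hΩN _ hy (hsub hy)]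
  refine ⟨hne, ?_, ⟨hne, ?_⟩, ?_, ⟨A, ?_⟩, ?_, ?_⟩
  · rw [heq]
    exact hcpt.image h.continuous_toChord
  · rw [heq]
    exact hpre.image _ h.continuous_toChord.continuousOn
  · rw [heq]
    rintro _ ⟨z, hz, rfl⟩
    rw [← hHb z.1 hz]
    exact h.isChord_toChord z (hzI _ hz) (hΩ _ hz).2.1
  · rw [heq]
    rintro _ ⟨z, hz, rfl⟩
    rw [← hHb z.1 hz, h.action_toChord z (hzI _ hz) (hΩ _ hz).2.1]
    exact (hΩ _ hz).2.2
  · exact fun hlt p hp hnd => hlt.ne (hdeg p hp hnd).1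
  · exact fun _ hnt p hp hnd => hnt.not_subsingleton (hdeg p hp hnd).2
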